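/- **Setting.** A *circuit* is a single-output straight-line program with operations $+,-,\times$ and no division; its *scalars* are the labels of its nodes of indegree $0$ that are not inputs. For $L,n\in\mathbb N$ let $W_{L,n}$ be the set of all $f\in\mathbb C[x_1,\dots,x_n]$ computed by a circuit with inputs $x_1,\dots,x_n$ and scalars in $\mathbb C$ that uses at most $L$ essential multiplications (multiplications of two non-constant intermediate results), and $\overline{W_{L,n}}$ its Zariski closure. Put $r=(L+n+1)^2$ and $m=4(L+n)^2+2$. Let $\mathcal D_{L,n}$ be a generic circuit for $W_{L,n}$: its inputs are $x_1,\dots,x_n$, its scalars are indeterminates $z_1,\dots,z_r$, and the polynomials obtained by specializing $z$ in $\mathbb C^r$ are exactly those of $W_{L,n}$. Let $\gamma_1,\dots,\gamma_m\in\mathbb Q^n$ be an identification sequence for $\overline{W_{L,n}}$: two elements of $\overline{W_{L,n}}$ with equal values at all $\gamma_k$ are equal. A *database* is a pair $(S,P)$ of constructible subsets of $\mathbb C^3$. For a database, $\Psi_{L,n}(S,P,z,x,y)$ says that $\mathcal D_{L,n}$, with its operations read off from the ternary relations $S$ (addition) and $P$ (multiplication), yields $y$ on input $x$ and scalars $z$;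 $\Delta_{L,n}(S,P)$ says that $S,P$ are graphs of binary operations on $\mathbb C$, that the class of maps $\mathbb C^n\to\mathbb C$ whose graphs are given by $\Psi_{L,n}(S,P,z,\cdot,\cdot)$ for some $z$ is nonempty, and that $\gamma_1,\dots,\gamma_m$ is an identification sequence for it; and $\Phi_{L,n}(S,P)$ denotes any $\mathrm{FO}(+,\times,0,1,=,S,P)$-formula in the free variables $u_1,\dots,u_m,x_1,\dots,x_n,y$ which on every database is equivalent to $$(\exists z_1)\cdots(\exists z_r)\Big(\Psi_{L,n}(S,P,z,x,y)\wedge\bigwedge_{k=1}^m\Psi_{L,n}(S,P,z,\gamma_k,u_k)\Big)\wedge\Delta_{L,n}(S,P).$$ Let a formula with free variables $u\in\mathbb C^m$ (parameters), $x\in\mathbb C^n$ (variables) and $y$ define, on a database, a nonempty set $A\subseteq\mathbb C^{m+n+1}$ whose fiber over each $u$ in its projection $\pi(A)\subseteq\mathbb C^m$ is the graph of a polynomial $f_u\in\mathbb C[x_1,\dots,x_n]$; the extended sample point query asks for a circuit evaluating $f_u$. Let $B,V$ be the Zariski closures of $A,\pi(A)$, suppose that $B$ is irreducible, $\pi(B)=V$,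 and all fibers of $B$ over $V$ are graphs of polynomials, and let $K=\mathbb C(V)$. A *branching-free representation* of the output is a circuit $\beta$ with inputs $x_1,\dots,x_n$ and scalars $\theta_1,\dots,\theta_s\in K$ such that (i) for each $u\in\pi(A)$ where all $\theta_i$ are defined, $\beta$ with scalars $\theta_i(u)$ computes $f_u$; (ii) for each $u\in V$, all $\mathbb C$-valued places of $K$ whose valuation ring extends the local ring of $V$ at $u$ (and which induce evaluation at $u$ on it) take one and the same finite value at $\theta_i$, for each $i$. A sequential procedure takes a database and a formula as input and writes a circuit, at most one node per unit of time. It is *branching-parsimonious* (on a class of inputs) if, on each input (of the class) whose query admits a branching-free representation, it halts and outputs one. **Theorem.** Let $D$ be the database in which $S$ and $P$ are the graphs of addition and multiplication of $\mathbb C$. 1. There are constants $C,a$ such that for each $n\ge1$ the choices of $\mathcal D_{n,n}$ (with at most $Cn^2$ nodes), $\gamma_1,\dots,\gamma_m$ and $\Phi_{n,n}(S,P)$ can be made so that $\Phi_{n,n}(S,P)$ is prenex, of length at most $Cn^2$ and with at most $a$ quantifier alternations. 2. For every $n$ and all choices of $\mathcal D_{n,n}$, $\gamma_1,\dots,\gamma_m$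 and $\Phi_{n,n}(S,P)$, the extended sample point query associated with $\Phi_{n,n}(S,P)$ on $D$ admits a branching-free representation, and the output of every branching-parsimonious procedure on this input has at least $2^n$ scalars. The procedure requires sequential time at least $2^n$, thus $2^{\Omega(n)}$. 3. There is $a\in\mathbb N$ such that no procedure that is branching-parsimonious on $D$ and all prenex formulas with at most $a$ quantifier alternations runs in polynomial time: for every polynomial $p$ there is such a formula, whose query admits a branching-free representation, on which the procedure runs for more than $p(N)$ steps, where $N$ is the length of the formula plus the number of its free variables. -/

import Mathlib

noncomputable section

open MvPolynomial

/-! ### Arithmetic circuits -/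

/-- A node of a division-free arithmetic circuit.  Inputs are labelled by `ι`, the non-input nodes
of indegree zero (the scalars) by `κ`.  Operands are positions of nodes in the circuit. -/
inductive Gate (ι κ : Type) : Type
  | input (i : ι)
  | scalar (c : κ)
  | add (a b : ℕ)
  | sub (a b : ℕ)
  | mul (a b : ℕ)

/-- A single-output division-free circuit (straight-line program): the list of its nodes in a
topological order.  The output is the last node. -/
abbrev Circuit (ι κ : Type) : Type := List (Gate ι κ)

namespace Circuit

variable {ι κ R : Type}

/-- The node at position `p`, if there is one. -/
def nodeAt (c : Circuit ι κ) (p : ℕ) : Option (Gate ι κ) := (c)[p]?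

/-- `v p` is the value of the node `p`, for inputs `x` and scalars `z`, where `S` and `P` are the
ternary relations used as graphs of the addition and of the multiplication.  Operands must
precede the node they enter. -/
def Trace (c : Circuit ι κ) (S P : R → R → R → Prop) (x : ι → R) (z : κ → R) (v : ℕ → R) : Prop :=
  ∀ (p : ℕ) (g : Gate ι κ), nodeAt c p = some g →
    match g with
    | .input i => v p = x i
    | .scalar s => v p = z s
    | .add a b => a < p ∧ b < p ∧ S (v a) (v b) (v p)
    | .sub a b => a < p ∧ b < p ∧ S (v p) (v b) (v a)
    | .mul a b => a < p ∧ b < p ∧ P (v a) (v b) (v p)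

/-- `y` is a value of the output node of `c`, with `S` and `P` in the role of the arithmetic. -/
def RelEval (c : Circuit ι κ) (S P : R → R → R → Prop) (x : ι → R) (z : κ → R) (y : R) : Prop :=
  ∃ v : ℕ → R, c.Trace S P x z v ∧ ∃ p : ℕ, p + 1 = c.length ∧ v p = y

/-- The graph of the addition. -/
def addGraph (R : Type) [CommRing R] (a b c : R) : Prop := a + b = c

/-- The graph of the multiplication. -/
def mulGraph (R : Type) [CommRing R] (a b c : R) : Prop := a * b = c

/-- The circuit evaluates, over the commutative ring `R`, to `y`. -/
def Computes [CommRing R] (c : Circuit ι κ) (x : ι → R) (z : κ → R) (y : R) : Prop :=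
  c.RelEval (addGraph R) (mulGraph R) x z y

/-- The number of different scalars of the circuit. -/
def numScalars (c : Circuit ι κ) : ℕ := {s : κ | Gate.scalar s ∈ c}.ncard

end Circuit

/-- `f` is computed by a division-free circuit with scalars from `ℂ` and at most `L` essential
multiplications, i.e. multiplications of two intermediate results neither of which is constant.
Additions, subtractions and multiplications by scalars are free. -/
def NonscalarSizeLE {n : ℕ} (L : ℕ) (f : MvPolynomial (Fin n) ℂ) : Prop :=
  ∃ (c : Circuit (Fin n) ℂ) (v : ℕ → MvPolynomial (Fin n) ℂ),
    c.Trace (Circuit.addGraph _) (Circuit.mulGraph _) X C v ∧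
    (∃ p : ℕ, p + 1 = c.length ∧ v p = f) ∧
    {p : ℕ | ∃ a b : ℕ, c.nodeAt p = some (Gate.mul a b) ∧
      v a ∉ Set.range (C : ℂ → MvPolynomial (Fin n) ℂ) ∧
      v b ∉ Set.range (C : ℂ → MvPolynomial (Fin n) ℂ)}.ncard ≤ L

/-- The class `W_{L,n}` of the polynomials of nonscalar complexity at most `L`. -/
def lowComplexity (L n : ℕ) : Set (MvPolynomial (Fin n) ℂ) := {f | NonscalarSizeLE L f}

/-- Zariski closure in affine space over `ℂ`. -/
def zariskiClosure {σ : Type} (s : Set (σ → ℂ)) : Set (σ → ℂ) :=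
  zeroLocus ℂ (vanishingIdeal ℂ s)

/-- The coefficient vector of a polynomial. -/
def coeffVector {n : ℕ} (f : MvPolynomial (Fin n) ℂ) : (Fin n →₀ ℕ) → ℂ := fun d => coeff d f

/-- The Zariski closure of a set of polynomials, with respect to their coefficients.  For a set of
polynomials of bounded degree this is the closure in the finite dimensional space of all
polynomials of that degree. -/
def polyClosure {n : ℕ} (W : Set (MvPolynomial (Fin n) ℂ)) : Set (MvPolynomial (Fin n) ℂ) :=
  {f | coeffVector f ∈ zariskiClosure (coeffVector '' W)}

/-- The complex point with the given rational coordinates. -/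
def ratPoint {n : ℕ} (a : Fin n → ℚ) : Fin n → ℂ := fun i => (a i : ℂ)

/-- An identification sequence for a class of polynomials. -/
def IsIdentificationSeq {n m : ℕ} (W : Set (MvPolynomial (Fin n) ℂ)) (γ : Fin m → Fin n → ℚ) :
    Prop :=
  ∀ f ∈ W, ∀ g ∈ W, (∀ k, eval (ratPoint (γ k)) f = eval (ratPoint (γ k)) g) → f = g

/-- The number `r` of scalars of the generic circuit. -/
def numGenericScalars (L n : ℕ) : ℕ := (L + n + 1) ^ 2

/-- The length `m` of the identification sequences. -/
def numPoints (L n : ℕ) : ℕ := 4 * (L + n) ^ 2 + 2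

/-- `c` is a generic circuit for `W_{L,n}`: the polynomials obtained from it by specialising the
`r` scalars are exactly the elements of `W_{L,n}`. -/
def IsGenericCircuit (L n : ℕ) (c : Circuit (Fin n) (Fin (numGenericScalars L n))) : Prop :=
  ∀ f : MvPolynomial (Fin n) ℂ,
    f ∈ lowComplexity L n ↔
      ∃ ζ : Fin (numGenericScalars L n) → ℂ, c.Computes X (fun s => C (ζ s)) f

/-! ### Constraint databases over the schema `(S, P)` and their query language -/

/-- Constructible subsets of `ℂ ^ k`: the Boolean algebra generated by the hypersurfaces. -/
inductive IsConstructibleSet {k : ℕ} : Set (Fin k → ℂ) → Prop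
  | zeros (p : MvPolynomial (Fin k) ℂ) : IsConstructibleSet {x | eval x p = 0}
  | compl {s : Set (Fin k → ℂ)} (hs : IsConstructibleSet s) : IsConstructibleSet sᶜ
  | inter {s t : Set (Fin k → ℂ)} (hs : IsConstructibleSet s) (ht : IsConstructibleSet t) :
      IsConstructibleSet (s ∩ t)

/-- A constraint database over `ℂ` with two ternary relations. -/
structure Database : Type where
  S : Set (Fin 3 → ℂ)
  P : Set (Fin 3 → ℂ)
  constructible_S : IsConstructibleSet S
  constructible_P : IsConstructibleSet P

namespace Database

/-- The relation `S`, as a ternary predicate. -/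
def relS (D : Database) (a b c : ℂ) : Prop := ![a, b, c] ∈ D.S

/-- The relation `P`, as a ternary predicate. -/
def relP (D : Database) (a b c : ℂ) : Prop := ![a, b, c] ∈ D.P

/-- The database in which `S` and `P` are the graphs of the addition and of the multiplication. -/
def arithmetic : Database where
  S := {w | w 0 + w 1 = w 2}
  P := {w | w 0 * w 1 = w 2}
  constructible_S := by
    have h := IsConstructibleSet.zeros (X 0 + X 1 - X 2 : MvPolynomial (Fin 3) ℂ)
    simpa [sub_eq_zero] using h
  constructible_P := by
    have h := IsConstructibleSet.zeros (X 0 * X 1 - X 2 : MvPolynomial (Fin 3) ℂ)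
    simpa [sub_eq_zero] using h

end Database

/-- Function symbols of `FO(+,×,0,1,=,S,P)`. -/
inductive QueryFunc : ℕ → Type
  | zero : QueryFunc 0
  | one : QueryFunc 0
  | add : QueryFunc 2
  | mul : QueryFunc 2

/-- Relation symbols of `FO(+,×,0,1,=,S,P)` besides equality. -/
inductive QueryRel : ℕ → Type
  | S : QueryRel 3
  | P : QueryRel 3

/-- The query language `FO(+,×,0,1,=,S,P)`. -/
def queryLang : FirstOrder.Language.{0, 0} := ⟨QueryFunc, QueryRel⟩

/-- The complex field, expanded by the relations of a database. -/
@[reducible] def Database.toStructure (D : Database) : queryLang.Structure ℂ where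
  funMap {n} (f : QueryFunc n) :=
    match n, f with
    | _, .zero => fun _ => 0
    | _, .one => fun _ => 1
    | _, .add => fun w => w 0 + w 1
    | _, .mul => fun w => w 0 * w 1
  RelMap {n} (R : QueryRel n) :=
    match n, R with
    | _, .S => fun w => w ∈ D.S
    | _, .P => fun w => w ∈ D.P

/-- The free variables `u_1,…,u_m` (parameters), `x_1,…,x_n` (variables) and `y`. -/
abbrev QueryVar (m n : ℕ) : Type := Fin m ⊕ (Fin n ⊕ Unit)

/-- The point `(u, x, y)` of `ℂ ^ (m + n + 1)`. -/
def mkPoint {m n : ℕ} (u : Fin m → ℂ) (x : Fin n → ℂ) (y : ℂ) : QueryVar m n → ℂ :=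
  Sum.elim u (Sum.elim x fun _ => y)

/-- The formula holds on the database `D` at the point `w`. -/
def Holds {α : Type} (D : Database) (φ : queryLang.Formula α) (w : α → ℂ) : Prop :=
  @FirstOrder.Language.Formula.Realize queryLang ℂ D.toStructure α φ w

/-- The number of symbols of a term. -/
def termSize {α : Type} : queryLang.Term α → ℕ
  | .var _ => 1
  | .func _ ts => 1 + ∑ i, termSize (ts i)

/-- The length of a formula: its number of symbols. -/
def formulaSize {α : Type} : {k : ℕ} → queryLang.BoundedFormula α k → ℕ
  | _, .falsum => 1
  | _, .equal s t => 1 + termSize s + termSize t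
  | _, .rel _ ts => 1 + ∑ i, termSize (ts i)
  | _, .imp φ ψ => 1 + formulaSize φ + formulaSize ψ
  | _, .all φ => 1 + formulaSize φ

/-- `PrenexAlt q a φ`: the formula `φ` is prenex with at most `a` quantifier alternations; the
leading quantifier block is existential for `q = false` and universal for `q = true`. -/
inductive PrenexAlt {α : Type} :
    Bool → ℕ → {k : ℕ} → queryLang.BoundedFormula α k → Prop
  | of_isQF {k : ℕ} {φ : queryLang.BoundedFormula α k} (q : Bool) (h : φ.IsQF) : PrenexAlt q 0 φ
  | ex {k a : ℕ} {φ : queryLang.BoundedFormula α (k + 1)} (h : PrenexAlt false a φ) :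
      PrenexAlt false a φ.ex
  | all {k a : ℕ} {φ : queryLang.BoundedFormula α (k + 1)} (h : PrenexAlt true a φ) :
      PrenexAlt true a φ.all
  | alternate {k a : ℕ} {φ : queryLang.BoundedFormula α k} {q : Bool} (h : PrenexAlt q a φ) :
      PrenexAlt (!q) (a + 1) φ

/-- A prenex formula with at most `a` quantifier alternations. -/
def HasAlternationsLE {α : Type} (a : ℕ) (φ : queryLang.Formula α) : Prop :=
  ∃ q : Bool, PrenexAlt q a φ

/-! ### The formulas `Φ_{L,n}(S, P)` -/

section Formulas

variable {n r m : ℕ} (c : Circuit (Fin n) (Fin r)) (γ : Fin m → Fin n → ℚ) (D : Database)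

/-- The meaning of `Ψ(S, P, z, x, y)` on `D`: the circuit `c`, with scalars `z` and inputs `x`, has
the output `y`, if its operations are read off from the relations of `D`. -/
def Psi (z : Fin r → ℂ) (x : Fin n → ℂ) (y : ℂ) : Prop :=
  c.RelEval D.relS D.relP x z y

/-- The class of the maps `ℂ ^ n → ℂ` defined on `D` by `Ψ(S, P)`. -/
def objectClass : Set ((Fin n → ℂ) → ℂ) :=
  {F | ∃ z : Fin r → ℂ, ∀ x y, Psi c D z x y ↔ F x = y}

/-- A ternary relation on `ℂ` is the graph of a binary operation. -/
def IsOperationGraph (Q : ℂ → ℂ → ℂ → Prop) : Prop := ∀ a b, ∃! d, Q a b d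

/-- The meaning of the closed formula `Δ(S, P)` on `D`: the relations are graphs of binary
operations, `γ` is an identification sequence for the object class, and this class is nonempty. -/
def Delta : Prop :=
  IsOperationGraph D.relS ∧ IsOperationGraph D.relP ∧
  (∀ F ∈ objectClass c D, ∀ G ∈ objectClass c D,
    (∀ k, F (ratPoint (γ k)) = G (ratPoint (γ k))) → F = G) ∧
  (objectClass c D).Nonempty

/-- The meaning of `Φ(S, P, u, x, y)` on `D`. -/
def Phi (u : Fin m → ℂ) (x : Fin n → ℂ) (y : ℂ) : Prop :=
  (∃ z : Fin r → ℂ, Psi c D z x y ∧ ∀ k, Psi c D z (ratPoint (γ k)) (u k)) ∧ Delta c γ D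

/-- The first-order formula `φ` expresses `Φ(S, P, u, x, y)`, on every database. -/
def ExpressesPhi (φ : queryLang.Formula (QueryVar m n)) : Prop :=
  ∀ (D : Database) (u : Fin m → ℂ) (x : Fin n → ℂ) (y : ℂ),
    Holds D φ (mkPoint u x y) ↔ Phi c γ D u x y

end Formulas

/-! ### Extended sample point queries -/

/-- An input of a query evaluation procedure: a database and a formula. -/
structure QueryInput : Type where
  m : ℕ
  n : ℕ
  D : Database
  φ : queryLang.Formula (QueryVar m n)

/-- The projection to the space of parameters. -/
def paramProj {m n : ℕ} (A : Set (QueryVar m n → ℂ)) : Set (Fin m → ℂ) :=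
  (fun w i => w (Sum.inl i)) '' A

/-- The fiber of `A` over `u` is the graph of the polynomial `f`. -/
def FiberIsGraph {m n : ℕ} (A : Set (QueryVar m n → ℂ)) (u : Fin m → ℂ)
    (f : MvPolynomial (Fin n) ℂ) : Prop :=
  ∀ x y, mkPoint u x y ∈ A ↔ y = eval x f

/-- `A` is a parameterised family of polynomial functions. -/
def IsPolynomialFamily {m n : ℕ} (A : Set (QueryVar m n → ℂ)) : Prop :=
  A.Nonempty ∧ ∀ u ∈ paramProj A, ∃ f, FiberIsGraph A u f

/-- A place of `K` with values in `ℂ ∪ {∞}`: a ring homomorphism on the subring of the elements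
with finite value, such that every other element has an inverse of value zero. -/
structure ComplexPlace (K : Type) [CommRing K] : Type where
  finite : Subring K
  value : finite →+* ℂ
  inv_of_not_mem : ∀ a : K, a ∉ finite → ∃ b : finite, a * (b : K) = 1 ∧ value b = 0

namespace QueryInput

variable (I : QueryInput)

/-- The set `A` defined by the formula on the database. -/
def A : Set (QueryVar I.m I.n → ℂ) := {w | Holds I.D I.φ w}

/-- The Zariski closure `B` of `A`. -/
def B : Set (QueryVar I.m I.n → ℂ) := zariskiClosure I.A

/-- The Zariski closure `V` of the projection of `A` to the space of parameters. -/
def V : Set (Fin I.m → ℂ) := zariskiClosure (paramProj I.A)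

/-- The coordinate ring of `V`. -/
abbrev coordRing : Type :=
  MvPolynomial (Fin I.m) ℂ ⧸ vanishingIdeal (σ := Fin I.m) ℂ I.V

/-- The ring of rational functions of `V` (the function field, if `V` is irreducible). -/
abbrev K : Type := FractionRing I.coordRing

/-- The rational function on `V` given by a polynomial. -/
def ofPoly (p : MvPolynomial (Fin I.m) ℂ) : I.K :=
  algebraMap I.coordRing I.K (Ideal.Quotient.mk _ p)

/-- The rational function `θ` is defined at `u`, with value `t`. -/
def HasValueAt (θ : I.K) (u : Fin I.m → ℂ) (t : ℂ) : Prop :=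
  ∃ p q : MvPolynomial (Fin I.m) ℂ,
    eval u q ≠ 0 ∧ θ * I.ofPoly q = I.ofPoly p ∧ t * eval u q = eval u p

/-- The valuation ring of the place extends (dominates) the local ring of `V` at `u`. -/
def IsCenteredAt (ρ : ComplexPlace I.K) (u : Fin I.m → ℂ) : Prop :=
  ∀ p : MvPolynomial (Fin I.m) ℂ, ∃ h : I.ofPoly p ∈ ρ.finite, ρ.value ⟨_, h⟩ = eval u p

/-- The assumptions under which branching-free representations are considered: `A` is a family of
polynomial functions, its closure `B` is irreducible, projects onto `V`, and is a family of
polynomial functions as well (extending `A`, since `A ⊆ B`). -/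
def IsAdmissible : Prop :=
  IsPolynomialFamily I.A ∧ (vanishingIdeal (σ := QueryVar I.m I.n) ℂ I.A).IsPrime ∧
  paramProj I.B = I.V ∧ IsPolynomialFamily I.B

/-- `β` is a branching-free representation of the output of the extended sample point query. -/
def IsBranchingFreeRep (β : Circuit (Fin I.n) I.K) : Prop :=
  I.IsAdmissible ∧
  (∀ u ∈ paramProj I.A, ∀ val : I.K → ℂ,
    (∀ θ, Gate.scalar θ ∈ β → I.HasValueAt θ u (val θ)) →
    ∀ f : MvPolynomial (Fin I.n) ℂ, FiberIsGraph I.A u f →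
      β.Computes X (fun θ => C (val θ)) f) ∧
  (∀ u ∈ I.V, ∀ θ, Gate.scalar θ ∈ β →
    ∃ t : ℂ, ∀ ρ : ComplexPlace I.K, I.IsCenteredAt ρ u →
      ∃ h : θ ∈ ρ.finite, ρ.value ⟨θ, h⟩ = t)

/-- The extended sample point query admits a branching-free output representation. -/
def AdmitsBranchingFree : Prop := ∃ β, I.IsBranchingFreeRep β

/-- The size of an input over a fixed database: length of the formula plus number of free
variables. -/
def size : ℕ := formulaSize I.φ + (I.m + I.n + 1)

end QueryInput

/-! ### Procedures and their sequential time -/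

/-- A deterministic sequential procedure which writes an output circuit.  In each unit of time it
changes its internal state and appends at most one node to the output circuit, or it halts
(`none`).  No restriction is put on the computations done on the internal states, so that lower
time bounds in this model hold in every model where writing down a node takes a unit of time. -/
structure Procedure : Type 1 where
  State : Type
  start : QueryInput → State
  next : (I : QueryInput) → State → Option (State × Option (Gate (Fin I.n) I.K))

namespace Procedure

variable (Q : Procedure)

/-- The state and the part of the output circuit written so far, after `t` steps. -/
def config (I : QueryInput) : ℕ → Q.State × Circuit (Fin I.n) I.K
  | 0 => (Q.start I, [])
  | t + 1 =>
    match Q.next I (config I t).1 with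
    | none => config I t
    | some (s, o) => (s, (config I t).2 ++ o.toList)

/-- On the input `I` the procedure halts after exactly `t` steps, with output `β`. -/
def OutputsInTime (I : QueryInput) (β : Circuit (Fin I.n) I.K) (t : ℕ) : Prop :=
  Q.next I (Q.config I t).1 = none ∧ (∀ t' < t, Q.next I (Q.config I t').1 ≠ none) ∧
    (Q.config I t).2 = β

/-- On all inputs from the class `𝓘`, the procedure produces a branching-free representation of the
output of the extended sample point query whenever there is one. -/
def IsBranchingParsimonious (𝓘 : Set QueryInput) : Prop :=
  ∀ I ∈ 𝓘, I.AdmitsBranchingFree →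
    ∃ (β : Circuit (Fin I.n) I.K) (t : ℕ), Q.OutputsInTime I β t ∧ I.IsBranchingFreeRep β

end Procedure

/-- The inputs consisting of the arithmetic database and a prenex formula with at most `a`
quantifier alternations. -/
def boundedAlternationInputs (a : ℕ) : Set QueryInput :=
  {I | I.D = Database.arithmetic ∧ HasAlternationsLE a I.φ}

end

/-! Let `F` be the generic member of the class, a polynomial in `x` with coefficients in P = ℂ[z].
Its specialisations form a cone, and its values at the points `γ` generate a copy of ℂ[V] inside P.

Existence. The coefficients of `F` are integral over ℂ[V] (`isIntegral_coeff`). At a place that is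
finite on the values and infinite at a coefficient, division by a dominant coefficient would produce
a nonzero limit of the cone whose values at `γ` all vanish, and `γ` could not tell it from 0. The
coefficients also belong to ℂ(V) (`exists_coeff_mul_eq`), since otherwise two conjugates over ℂ(V)
would specialise to different limits with equal values. Hence the coefficients themselves can serve
as scalars: at a place centred at u their values form a limit of the family with values u, and there
is at most one such limit (`admitsBranchingFree`). The admissibility of the query comes from lying
over for the same integral extension.

Lower bound (`le_numScalars`). The scalars θ of a branching-free representation are finite at every
place centred on V, so they are integral over ℂ[V]. Scaling the family by an indeterminate T embeds
ℂ(V) into the fraction field of P[T] and multiplies every coefficient of `F` by T. The image of θ is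
integral over P[T], hence lies in P[T]; putting T = 0 shows that its constant term is integral over
ℂ, hence a number. Without divisions, the linear term in T of anything computed is then a ℂ-linear
combination of the linear terms of the scalars. So all coefficients of `F` lie in a space spanned by
one vector per scalar. The powers (X + a)^(2^n), obtained by n squarings, show that 2^n of these
coefficients are linearly independent. A procedure that writes at most one node per step needs as
many steps.

Short formulas. A computation with n essential multiplications can be normalised to a chain of n
products of linear combinations of 1, the inputs and earlier products
(`nonscalarSizeLE_iff_chainResult`). This gives a generic circuit with O(n²) nodes and without
subtractions. The identification points are (t, t^N, t^(N²), …) with N = 2^(n+2), t = 2^(A^k) and A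
= 2^(95n²). By Kronecker substitution the difference of two members becomes a univariate polynomial
vanishing at all these t. If it were nonzero, products of powers of the t's could be reduced modulo
it. A pigeonhole argument over the parameters then yields two different sets of powers of two with
equal sums (`eq_zero_of_roots`), contradicting uniqueness of binary expansions. Such points are
definable by repeated squaring, and a universal quantifier lets all k share the same squaring
variables. So `Phi` has a prenex form of the shape ∃∀∃ and of quadratic length, and 2^n exceeds
every polynomial in that length. -/

noncomputable section

open MvPolynomial

/-! ### Evaluation of circuits over commutative rings -/

namespace Circuit

variable {ι κ R T : Type}

/-- All operands precede the nodes they enter. -/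
def WellFormed (c : Circuit ι κ) : Prop :=
  ∀ (p : ℕ) (g : Gate ι κ), nodeAt c p = some g →
    match g with
    | .input _ => True
    | .scalar _ => True
    | .add a b => a < p ∧ b < p
    | .sub a b => a < p ∧ b < p
    | .mul a b => a < p ∧ b < p

/-- The value of the node `p` over a commutative ring. -/
def nodeVal [CommRing R] (c : Circuit ι κ) (x : ι → R) (z : κ → R) (p : ℕ) : R :=
  match nodeAt c p with
  | none => 0
  | some (.input i) => x i
  | some (.scalar s) => z s
  | some (.add a b) =>
    if _h : a < p ∧ b < p then nodeVal c x z a + nodeVal c x z b else 0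
  | some (.sub a b) =>
    if _h : a < p ∧ b < p then nodeVal c x z a - nodeVal c x z b else 0
  | some (.mul a b) =>
    if _h : a < p ∧ b < p then nodeVal c x z a * nodeVal c x z b else 0
termination_by p
decreasing_by all_goals omega

section

variable [CommRing R] [CommRing T] {c : Circuit ι κ} {x : ι → R} {z : κ → R} {p a b : ℕ}

theorem nodeVal_none (h : nodeAt c p = none) : nodeVal c x z p = 0 := by
  rw [nodeVal, h]

theorem nodeVal_input {i : ι} (h : nodeAt c p = some (.input i)) : nodeVal c x z p = x i := by
  rw [nodeVal, h]

theorem nodeVal_scalar {s : κ} (h : nodeAt c p = some (.scalar s)) : nodeVal c x z p = z s := by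
  rw [nodeVal, h]

theorem nodeVal_add (h : nodeAt c p = some (.add a b)) (hab : a < p ∧ b < p) :
    nodeVal c x z p = nodeVal c x z a + nodeVal c x z b := by
  rw [nodeVal, h]; simp [hab]

theorem nodeVal_sub (h : nodeAt c p = some (.sub a b)) (hab : a < p ∧ b < p) :
    nodeVal c x z p = nodeVal c x z a - nodeVal c x z b := by
  rw [nodeVal, h]; simp [hab]

theorem nodeVal_mul (h : nodeAt c p = some (.mul a b)) (hab : a < p ∧ b < p) :
    nodeVal c x z p = nodeVal c x z a * nodeVal c x z b := by
  rw [nodeVal, h]; simp [hab]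

theorem WellFormed.trace_nodeVal (hc : c.WellFormed) :
    c.Trace (addGraph R) (mulGraph R) x z (nodeVal c x z) := by
  intro p g hg
  have := hc p g hg
  cases g with
  | input i => exact nodeVal_input hg
  | scalar s => exact nodeVal_scalar hg
  | add a b => exact ⟨this.1, this.2, (nodeVal_add hg this).symm⟩
  | sub a b => exact ⟨this.1, this.2, by simp [addGraph, nodeVal_sub hg this]⟩
  | mul a b => exact ⟨this.1, this.2, (nodeVal_mul hg this).symm⟩

omit [CommRing R] in
theorem Trace.wellFormed {S P : R → R → R → Prop} {v : ℕ → R} (hv : c.Trace S P x z v) :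
    c.WellFormed := by
  intro p g hg
  have := hv p g hg
  cases g with
  | input i => trivial
  | scalar s => trivial
  | add a b => exact ⟨this.1, this.2.1⟩
  | sub a b => exact ⟨this.1, this.2.1⟩
  | mul a b => exact ⟨this.1, this.2.1⟩

theorem Trace.eq_nodeVal {v : ℕ → R} (hv : c.Trace (addGraph R) (mulGraph R) x z v) :
    ∀ p < c.length, v p = nodeVal c x z p := by
  intro p
  induction p using Nat.strong_induction_on with
  | _ p ih =>
    intro hp
    obtain ⟨g, hg⟩ : ∃ g, nodeAt c p = some g := ⟨_, List.getElem?_eq_getElem hp⟩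
    have := hv p g hg
    cases g with
    | input i => rw [nodeVal_input hg]; exact this
    | scalar s => rw [nodeVal_scalar hg]; exact this
    | add a b =>
      obtain ⟨h1, h2, h3⟩ := this
      rw [nodeVal_add hg ⟨h1, h2⟩, ← ih a h1 (h1.trans hp), ← ih b h2 (h2.trans hp)]
      exact h3.symm
    | sub a b =>
      obtain ⟨h1, h2, h3⟩ := this
      rw [nodeVal_sub hg ⟨h1, h2⟩, ← ih a h1 (h1.trans hp), ← ih b h2 (h2.trans hp)]
      exact eq_sub_of_add_eq h3
    | mul a b =>
      obtain ⟨h1, h2, h3⟩ := this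
      rw [nodeVal_mul hg ⟨h1, h2⟩, ← ih a h1 (h1.trans hp), ← ih b h2 (h2.trans hp)]
      exact h3.symm

theorem computes_iff {y : R} :
    c.Computes x z y ↔ c.WellFormed ∧ c ≠ [] ∧ nodeVal c x z (c.length - 1) = y := by
  constructor
  · rintro ⟨v, hv, p, hp, rfl⟩
    refine ⟨hv.wellFormed, by rintro rfl; simp at hp, ?_⟩
    rw [hv.eq_nodeVal p (by omega), ← hp, Nat.add_sub_cancel]
  · rintro ⟨h1, h2, rfl⟩
    have := List.length_pos_iff.mpr h2
    exact ⟨_, h1.trace_nodeVal, c.length - 1, by omega, rfl⟩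

/-- The operations at the nodes are ring operations. This is what allows inputs and scalars to be
specialised before or after the evaluation. -/
theorem map_nodeVal (φ : R →+* T) (p : ℕ) :
    φ (nodeVal c x z p) = nodeVal c (fun i => φ (x i)) (fun s => φ (z s)) p := by
  induction p using Nat.strong_induction_on with
  | _ p ih =>
    rcases hg : nodeAt c p with _ | g
    · simp [nodeVal_none hg]
    cases g with
    | input i => simp [nodeVal_input hg]
    | scalar s => simp [nodeVal_scalar hg]
    | add a b =>
      rw [nodeVal, nodeVal, hg]
      by_cases h : a < p ∧ b < p
      · simp [h, ih]
      · simp [h]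
    | sub a b =>
      rw [nodeVal, nodeVal, hg]
      by_cases h : a < p ∧ b < p
      · simp [h, ih]
      · simp [h]
    | mul a b =>
      rw [nodeVal, nodeVal, hg]
      by_cases h : a < p ∧ b < p
      · simp [h, ih]
      · simp [h]

theorem mem_of_nodeAt {g : Gate ι κ} (h : nodeAt c p = some g) : g ∈ c :=
  List.mem_of_getElem? h

/-- Circuits contain no divisions, so they cannot leave a subring. The lower bound applies this to
polynomials over `linearTermSubring`. -/
theorem nodeVal_mem (Λ : Subring R) (hx : ∀ i, x i ∈ Λ) (hz : ∀ s, Gate.scalar s ∈ c → z s ∈ Λ)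
    (p : ℕ) : nodeVal c x z p ∈ Λ := by
  induction p using Nat.strong_induction_on with
  | _ p ih =>
    rcases hg : nodeAt c p with _ | g
    · simp [nodeVal_none hg]
    cases g with
    | input i => rw [nodeVal_input hg]; exact hx i
    | scalar s => rw [nodeVal_scalar hg]; exact hz s (mem_of_nodeAt hg)
    | add a b =>
      rw [nodeVal, hg]
      by_cases h : a < p ∧ b < p
      · simpa [h] using Λ.add_mem (ih a h.1) (ih b h.2)
      · simp [h]
    | sub a b =>
      rw [nodeVal, hg]
      by_cases h : a < p ∧ b < p
      · simpa [h] using Λ.sub_mem (ih a h.1) (ih b h.2)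
      · simp [h]
    | mul a b =>
      rw [nodeVal, hg]
      by_cases h : a < p ∧ b < p
      · simpa [h] using Λ.mul_mem (ih a h.1) (ih b h.2)
      · simp [h]

theorem nodeVal_congr {z' : κ → R} (hz : ∀ s, Gate.scalar s ∈ c → z s = z' s) (p : ℕ) :
    nodeVal c x z p = nodeVal c x z' p := by
  induction p using Nat.strong_induction_on with
  | _ p ih =>
    rcases hg : nodeAt c p with _ | g
    · simp [nodeVal_none hg]
    cases g with
    | input i => rw [nodeVal_input hg, nodeVal_input hg]
    | scalar s => rw [nodeVal_scalar hg, nodeVal_scalar hg]; exact hz s (mem_of_nodeAt hg)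
    | add a b =>
      rw [nodeVal, nodeVal, hg]
      by_cases h : a < p ∧ b < p
      · simp [h, ih]
      · simp [h]
    | sub a b =>
      rw [nodeVal, nodeVal, hg]
      by_cases h : a < p ∧ b < p
      · simp [h, ih]
      · simp [h]
    | mul a b =>
      rw [nodeVal, nodeVal, hg]
      by_cases h : a < p ∧ b < p
      · simp [h, ih]
      · simp [h]

theorem nodeAt_append_left {e : Circuit ι κ} (h : p < c.length) :
    nodeAt (c ++ e) p = nodeAt c p :=
  List.getElem?_append_left h

theorem nodeVal_append {e : Circuit ι κ} (hp : p < c.length) :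
    nodeVal (c ++ e) x z p = nodeVal c x z p := by
  induction p using Nat.strong_induction_on with
  | _ p ih =>
    have hn : nodeAt (c ++ e) p = nodeAt c p := nodeAt_append_left hp
    rw [nodeVal, nodeVal, hn]
    rcases nodeAt c p with _ | g
    · rfl
    cases g with
    | input i => rfl
    | scalar s => rfl
    | add a b =>
      by_cases h : a < p ∧ b < p
      · simp [h, ih a h.1 (h.1.trans hp), ih b h.2 (h.2.trans hp)]
      · simp [h]
    | sub a b =>
      by_cases h : a < p ∧ b < p
      · simp [h, ih a h.1 (h.1.trans hp), ih b h.2 (h.2.trans hp)]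
      · simp [h]
    | mul a b =>
      by_cases h : a < p ∧ b < p
      · simp [h, ih a h.1 (h.1.trans hp), ih b h.2 (h.2.trans hp)]
      · simp [h]

theorem nodeAt_concat (g : Gate ι κ) : nodeAt (c ++ [g]) c.length = some g := by
  simp [nodeAt]

theorem nodeAt_concat_eq_some {g g' : Gate ι κ} (h : nodeAt (c ++ [g]) p = some g') :
    nodeAt c p = some g' ∨ p = c.length ∧ g' = g := by
  rcases lt_or_ge p c.length with hp | hp
  · left; rwa [nodeAt_append_left hp] at h
  · right
    obtain ⟨hlt, -⟩ := List.getElem?_eq_some_iff.mp h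
    have : p = c.length := by simp at hlt; omega
    subst this
    rw [nodeAt_concat] at h
    exact ⟨rfl, (Option.some.inj h).symm⟩

theorem nodeVal_concat_add (ha : a < c.length) (hb : b < c.length) :
    nodeVal (c ++ [Gate.add a b]) x z c.length = nodeVal c x z a + nodeVal c x z b := by
  rw [nodeVal_add (nodeAt_concat _) ⟨ha, hb⟩, nodeVal_append ha, nodeVal_append hb]

theorem nodeVal_concat_mul (ha : a < c.length) (hb : b < c.length) :
    nodeVal (c ++ [Gate.mul a b]) x z c.length = nodeVal c x z a * nodeVal c x z b := by
  rw [nodeVal_mul (nodeAt_concat _) ⟨ha, hb⟩, nodeVal_append ha, nodeVal_append hb]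

theorem nodeVal_concat_input (i : ι) : nodeVal (c ++ [Gate.input i]) x z c.length = x i :=
  nodeVal_input (nodeAt_concat _)

theorem nodeVal_concat_scalar (s : κ) : nodeVal (c ++ [Gate.scalar s]) x z c.length = z s :=
  nodeVal_scalar (nodeAt_concat _)

end

theorem WellFormed.concat {c : Circuit ι κ} (hc : c.WellFormed) {g : Gate ι κ}
    (hg : match g with
      | .input _ => True
      | .scalar _ => True
      | .add a b => a < c.length ∧ b < c.length
      | .sub a b => a < c.length ∧ b < c.length
      | .mul a b => a < c.length ∧ b < c.length) : WellFormed (c ++ [g]) := by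
  intro p g' hp
  rcases nodeAt_concat_eq_some hp with h | ⟨rfl, rfl⟩
  · exact hc p g' h
  · exact hg

theorem wellFormed_nil : WellFormed ([] : Circuit ι κ) := by
  intro p g h; simp [nodeAt] at h

theorem finite_scalars (c : Circuit ι κ) : {s : κ | Gate.scalar s ∈ c}.Finite := by
  refine Set.Finite.of_finite_image (f := Gate.scalar (ι := ι)) ?_ (by intro a _ b _ h; simpa using h)
  exact (List.finite_toSet c).subset (by rintro _ ⟨s, hs, rfl⟩; exact hs)

theorem numScalars_le_length (c : Circuit ι κ) : c.numScalars ≤ c.length := by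
  classical
  have : (Gate.scalar (ι := ι)) '' {s : κ | Gate.scalar s ∈ c} ⊆ {g | g ∈ c} := by
    rintro _ ⟨s, hs, rfl⟩; exact hs
  have h1 := Set.ncard_le_ncard this (List.finite_toSet c)
  rw [Set.ncard_image_of_injective _ (fun a b h => by simpa using h)] at h1
  refine h1.trans ?_
  have : {g | g ∈ c} = (c.toFinset : Set (Gate ι κ)) := by ext; simp
  rw [this, Set.ncard_coe_finset]
  exact c.toFinset_card_le

/-- Multiplying the last node of a circuit by powers of the inputs. -/
theorem exists_mul_monomial {n : ℕ} {c : Circuit (Fin n) κ} (hc : c.WellFormed) (hne : c ≠ [])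
    (d : Fin n →₀ ℕ) :
    ∃ e : Circuit (Fin n) κ, (c ++ e).WellFormed ∧ (∀ s, Gate.scalar s ∉ e) ∧
      ∀ (R : Type) [CommRing R] (x : Fin n → R) (z : κ → R),
        nodeVal (c ++ e) x z ((c ++ e).length - 1) =
          nodeVal c x z (c.length - 1) * ∏ i, x i ^ d i := by
  induction d using Finsupp.induction_linear generalizing c with
  | zero => exact ⟨[], by simpa, by simp, by simp⟩
  | add d₁ d₂ h₁ h₂ =>
    obtain ⟨e₁, hw₁, hs₁, hv₁⟩ := h₁ hc hne
    obtain ⟨e₂, hw₂, hs₂, hv₂⟩ := h₂ hw₁ (by simp [hne])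
    rw [List.append_assoc] at hw₂
    refine ⟨e₁ ++ e₂, hw₂, ?_, ?_⟩
    · intro s hs; rcases List.mem_append.mp hs with h | h
      exacts [hs₁ s h, hs₂ s h]
    · intro R _ x z
      have := hv₂ R x z
      rw [List.append_assoc] at this
      rw [this, hv₁, mul_assoc, ← Finset.prod_mul_distrib]
      simp [pow_add]
  | single i k =>
    induction k with
    | zero => exact ⟨[], by simpa, by simp, by simp⟩
    | succ k ih =>
      obtain ⟨e, hw, hs, hv⟩ := ih
      have hpos : 0 < (c ++ e).length := List.length_pos_iff.mpr (by simp [hne])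
      have hw1 : (c ++ e ++ [Gate.input i]).WellFormed := hw.concat trivial
      have hl1 : (c ++ e ++ [Gate.input i]).length = (c ++ e).length + 1 := by
        rw [List.length_append, List.length_singleton]
      have hw2 := hw1.concat (g := Gate.mul ((c ++ e).length - 1) (c ++ e).length)
        ⟨by omega, by omega⟩
      have h3 : c ++ (e ++ [Gate.input i] ++ [Gate.mul ((c ++ e).length - 1) (c ++ e).length]) =
          c ++ e ++ [Gate.input i] ++ [Gate.mul ((c ++ e).length - 1) (c ++ e).length] := by simp
      refine ⟨e ++ [Gate.input i] ++ [Gate.mul ((c ++ e).length - 1) (c ++ e).length], ?_, ?_, ?_⟩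
      · rwa [h3]
      · intro s h; simp at h; exact hs s h
      · intro R _ x z
        rw [h3, List.length_append (bs := [Gate.mul _ _]), List.length_singleton,
          Nat.add_sub_cancel, nodeVal_concat_mul (by omega) (by omega),
          nodeVal_append (by omega), hv, nodeVal_concat_input, mul_assoc]
        congr 1
        have hk : ∀ m : ℕ, ∏ j, x j ^ (Finsupp.single i m) j = x i ^ m := by
          intro m
          rw [Finset.prod_eq_single i] <;> simp +contextual [eq_comm]
        rw [hk, hk, pow_succ]

/-- A circuit for a polynomial which is given by its coefficients. -/
theorem exists_circuit_sum {n : ℕ} (s : Finset (Fin n →₀ ℕ)) (hs : s.Nonempty)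
    (θ : (Fin n →₀ ℕ) → κ) :
    ∃ β : Circuit (Fin n) κ, (∀ t, Gate.scalar t ∈ β ↔ ∃ d ∈ s, t = θ d) ∧
      ∀ (R : Type) [CommRing R] (x : Fin n → R) (z : κ → R),
        β.Computes x z (∑ d ∈ s, z (θ d) * ∏ i, x i ^ d i) := by
  classical
  simp only [computes_iff]
  induction hs using Finset.Nonempty.cons_induction with
  | singleton d =>
    have hw : WellFormed ([] ++ [Gate.scalar (θ d)] : Circuit (Fin n) κ) :=
      wellFormed_nil.concat (g := Gate.scalar (θ d)) trivial
    obtain ⟨e, hw, hse, hv⟩ := exists_mul_monomial hw (by simp) d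
    refine ⟨_, ?_, fun R _ x z => ⟨hw, by simp, ?_⟩⟩
    · intro t
      simp [hse t]
    · rw [hv]
      have := nodeVal_concat_scalar (c := []) (x := x) (z := z) (θ d)
      simp only [List.length_nil] at this
      simp only [List.nil_append, List.length_singleton, Nat.sub_self] at *
      rw [this]; simp
  | cons d s hd hs ih =>
    obtain ⟨β, hβ, hcomp⟩ := ih
    -- Being well formed and nonempty does not depend on the ring; ℤ is an arbitrary choice for
    -- reading it off.
    have hw0 : β.WellFormed := (hcomp ℤ (fun _ => 0) (fun _ => 0)).1
    have hne : β ≠ [] := (hcomp ℤ (fun _ => 0) (fun _ => 0)).2.1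
    have hpos := List.length_pos_iff.mpr hne
    have hw1 := hw0.concat (g := Gate.scalar (θ d)) trivial
    obtain ⟨e, hw, hse, hv⟩ := exists_mul_monomial hw1 (by simp) d
    have hl : β.length + 1 ≤ (β ++ [Gate.scalar (θ d)] ++ e).length := by simp
    have hw2 := hw.concat (g := Gate.add ((β ++ [Gate.scalar (θ d)] ++ e).length - 1)
      (β.length - 1)) ⟨by omega, by omega⟩
    refine ⟨_, ?_, fun R _ x z => ⟨hw2, by simp, ?_⟩⟩
    · intro t
      simp [hse t, hβ t, or_comm]
    · rw [Finset.sum_cons, ← (hcomp R x z).2.2, List.length_append (bs := [Gate.add _ _]),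
        List.length_singleton, Nat.add_sub_cancel, nodeVal_concat_add (by omega) (by omega), hv,
        List.length_append (bs := [Gate.scalar _]), List.length_singleton, Nat.add_sub_cancel,
        nodeVal_concat_scalar, List.append_assoc, nodeVal_append (c := β) (by omega)]

end Circuit

theorem aeval_eq_eval_apply {R τ : Type*} [CommSemiring R] (x : τ → R) (p : MvPolynomial τ R) :
    aeval x p = eval x p := rfl

/-! ### Complex points of algebras of finite type -/

/-- Nullstellensatz: the residue field is finite over ℂ by Zariski's lemma, hence equal to ℂ. -/
theorem exists_algHom_ker_eq {T : Type*} [CommRing T] [Algebra ℂ T] [Algebra.FiniteType ℂ T]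
    (M : Ideal T) [M.IsMaximal] : ∃ φ : T →ₐ[ℂ] ℂ, RingHom.ker φ = M := by
  let _ := Ideal.Quotient.field M
  have : Module.Finite ℂ (T ⧸ M) := finite_of_finite_type_of_isJacobsonRing ℂ (T ⧸ M)
  have hb := IsAlgClosed.algebraMap_bijective_of_isIntegral (k := ℂ) (K := T ⧸ M)
  let e : ℂ ≃ₐ[ℂ] (T ⧸ M) := AlgEquiv.ofBijective (Algebra.ofId ℂ (T ⧸ M)) hb
  refine ⟨e.symm.toAlgHom.comp (Ideal.Quotient.mkₐ ℂ M), ?_⟩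
  ext t
  simp [RingHom.mem_ker, Ideal.Quotient.eq_zero_iff_mem]

/-- Rabinowitsch's trick: the localisation at x is nonzero and of finite type, and any complex point
of it makes x invertible. -/
theorem exists_algHom_ne_zero {T : Type*} [CommRing T] [IsDomain T] [Algebra ℂ T]
    [Algebra.FiniteType ℂ T] {x : T} (hx : x ≠ 0) : ∃ φ : T →ₐ[ℂ] ℂ, φ x ≠ 0 := by
  have : Algebra.FiniteType T (Localization.Away x) := IsLocalization.finiteType_of_monoid_fg (.powers x) _
  have : Algebra.FiniteType ℂ (Localization.Away x) := .trans (S := T) inferInstance this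
  have : Nontrivial (Localization.Away x) :=
    (IsLocalization.injective (Localization.Away x)
      (powers_le_nonZeroDivisors_of_noZeroDivisors hx)).nontrivial
  obtain ⟨M, hM⟩ := Ideal.exists_maximal (Localization.Away x)
  obtain ⟨φ, -⟩ := exists_algHom_ker_eq M
  refine ⟨φ.comp (IsScalarTower.toAlgHom ℂ T _), ?_⟩
  have := (IsLocalization.Away.algebraMap_isUnit (S := Localization.Away x) x).map φ
  simpa using this.ne_zero

theorem exists_ringHom_of_finite {k L : Type*} [Field k] [Field L] [Algebra k L]
    [Module.Finite k L] (f : k →+* ℂ) : ∃ g : L →+* ℂ, ∀ a, g (algebraMap k L a) = f a := by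
  let _ := f.toAlgebra
  let l : L →ₐ[k] ℂ := IsAlgClosed.lift
  exact ⟨l.toRingHom, l.commutes⟩

/-! ### Extension of places -/

namespace ComplexPlace

variable {K : Type} [Field K]

/-- A homomorphism to `ℂ` from a subring of `K`, extending the given one, which cannot be
extended further. -/
theorem exists_maximal_extension (A₀ : Subring K) (φ₀ : A₀ →+* ℂ) :
    ∃ (A : Subring K) (φ : A →+* ℂ), (∃ h : A₀ ≤ A, ∀ a : A₀, φ ⟨a, h a.2⟩ = φ₀ a) ∧
      ∀ (B : Subring K) (ψ : B →+* ℂ) (h : A ≤ B), (∀ a : A, ψ ⟨a, h a.2⟩ = φ a) → B ≤ A := by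
  -- A partial homomorphism is encoded by its graph, a subring of K × ℂ in which only 0 lies over 0.
  -- This condition passes to unions of chains, so Zorn's lemma applies.
  let G₀ : Subring (K × ℂ) := (A₀.subtype.prod φ₀).range
  have hG₀ : G₀ ∈ {G : Subring (K × ℂ) | ∀ c, ((0 : K), c) ∈ G → c = 0} := by
    rintro c ⟨a, ha⟩
    simp only [RingHom.prod_apply, Prod.mk.injEq, Subring.subtype_apply, ZeroMemClass.coe_eq_zero]
      at ha
    rw [← ha.2, ha.1, map_zero]
  obtain ⟨G, hG₀G, hG⟩ := zorn_le_nonempty₀ {G : Subring (K × ℂ) | ∀ c, ((0 : K), c) ∈ G → c = 0}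
    (by
      intro S hS hch G hGS
      refine ⟨sSup S, ?_, fun z hz => le_sSup hz⟩
      intro c hc
      obtain ⟨H, hH, hcH⟩ := (Subring.mem_sSup_of_directedOn ⟨G, hGS⟩ hch.directedOn).mp hc
      exact hS hH c hcH) G₀ hG₀
  let f : G →+* K := (RingHom.fst K ℂ).comp G.subtype
  have hf : Function.Injective f := by
    rw [injective_iff_map_eq_zero]
    rintro ⟨⟨a, c⟩, hac⟩ h
    have ha : a = 0 := h
    subst ha
    have := hG.prop c hac
    subst this; rfl
  let e : G ≃+* f.range := RingEquiv.ofBijective f.rangeRestrict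
    ⟨fun a b h => hf congr(($h : K)), f.rangeRestrict_surjective⟩
  have he : ∀ g : G, (e g : K) = g.1.1 := fun g => rfl
  let φ : f.range →+* ℂ := ((RingHom.snd K ℂ).comp G.subtype).comp e.symm.toRingHom
  have hφ : ∀ (a : K) (c : ℂ) (h : (a, c) ∈ G) (ha : a ∈ f.range), φ ⟨a, ha⟩ = c := by
    intro a c h ha
    have : e.symm ⟨a, ha⟩ = ⟨(a, c), h⟩ := by
      rw [RingEquiv.symm_apply_eq]; ext; rfl
    change (e.symm ⟨a, ha⟩).1.2 = c
    rw [this]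
  refine ⟨f.range, φ, ⟨?_, ?_⟩, ?_⟩
  · intro a ha
    exact ⟨⟨(a, φ₀ ⟨a, ha⟩), hG₀G ⟨⟨a, ha⟩, rfl⟩⟩, rfl⟩
  · intro a
    exact hφ _ _ (hG₀G ⟨a, rfl⟩) _
  · intro B ψ h hψ
    have hle : G ≤ (B.subtype.prod ψ).range := by
      rintro ⟨a, c⟩ hac
      have ha : a ∈ f.range := ⟨⟨(a, c), hac⟩, rfl⟩
      refine ⟨⟨a, h ha⟩, ?_⟩
      have := hψ ⟨a, ha⟩
      simp only [RingHom.prod_apply, Subring.subtype_apply]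
      rw [this, hφ a c hac ha]
    have hB : (B.subtype.prod ψ).range ≤ G := by
      refine hG.le_of_ge ?_ hle
      rintro c ⟨b, hb⟩
      simp only [RingHom.prod_apply, Prod.mk.injEq, Subring.subtype_apply,
        ZeroMemClass.coe_eq_zero] at hb
      rw [← hb.2, hb.1, map_zero]
    intro b hb
    exact ⟨⟨(b, ψ ⟨b, hb⟩), hB ⟨⟨b, hb⟩, rfl⟩⟩, rfl⟩

section Maximal

variable {A : Subring K} {φ : A →+* ℂ}
  (hmax : ∀ (B : Subring K) (ψ : B →+* ℂ) (h : A ≤ B), (∀ a : A, ψ ⟨a, h a.2⟩ = φ a) → B ≤ A)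

include hmax

/-- φ extends to the localisation of A at ker φ, where a is a unit; by maximality this localisation
is already contained in A. -/
theorem isUnit_of_maximal {a : A} (ha : φ a ≠ 0) : IsUnit a := by
  have hP : (RingHom.ker φ).IsPrime := RingHom.ker_isPrime φ
  let B := LocalSubring.ofPrime A (RingHom.ker φ)
  let ψ : B.toSubring →+* ℂ := IsLocalization.lift (M := (RingHom.ker φ).primeCompl) (g := φ)
    (fun y => isUnit_iff_ne_zero.mpr y.2)
  have hB := hmax B.toSubring ψ (LocalSubring.le_ofPrime A _)
    (fun a => IsLocalization.lift_eq (M := (RingHom.ker φ).primeCompl) _ a)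
  have hu : IsUnit (algebraMap A B.toSubring a) :=
    IsLocalization.map_units (M := (RingHom.ker φ).primeCompl) B.toSubring ⟨a, ha⟩
  obtain ⟨b, hb⟩ := hu.exists_right_inv
  refine IsUnit.of_mul_eq_one ⟨b, hB b.2⟩ ?_
  have := congr_arg (fun t : B.toSubring => (t : K)) hb
  exact Subtype.ext this

theorem isLocalRing_of_maximal : IsLocalRing A := by
  refine IsLocalRing.of_nonunits_add ?_
  intro a b ha hb hab
  have h0 : ∀ {a : A}, a ∈ nonunits A → φ a = 0 := fun h => by
    by_contra h'; exact h (isUnit_of_maximal hmax h')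
  have := hab.map φ
  rw [map_add, h0 ha, h0 hb, add_zero] at this
  exact not_isUnit_zero this

/-- The residue field of A[y] at M is of finite type over the field A/ker φ, hence finite over it.
So the map to ℂ induced by φ extends to A[y], and maximality forces A[y] ⊆ A. -/
theorem mem_of_maximal {y : K} (M : Ideal (Algebra.adjoin A {y})) [M.IsMaximal]
    (hM : (RingHom.ker φ).map (algebraMap A (Algebra.adjoin A {y})) ≤ M) : y ∈ A := by
  have hloc := isLocalRing_of_maximal hmax
  have hu : ∀ a : A, a ∉ RingHom.ker φ → IsUnit a := fun a ha => isUnit_of_maximal hmax ha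
  have hP : (RingHom.ker φ).IsMaximal := by
    refine Ideal.isMaximal_iff.mpr ⟨by simp, fun J x hJ hx hxJ => ?_⟩
    exact (J.eq_top_iff_one).mp (J.eq_top_of_isUnit_mem hxJ (hu x hx))
  have hlies : M.LiesOver (RingHom.ker φ) := ⟨(hP.eq_of_le
    (Ideal.comap_ne_top _ (Ideal.IsMaximal.ne_top ‹_›)) (Ideal.map_le_iff_le_comap.mp hM))⟩
  let _ := Ideal.Quotient.field M
  let _ := Ideal.Quotient.field (RingHom.ker φ)
  have : Algebra.FiniteType A (Algebra.adjoin A {y}) :=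
    (Algebra.adjoin A {y}).fg_iff_finiteType.mp (by
      simpa using Subalgebra.fg_adjoin_finset (R := A) {y})
  have : Algebra.FiniteType (A ⧸ RingHom.ker φ) (Algebra.adjoin A {y} ⧸ M) := inferInstance
  have := finite_of_finite_type_of_isJacobsonRing (A ⧸ RingHom.ker φ) (Algebra.adjoin A {y} ⧸ M)
  obtain ⟨l, hl⟩ := exists_ringHom_of_finite (L := Algebra.adjoin A {y} ⧸ M)
    (Ideal.Quotient.lift (RingHom.ker φ) φ (fun a ha => ha))
  let ψ : (Algebra.adjoin A {y}).toSubring →+* ℂ := l.comp (Ideal.Quotient.mk M)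
  refine hmax (Algebra.adjoin A {y}).toSubring ψ (fun a ha => (Algebra.adjoin A {y}).algebraMap_mem ⟨a, ha⟩) ?_
    (Algebra.self_mem_adjoin_singleton A y)
  intro a
  exact hl (Ideal.Quotient.mk _ a)

end Maximal

/-- Every homomorphism to `ℂ` from a subring of a field extends to a place. -/
theorem exists_extension (A₀ : Subring K) (φ₀ : A₀ →+* ℂ) :
    ∃ ρ : ComplexPlace K, ∃ h : A₀ ≤ ρ.finite, ∀ a : A₀, ρ.value ⟨a, h a.2⟩ = φ₀ a := by
  obtain ⟨A, φ, hA, hmax⟩ := exists_maximal_extension A₀ φ₀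
  have hloc := isLocalRing_of_maximal hmax
  -- A is maximal for domination among the local subrings of K, and such subrings are valuation
  -- rings.
  have hM : IsMax (⟨A⟩ : LocalSubring K) := by
    intro B hB
    obtain ⟨hle, hlocal⟩ := hB
    have := B.isLocalRing
    refine ⟨fun y hy => ?_, ?_⟩
    · let C := Algebra.adjoin A {y}
      have hC : C.toSubring ≤ B.toSubring := by
        intro t ht
        induction ht using Algebra.adjoin_induction with
        | mem x hx => rw [Set.mem_singleton_iff.mp hx]; exact hy
        | algebraMap r => exact hle r.2
        | add x y _ _ hx hy => exact B.toSubring.add_mem hx hy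
        | mul x y _ _ hx hy => exact B.toSubring.mul_mem hx hy
      let i : C →+* B.toSubring := Subring.inclusion hC
      -- If ker φ generated the unit ideal of A[y], it would do so in B. But B dominates A, so it
      -- sends ker φ into its maximal ideal.
      have hne : (RingHom.ker φ).map (algebraMap A C) ≠ ⊤ := by
        intro htop
        have h1 : (RingHom.ker φ).map (i.comp (algebraMap A C)) = ⊤ := by
          rw [← Ideal.map_map, htop, Ideal.map_top]
        have h2 : (RingHom.ker φ).map (i.comp (algebraMap A C)) ≤
            IsLocalRing.maximalIdeal B.toSubring := by
          rw [Ideal.map_le_iff_le_comap]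
          intro a ha
          rw [Ideal.mem_comap, IsLocalRing.mem_maximalIdeal]
          intro hu
          have : IsUnit a := hlocal.map_nonunit a hu
          exact (this.map φ).ne_zero ha
        rw [h1, top_le_iff] at h2
        exact (IsLocalRing.maximalIdeal.isMaximal B.toSubring).ne_top h2
      obtain ⟨M, hM, hMle⟩ := Ideal.exists_le_maximal _ hne
      exact mem_of_maximal hmax M hMle
    · refine ⟨fun b hb => ?_⟩
      obtain ⟨c, hc⟩ := hb.exists_right_inv
      exact IsUnit.of_mul_eq_one ⟨c, hle c.2⟩ (Subtype.ext congr(($hc : K)))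
  obtain ⟨V, hV⟩ := LocalSubring.exists_valuationRing_of_isMax hM
  have hVA : ∀ x, x ∈ V ↔ x ∈ A := fun x => by
    have := congr_arg (fun L : LocalSubring K => x ∈ L.toSubring) hV
    exact iff_of_eq this
  refine ⟨⟨A, φ, fun x hx => ?_⟩, hA⟩
  have hx0 : x ≠ 0 := by rintro rfl; exact hx A.zero_mem
  have hinv : x⁻¹ ∈ A := (hVA _).mp ((V.mem_or_inv_mem x).resolve_left (fun h => hx ((hVA x).mp h)))
  refine ⟨⟨x⁻¹, hinv⟩, mul_inv_cancel₀ hx0, ?_⟩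
  by_contra h
  obtain ⟨⟨b, hb⟩, hb1⟩ := (isUnit_of_maximal hmax h).exists_right_inv
  have : x⁻¹ * b = 1 := congr(($hb1 : K))
  have : b = x := by field_simp at this; exact this
  exact hx (this ▸ hb)

/-- An element which is not integral over an algebra of finite type is infinite at a place that
is finite on this algebra. -/
theorem exists_not_mem_finite [Algebra ℂ K] {m : ℕ} (v : Fin m → K) {x : K}
    (hx : ¬ (aeval (R := ℂ) v).toRingHom.IsIntegralElem x) :
    ∃ (ρ : ComplexPlace K) (u : Fin m → ℂ), (∀ p : MvPolynomial (Fin m) ℂ,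
      ∃ h : aeval v p ∈ ρ.finite, ρ.value ⟨_, h⟩ = eval u p) ∧ x ∉ ρ.finite := by
  set A := (aeval (R := ℂ) v).range with hA
  have hx0 : x ≠ 0 := by rintro rfl; exact hx (RingHom.isIntegralElem_zero _)
  let _ : Invertible x⁻¹ := invertibleOfNonzero (inv_ne_zero hx0)
  let T := Algebra.adjoin A {x⁻¹}
  let y : T := ⟨x⁻¹, Algebra.self_mem_adjoin_singleton A _⟩
  -- If x⁻¹ were invertible in A[x⁻¹], then x would be a polynomial in x⁻¹ over A; clearing
  -- denominators gives a monic equation for x.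
  have hspan : Ideal.span {y} ≠ ⊤ := by
    intro htop
    obtain ⟨p, hp, hpx⟩ :=
      Algebra.exists_aeval_invOf_eq_zero_of_idealMap_adjoin_sup_span_eq_top x⁻¹
        (⊥ : Ideal A) bot_ne_top (top_unique <| htop.ge.trans le_sup_right)
    have hpm : p.Monic := by simpa [Polynomial.Monic, sub_eq_zero] using hp
    obtain ⟨q, rfl⟩ := Polynomial.map_surjective _ (aeval (R := ℂ) v).rangeRestrict_surjective p
    -- Integrality is stated over the polynomial ring, so the equation over A has to be lifted to a
    -- polynomial that is still monic.
    obtain ⟨q', hq', -, hqm⟩ := Polynomial.lifts_and_degree_eq_and_monic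
      ((Polynomial.mem_lifts _).mpr ⟨q, rfl⟩) hpm
    rw [← hq', Polynomial.aeval_def, Polynomial.eval₂_map, invOf_eq_inv, inv_inv] at hpx
    exact hx ⟨q', hqm, hpx⟩
  obtain ⟨M, hM, hyM⟩ := Ideal.exists_le_maximal _ hspan
  have h1 : Algebra.FiniteType ℂ A := Algebra.FiniteType.of_surjective
    (aeval (R := ℂ) v).rangeRestrict (aeval (R := ℂ) v).rangeRestrict_surjective
  have h2 : Algebra.FiniteType A T :=
    T.fg_iff_finiteType.mp (by
      simpa [T] using Subalgebra.fg_adjoin_finset (R := A) {x⁻¹})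
  have h3 : Algebra.FiniteType ℂ T := .trans h1 h2
  obtain ⟨φ, hφ⟩ := exists_algHom_ker_eq M
  obtain ⟨ρ, hρ, hval⟩ := exists_extension T.toSubring φ.toRingHom
  have hmem : ∀ p : MvPolynomial (Fin m) ℂ, aeval v p ∈ T := fun p =>
    T.algebraMap_mem (⟨_, p, rfl⟩ : A)
  let ψ : MvPolynomial (Fin m) ℂ →ₐ[ℂ] ℂ := (φ.comp (IsScalarTower.toAlgHom ℂ A T)).comp
    (aeval (R := ℂ) v).rangeRestrict
  refine ⟨ρ, fun i => ψ (X i), fun p => ⟨hρ (hmem p), ?_⟩, ?_⟩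
  · rw [hval ⟨_, hmem p⟩]
    have : ψ = aeval (fun i => ψ (X i)) := by ext i; simp
    change ψ p = _
    exact (DFunLike.congr_fun this p).trans (aeval_eq_eval_apply _ p)
  · intro hxf
    -- The place was chosen with x⁻¹ ↦ 0. If x were finite, then x · x⁻¹ = 1 would have the value 0.
    have hyf : x⁻¹ ∈ ρ.finite := hρ y.2
    have h0 : ρ.value ⟨x⁻¹, hyf⟩ = 0 := by
      rw [hval y]
      have : y ∈ RingHom.ker φ := by
        rw [hφ]; exact hyM (Ideal.subset_span rfl)
      exact this
    have h1 : (⟨x, hxf⟩ * ⟨x⁻¹, hyf⟩ : ρ.finite) = 1 := Subtype.ext (mul_inv_cancel₀ hx0)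
    have := congr_arg ρ.value h1
    rw [map_mul, h0, mul_zero, map_one] at this
    exact zero_ne_one this

end ComplexPlace

/-! ### Zariski closures; values and integrality at places -/

theorem mem_zariskiClosure {σ : Type} {s : Set (σ → ℂ)} {w : σ → ℂ} :
    w ∈ zariskiClosure s ↔ ∀ p : MvPolynomial σ ℂ, (∀ a ∈ s, eval a p = 0) → eval w p = 0 := by
  simp [zariskiClosure, mem_zeroLocus_iff, mem_vanishingIdeal_iff, aeval_eq_eval_apply]

theorem subset_zariskiClosure {σ : Type} (s : Set (σ → ℂ)) : s ⊆ zariskiClosure s :=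
  fun _ ha => mem_zariskiClosure.mpr fun _ hp => hp _ ha

theorem mem_vanishingIdeal_zariskiClosure {σ : Type} {s : Set (σ → ℂ)} {p : MvPolynomial σ ℂ} :
    p ∈ vanishingIdeal ℂ (zariskiClosure s) ↔ ∀ a ∈ s, eval a p = 0 := by
  simp only [mem_vanishingIdeal_iff, aeval_eq_eval_apply]
  exact ⟨fun h a ha => h a (subset_zariskiClosure s ha),
    fun h w hw => mem_zariskiClosure.mp hw p h⟩

namespace ComplexPlace

section

variable {K : Type} [CommRing K] [Algebra ℂ K] (ρ : ComplexPlace K)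

theorem exists_value_aeval
    (hC : ∀ a : ℂ, ∃ h : algebraMap ℂ K a ∈ ρ.finite, ρ.value ⟨_, h⟩ = a)
    {τ : Type} (e : τ → ρ.finite) (p : MvPolynomial τ ℂ) :
    ∃ h : aeval (fun i => (e i : K)) p ∈ ρ.finite,
      ρ.value ⟨_, h⟩ = eval (fun i => ρ.value (e i)) p := by
  induction p using MvPolynomial.induction_on with
  | C a =>
    obtain ⟨h, ha⟩ := hC a
    refine ⟨by simpa using h, ?_⟩
    simpa using ha
  | add p q hp hq =>
    obtain ⟨hp, hp'⟩ := hp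
    obtain ⟨hq, hq'⟩ := hq
    refine ⟨by simpa using add_mem hp hq, ?_⟩
    rw [map_add (eval _), ← hp', ← hq', ← map_add ρ.value]
    exact congr_arg ρ.value (Subtype.ext (map_add _ p q))
  | mul_X p i hp =>
    obtain ⟨hp, hp'⟩ := hp
    refine ⟨by simpa using mul_mem hp (e i).2, ?_⟩
    rw [map_mul (eval _), ← hp', eval_X, ← map_mul ρ.value]
    exact congr_arg ρ.value (Subtype.ext (by simp))

omit [Algebra ℂ K] in
/-- Elements which are integral over finite elements are finite. -/
theorem mem_finite_of_isIntegralElem {R : Type} [CommRing R] (f : R →+* K)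
    (hf : ∀ r, f r ∈ ρ.finite) {a : K} (ha : f.IsIntegralElem a) : a ∈ ρ.finite := by
  by_contra h
  obtain ⟨b, hab, hb⟩ := ρ.inv_of_not_mem a h
  obtain ⟨p, hp, h0⟩ := ha
  let _ : Invertible a := ⟨b, by rw [mul_comm]; exact hab, hab⟩
  -- The inverse b of a is a root of the reversed polynomial, whose constant coefficient is the
  -- leading coefficient 1 of p. As b has value 0, taking values gives 1 = 0.
  have h1 := Polynomial.eval₂_reverse_mul_pow f a p
  have h2 : Polynomial.eval₂ f (b : K) p.reverse = 0 := by
    have hu : IsUnit (a ^ p.natDegree) := (isUnit_of_invertible a).pow _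
    refine hu.mul_left_eq_zero.mp (h1.trans h0)
  let g : R →+* ρ.finite := f.codRestrict ρ.finite hf
  have h3 : Polynomial.eval₂ g b p.reverse = 0 := by
    apply Subtype.ext
    have := Polynomial.hom_eval₂ p.reverse g ρ.finite.subtype b
    exact this.trans h2
  have h4 := congr_arg ρ.value h3
  rw [Polynomial.hom_eval₂, hb, map_zero, Polynomial.eval₂_at_zero, Polynomial.coeff_zero_reverse,
    hp.leadingCoeff, map_one] at h4
  exact one_ne_zero h4

end

variable {K : Type} [Field K] (ρ : ComplexPlace K)

/-- For any two nonzero elements one of the two quotients is finite, so a finite set has an element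
of largest order. The induction compares one new element with the current maximum. -/
theorem exists_dominant {s : Finset K} {a : K} (ha : a ∈ s) (ha0 : a ≠ 0) :
    ∃ b ∈ s, b ≠ 0 ∧ ∀ i ∈ s, i * b⁻¹ ∈ ρ.finite := by
  classical
  suffices ∀ t ⊆ s, ∃ b ∈ s, b ≠ 0 ∧ ∀ i ∈ insert a t, i * b⁻¹ ∈ ρ.finite by
    obtain ⟨b, hb, hb0, h⟩ := this s subset_rfl
    exact ⟨b, hb, hb0, fun i hi => h i (Finset.mem_insert_of_mem hi)⟩
  intro t
  induction t using Finset.induction_on with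
  | empty => exact fun _ => ⟨a, ha, ha0, by simp [ha0]⟩
  | insert c t _ ih =>
    intro ht
    obtain ⟨b, hb, hb0, h⟩ := ih (fun x hx => ht (Finset.mem_insert_of_mem hx))
    by_cases hcb : c * b⁻¹ ∈ ρ.finite
    · refine ⟨b, hb, hb0, fun i hi => ?_⟩
      rw [Finset.insert_comm, Finset.mem_insert] at hi
      rcases hi with rfl | hi
      exacts [hcb, h i hi]
    · have hc0 : c ≠ 0 := by rintro rfl; simp at hcb
      have hbc : b * c⁻¹ ∈ ρ.finite := by
        obtain ⟨d, hd, -⟩ := ρ.inv_of_not_mem _ hcb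
        have : (d : K) = b * c⁻¹ := by field_simp at hd ⊢; linear_combination hd
        exact this ▸ d.2
      refine ⟨c, ht (Finset.mem_insert_self _ _), hc0, fun i hi => ?_⟩
      rw [Finset.insert_comm, Finset.mem_insert] at hi
      rcases hi with rfl | hi
      · simp [hc0]
      · have : i * c⁻¹ = i * b⁻¹ * (b * c⁻¹) := by field_simp
        rw [this]; exact mul_mem (h i hi) hbc

theorem value_eq_zero_of_mul_eq_one {a b : K} (ha : a ∉ ρ.finite) (hab : a * b = 1) :
    ∃ h : b ∈ ρ.finite, ρ.value ⟨b, h⟩ = 0 := by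
  obtain ⟨d, hd, h0⟩ := ρ.inv_of_not_mem a ha
  have ha0 : a ≠ 0 := left_ne_zero_of_mul_eq_one hab
  have : (d : K) = b := mul_left_cancel₀ ha0 (hd.trans hab.symm)
  subst this
  exact ⟨d.2, h0⟩

end ComplexPlace

/-! ### Families of polynomials -/

section Family

variable {n m : ℕ} {σ : Type} (F : MvPolynomial (Fin n) (MvPolynomial σ ℂ))

/-- The member of the family `F` with the given parameters. -/
def spec (ζ : σ → ℂ) : MvPolynomial (Fin n) ℂ := map (eval ζ) F

/-- The value at a rational point, as a function of the parameters. -/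
def valueAt (a : Fin n → ℚ) : MvPolynomial σ ℂ := eval (fun i => C (a i : ℂ)) F

/-- The linear form in the coefficients which gives the value at a point. -/
def valueForm (x : Fin n → ℂ) : MvPolynomial (Fin n →₀ ℕ) ℂ :=
  ∑ d ∈ F.support, X d * C (∏ i, x i ^ d i)

variable {F}

theorem coeff_spec (ζ : σ → ℂ) (d : Fin n →₀ ℕ) : coeff d (spec F ζ) = eval ζ (coeff d F) := by
  simp [spec, coeff_map]

theorem aeval_valueForm {Q : Type*} [CommRing Q] [Algebra ℂ Q] (y : (Fin n →₀ ℕ) → Q)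
    (x : Fin n → ℂ) : aeval y (valueForm F x) =
      ∑ d ∈ F.support, y d * algebraMap ℂ Q (∏ i, x i ^ d i) := by
  simp [valueForm]

theorem valueAt_eq (a : Fin n → ℚ) :
    valueAt F a = aeval (fun d => coeff d F) (valueForm F (ratPoint a)) := by
  rw [aeval_valueForm, valueAt, eval_eq']
  simp [ratPoint, MvPolynomial.algebraMap_eq]

theorem eval_valueAt (ζ : σ → ℂ) (a : Fin n → ℚ) :
    eval ζ (valueAt F a) = eval (ratPoint a) (spec F ζ) := by
  have : (eval ζ).comp (eval (fun i => C (a i : ℂ))) =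
      (eval (ratPoint a)).comp (map (eval ζ)) := by
    refine MvPolynomial.ringHom_ext (fun p => ?_) (fun i => ?_)
    · simp
    · simp [ratPoint]
  exact DFunLike.congr_fun this F

/-- `y` is a point of the closure of the family, as a family of coefficients. -/
def IsLimitCoeff (F : MvPolynomial (Fin n) (MvPolynomial σ ℂ)) (y : (Fin n →₀ ℕ) → ℂ) : Prop :=
  ∀ p : MvPolynomial (Fin n →₀ ℕ) ℂ, aeval (fun d => coeff d F) p = 0 → eval y p = 0

/-- The polynomial with the coefficients `y`. -/
def polyOf (F : MvPolynomial (Fin n) (MvPolynomial σ ℂ)) (y : (Fin n →₀ ℕ) → ℂ) :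
    MvPolynomial (Fin n) ℂ := ∑ d ∈ F.support, monomial d (y d)

theorem IsLimitCoeff.coeff_polyOf {y : (Fin n →₀ ℕ) → ℂ} (hy : IsLimitCoeff F y)
    (d : Fin n →₀ ℕ) : coeff d (polyOf F y) = y d := by
  classical
  simp only [polyOf, coeff_sum, coeff_monomial, Finset.sum_ite_eq']
  split_ifs with h
  · rfl
  · have := hy (X d) (by simpa using h)
    simpa using this.symm

theorem eval_polyOf (y : (Fin n →₀ ℕ) → ℂ) (x : Fin n → ℂ) :
    eval x (polyOf F y) = eval y (valueForm F x) := by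
  rw [← aeval_eq_eval_apply y, aeval_valueForm]
  simp [polyOf, eval_monomial, Finsupp.prod_fintype]

theorem isLimitCoeff_map {Q : Type*} [CommRing Q] [Algebra ℂ Q] (a : (Fin n →₀ ℕ) → Q)
    (ha : ∀ p : MvPolynomial (Fin n →₀ ℕ) ℂ, aeval (fun d => coeff d F) p = 0 → aeval a p = 0)
    (φ : Q →ₐ[ℂ] ℂ) : IsLimitCoeff F (fun d => φ (a d)) := by
  intro p hp
  have := congr_arg φ (ha p hp)
  rw [map_zero, ← AlgHom.comp_apply, comp_aeval, aeval_eq_eval_apply] at this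
  exact this

theorem isLimitCoeff_spec (ζ : σ → ℂ) : IsLimitCoeff F (fun d => coeff d (spec F ζ)) := by
  simpa [coeff_spec] using isLimitCoeff_map _ (fun _ h => h) (aeval ζ)

theorem polyOf_spec (ζ : σ → ℂ) : polyOf F (fun d => coeff d (spec F ζ)) = spec F ζ := by
  ext d; rw [(isLimitCoeff_spec ζ).coeff_polyOf]

theorem IsLimitCoeff.mem_polyClosure {y : (Fin n →₀ ℕ) → ℂ} (hy : IsLimitCoeff F y) :
    polyOf F y ∈ polyClosure (Set.range (spec F)) := by
  refine mem_zariskiClosure.mpr fun p hp => ?_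
  have : coeffVector (polyOf F y) = y := funext hy.coeff_polyOf
  rw [this]
  refine hy p (MvPolynomial.funext fun ζ => ?_)
  have := hp _ ⟨_, ⟨ζ, rfl⟩, rfl⟩
  rw [map_zero, ← this, ← aeval_eq_eval_apply, ← AlgHom.comp_apply, comp_aeval,
    aeval_eq_eval_apply]
  congr 2

variable {γ : Fin m → Fin n → ℚ}
  (hcone : ∀ (t : ℂ) (ζ : σ → ℂ), ∃ ζ', spec F ζ' = C t * spec F ζ)
  (hγ : IsIdentificationSeq (polyClosure (Set.range (spec F))) γ)

include hγ in
-- Limits of the family are coefficient vectors of elements of its closure, so the identification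
-- property applies to them. The arguments about integrality, rationality and places all rest on
-- this uniqueness.
theorem IsLimitCoeff.eq_of_values {y y' : (Fin n →₀ ℕ) → ℂ} (hy : IsLimitCoeff F y)
    (hy' : IsLimitCoeff F y')
    (h : ∀ k, eval y (valueForm F (ratPoint (γ k))) = eval y' (valueForm F (ratPoint (γ k)))) : y = y' := by
  have := hγ _ hy.mem_polyClosure _ hy'.mem_polyClosure (fun k => by
    rw [eval_polyOf, eval_polyOf, h])
  ext d
  rw [← hy.coeff_polyOf, this, hy'.coeff_polyOf]

include hcone in
/-- A polynomial relation between the coefficients of a cone is preserved by scaling. -/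
theorem aeval_scale_eq_zero {p : MvPolynomial (Fin n →₀ ℕ) ℂ}
    (hp : aeval (fun d => coeff d F) p = 0) :
    aeval (fun d => Polynomial.X * Polynomial.C (coeff d F)) p = 0 := by
  -- The relation with indeterminate scaling factor is tested at all complex constants t. For each
  -- of them the scaled member belongs to the family and satisfies p.
  refine Polynomial.eq_zero_of_infinite_isRoot _ ?_
  have hinf : (Set.range (C : ℂ → MvPolynomial σ ℂ)).Infinite :=
    Set.infinite_range_of_injective (C_injective σ ℂ)
  refine hinf.mono ?_
  rintro _ ⟨t, rfl⟩
  refine MvPolynomial.funext fun ζ => ?_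
  obtain ⟨ζ', hζ'⟩ := hcone t ζ
  have h1 := isLimitCoeff_spec ζ' p hp
  rw [hζ'] at h1
  have h2 : ((eval ζ).comp ((Polynomial.evalRingHom (C t)).comp (aeval (R := ℂ)
      (fun d => Polynomial.X * Polynomial.C (coeff d F))).toRingHom)) =
      eval (fun d => coeff d (C t * spec F ζ)) := by
    refine MvPolynomial.ringHom_ext (fun a => ?_) (fun d => ?_)
    · simp [Polynomial.algebraMap_apply, MvPolynomial.algebraMap_eq]
    · simp only [coeff_spec, RingHom.coe_comp, Function.comp_apply, coeff_C_mul, eval_X, AlgHom.toRingHom_eq_coe, RingHom.coe_coe, aeval_X]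
      simp; exact mul_comm _ _
  have h3 := DFunLike.congr_fun h2 p
  rw [h1] at h3
  rw [map_zero]; exact h3

include hcone in
theorem aeval_smul_eq_zero {E : Type*} [CommRing E] [Algebra ℂ E]
    (i : MvPolynomial σ ℂ →ₐ[ℂ] E) (t : E) {p : MvPolynomial (Fin n →₀ ℕ) ℂ}
    (hp : aeval (fun d => coeff d F) p = 0) : aeval (fun d => t * i (coeff d F)) p = 0 := by
  have h := congr_arg (Polynomial.eval₂RingHom i.toRingHom t) (aeval_scale_eq_zero hcone hp)
  have h2 : (Polynomial.eval₂RingHom i.toRingHom t).comp (aeval (R := ℂ)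
      (fun d => Polynomial.X * Polynomial.C (coeff d F))).toRingHom =
      (aeval (R := ℂ) (fun d => t * i (coeff d F))).toRingHom := by
    refine MvPolynomial.ringHom_ext (fun a => ?_) (fun d => ?_)
    · simp [Polynomial.algebraMap_apply]
    · simp; exact mul_comm _ _
  have h3 := DFunLike.congr_fun h2 p
  rw [map_zero] at h
  exact h3.symm.trans h

include hcone hγ in
/-- The coefficients are integral over the algebra of the values. -/
theorem isIntegral_coeff (d : Fin n →₀ ℕ) :
    (aeval (R := ℂ) (fun k => algebraMap (MvPolynomial σ ℂ)
      (FractionRing (MvPolynomial σ ℂ)) (valueAt F (γ k)))).toRingHom.IsIntegralElem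
      (algebraMap (MvPolynomial σ ℂ) (FractionRing (MvPolynomial σ ℂ)) (coeff d F)) := by
  classical
  by_contra hd
  set E := FractionRing (MvPolynomial σ ℂ)
  set i : MvPolynomial σ ℂ →ₐ[ℂ] E := IsScalarTower.toAlgHom ℂ _ _ with hi
  -- Failure of integrality gives a place at which all values at `γ` are finite but this coefficient
  -- is infinite.
  obtain ⟨ρ, u, hu, hρ⟩ := ComplexPlace.exists_not_mem_finite _ hd
  have hC : ∀ a : ℂ, ∃ h : algebraMap ℂ E a ∈ ρ.finite, ρ.value ⟨_, h⟩ = a := by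
    intro a
    obtain ⟨h, ha⟩ := hu (C a)
    simp only [algHom_C, eval_C] at h ha
    exact ⟨h, ha⟩
  have hne : i (coeff d F) ≠ 0 := fun h => hρ (by
    change i (coeff d F) ∈ _
    rw [h]; exact zero_mem _)
  have hds : d ∈ F.support := by
    rw [mem_support_iff]; intro h; exact hne (by rw [h, map_zero])
  obtain ⟨b, hb, hb0, hdom⟩ := ρ.exists_dominant
    (Finset.mem_image_of_mem (fun d => i (coeff d F)) hds) hne
  obtain ⟨j, -, rfl⟩ := Finset.mem_image.mp hb
  have hdom' : ∀ d', (i (coeff j F))⁻¹ * i (coeff d' F) ∈ ρ.finite := by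
    intro d'
    by_cases h : d' ∈ F.support
    · rw [mul_comm]; exact hdom _ (Finset.mem_image_of_mem (fun d => i (coeff d F)) h)
    · rw [notMem_support_iff.mp h]; simp
  have hbf : i (coeff j F) ∉ ρ.finite := by
    intro h
    apply hρ
    have := mul_mem (hdom' d) h
    rwa [mul_comm, mul_inv_cancel_left₀ hb0] at this
  obtain ⟨hinv, hinv0⟩ := ρ.value_eq_zero_of_mul_eq_one hbf (mul_inv_cancel₀ hb0)
  let e : (Fin n →₀ ℕ) → ρ.finite := fun d' => ⟨_, hdom' d'⟩
  -- After division by the dominant coefficient every coefficient is finite. The quotients still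
  -- satisfy the relations of the family because it is a cone.
  have hlim : IsLimitCoeff F (fun d' => ρ.value (e d')) := by
    intro p hp
    obtain ⟨h, h'⟩ := ρ.exists_value_aeval hC e p
    rw [← h']
    have h0 : aeval (fun i => (e i : E)) p = 0 := aeval_smul_eq_zero hcone i _ hp
    have : (⟨_, h⟩ : ρ.finite) = 0 := Subtype.ext h0
    rw [this, map_zero]
  have hlim0 : IsLimitCoeff F (fun _ => 0) := by
    obtain ⟨ζ', hζ'⟩ := hcone 0 0
    have := isLimitCoeff_spec (F := F) ζ'
    simpa [hζ'] using this
  -- The value at a point is also divided by the dominant coefficient: a finite element times one of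
  -- value 0. So this limit has the same values as the zero polynomial, although its coefficient at
  -- j is 1.
  have hval : ∀ k, eval (fun d' => ρ.value (e d')) (valueForm F (ratPoint (γ k))) =
      eval (fun _ => 0) (valueForm F (ratPoint (γ k))) := by
    intro k
    have h0 : eval (fun _ => (0 : ℂ)) (valueForm F (ratPoint (γ k))) = 0 := by
      rw [← aeval_eq_eval_apply, aeval_valueForm]; simp
    obtain ⟨h, h'⟩ := ρ.exists_value_aeval hC e (valueForm F (ratPoint (γ k)))
    rw [h0, ← h']
    obtain ⟨hk, hk'⟩ := hu (X k)
    have h1 : aeval (fun i => (e i : E)) (valueForm F (ratPoint (γ k))) =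
        (i (coeff j F))⁻¹ * i (valueAt F (γ k)) := by
      rw [valueAt_eq, ← AlgHom.comp_apply, comp_aeval, aeval_valueForm, aeval_valueForm,
        Finset.mul_sum]
      exact Finset.sum_congr rfl fun d' _ => by rw [← mul_assoc]
    have h2 : (⟨_, h⟩ : ρ.finite) = ⟨_, hinv⟩ * ⟨_, hk⟩ := by
      refine Subtype.ext (h1.trans ?_)
      change _ = _ * aeval _ (X k)
      rw [aeval_X]; rfl
    rw [h2, map_mul, hinv0, zero_mul]
  have := congr_fun (hlim.eq_of_values hγ hlim0 hval) j
  have h1 : e j = 1 := Subtype.ext (inv_mul_cancel₀ hb0)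
  simp only [h1, map_one] at this
  exact one_ne_zero this

end Family

/-! ### The coefficients as rational functions of the values -/

/-- Conjugates of a family of algebraic elements, specialised to complex values. -/
theorem exists_conjugate_points {k E : Type} [Field k] [Field E] [CharZero k] [Algebra ℂ k]
    [Algebra ℂ E] [Algebra k E] [IsScalarTower ℂ k E] {τ : Type} (x : τ → E)
    (hfin : (Set.range x).Finite) (halg : ∀ i, IsIntegral k (x i)) {j : τ}
    (hj : x j ∉ Set.range (algebraMap k E)) :
    ∃ y y' : τ → ℂ, (∀ p : MvPolynomial τ ℂ, aeval x p = 0 → eval y p = 0 ∧ eval y' p = 0) ∧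
      (∀ p : MvPolynomial τ ℂ, aeval x p ∈ Set.range (algebraMap k E) → eval y p = eval y' p) ∧
      y j ≠ y' j := by
  let S := Algebra.adjoin k (Set.range x)
  have : Algebra.IsIntegral k S := Algebra.IsIntegral.adjoin (by rintro _ ⟨i, rfl⟩; exact halg i)
  let Ω := AlgebraicClosure k
  let ι : S →ₐ[k] Ω := IsAlgClosed.lift
  have hι : Function.Injective ι := by
    have hfield : IsField S := isField_of_isIntegral_of_isField' (Field.toIsField k)
    let _ := hfield.toField
    exact ι.toRingHom.injective
  let xS : τ → S := fun i => ⟨x i, Algebra.subset_adjoin ⟨i, rfl⟩⟩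
  have hnot : ι (xS j) ∉ Set.range (algebraMap k Ω) := by
    rintro ⟨c, hc⟩
    rw [← ι.commutes] at hc
    exact hj ⟨c, congr_arg (fun t : S => (t : E)) (hι hc)⟩
  -- In characteristic zero the algebraic closure is Galois over k, so some automorphism s moves the
  -- image of x j.
  rw [InfiniteGalois.mem_range_algebraMap_iff_fixed] at hnot
  push Not at hnot
  obtain ⟨s, hs⟩ := hnot
  let f : S →ₐ[ℂ] Ω := ι.restrictScalars ℂ
  let g : S →ₐ[ℂ] Ω := (s.toAlgHom.comp ι).restrictScalars ℂ
  -- T contains both conjugate families and is of finite type. A complex point of T that does not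
  -- kill the difference of the two conjugates at j separates them, while elements of k have the
  -- same image on both sides.
  let T := Algebra.adjoin ℂ (Set.range (fun i => f (xS i)) ∪ Set.range (fun i => g (xS i)))
  have hxS : (Set.range xS).Finite :=
    Set.Finite.of_finite_image (f := fun t : S => (t : E))
      (by rwa [← Set.range_comp]) Subtype.val_injective.injOn
  have hT : Algebra.FiniteType ℂ T := T.fg_iff_finiteType.mp <| by
    have h1 : (Set.range (fun i => f (xS i)) ∪ Set.range (fun i => g (xS i))).Finite := by
      refine Set.Finite.union ?_ ?_
      · exact (hxS.image f).subset (by rintro _ ⟨i, rfl⟩; exact ⟨_, ⟨i, rfl⟩, rfl⟩)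
      · exact (hxS.image g).subset (by rintro _ ⟨i, rfl⟩; exact ⟨_, ⟨i, rfl⟩, rfl⟩)
    exact ⟨h1.toFinset, by simp [T]⟩
  let a : τ → T := fun i => ⟨f (xS i), Algebra.subset_adjoin (Or.inl ⟨i, rfl⟩)⟩
  let b : τ → T := fun i => ⟨g (xS i), Algebra.subset_adjoin (Or.inr ⟨i, rfl⟩)⟩
  have hne : a j - b j ≠ 0 := by
    rw [sub_ne_zero]
    intro h
    exact hs (congr_arg (fun t : T => (t : Ω)) h).symm
  obtain ⟨ψ, hψ⟩ := exists_algHom_ne_zero hne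
  have hcomp : ∀ {A B : Type} [CommRing A] [CommRing B] [Algebra ℂ A] [Algebra ℂ B]
      (h : A →ₐ[ℂ] B) (e : τ → A) (p : MvPolynomial τ ℂ),
      h (aeval e p) = aeval (fun i => h (e i)) p := by
    intro A B _ _ _ _ h e p
    rw [← AlgHom.comp_apply, comp_aeval]
  have hxe : ∀ p : MvPolynomial τ ℂ, ((aeval xS p : S) : E) = aeval x p :=
    hcomp (S.val.restrictScalars ℂ) xS
  have hy : ∀ p : MvPolynomial τ ℂ, eval (fun i => ψ (a i)) p = ψ (aeval a p) :=
    fun p => (hcomp ψ a p).symm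
  have hy' : ∀ p : MvPolynomial τ ℂ, eval (fun i => ψ (b i)) p = ψ (aeval b p) :=
    fun p => (hcomp ψ b p).symm
  have ha : ∀ p : MvPolynomial τ ℂ, ((aeval a p : T) : Ω) = f (aeval xS p) :=
    fun p => (hcomp T.val a p).trans (hcomp f xS p).symm
  have hb : ∀ p : MvPolynomial τ ℂ, ((aeval b p : T) : Ω) = g (aeval xS p) :=
    fun p => (hcomp T.val b p).trans (hcomp g xS p).symm
  refine ⟨fun i => ψ (a i), fun i => ψ (b i), ?_, ?_, ?_⟩
  · intro p hp
    have h0 : aeval xS p = 0 := Subtype.ext ((hxe p).trans hp)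
    have h1 : aeval a p = 0 := Subtype.ext (by rw [ha, h0, map_zero]; rfl)
    have h2 : aeval b p = 0 := Subtype.ext (by rw [hb, h0, map_zero]; rfl)
    rw [hy, hy', h1, h2, map_zero]
    exact ⟨rfl, rfl⟩
  · rintro p ⟨c, hc⟩
    have h0 : aeval xS p = algebraMap k S c := Subtype.ext ((hxe p).trans hc.symm)
    rw [hy, hy']
    congr 1
    refine Subtype.ext ?_
    rw [ha, hb, h0]
    change ι _ = s (ι _)
    rw [ι.commutes, s.commutes]
  · intro h
    rw [map_sub, sub_ne_zero] at hψ
    exact hψ h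

section Family

variable {n m : ℕ} {σ : Type} {F : MvPolynomial (Fin n) (MvPolynomial σ ℂ)}
  {γ : Fin m → Fin n → ℚ}
  (hcone : ∀ (t : ℂ) (ζ : σ → ℂ), ∃ ζ', spec F ζ' = C t * spec F ζ)
  (hγ : IsIdentificationSeq (polyClosure (Set.range (spec F))) γ)

include hcone hγ in
/-- The coefficients are rational functions of the values. -/
theorem exists_coeff_mul_eq (d : Fin n →₀ ℕ) :
    ∃ p q : MvPolynomial (Fin m) ℂ, aeval (fun k => valueAt F (γ k)) q ≠ 0 ∧
      coeff d F * aeval (fun k => valueAt F (γ k)) q = aeval (fun k => valueAt F (γ k)) p := by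
  classical
  set E := FractionRing (MvPolynomial σ ℂ)
  set i : MvPolynomial σ ℂ →ₐ[ℂ] E := IsScalarTower.toAlgHom ℂ _ _ with hi
  have hiinj : Function.Injective i := IsFractionRing.injective (MvPolynomial σ ℂ) E
  set vE : Fin m → E := fun k => i (valueAt F (γ k)) with hvE
  set k : IntermediateField ℂ E := IntermediateField.adjoin ℂ (Set.range vE) with hk
  have hle : ∀ x ∈ (aeval (R := ℂ) vE).range, x ∈ k := by
    rintro _ ⟨p, rfl⟩
    have : (Set.range vE) ⊆ k.toSubalgebra := IntermediateField.subset_adjoin ℂ _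
    rw [AlgHom.toRingHom_eq_coe, RingHom.coe_coe, ← SetLike.mem_coe]
    have h2 := Algebra.adjoin_le this
    rw [Algebra.adjoin_range_eq_range_aeval] at h2
    exact h2 ⟨p, rfl⟩
  by_cases hd : i (coeff d F) ∈ k
  · obtain ⟨p, q, hpq⟩ := (IntermediateField.mem_adjoin_range_iff (F := ℂ) vE _).mp hd
    have haev : ∀ p : MvPolynomial (Fin m) ℂ, aeval vE p = i (aeval (fun k => valueAt F (γ k)) p) := by
      intro p; rw [← AlgHom.comp_apply, comp_aeval]
    rw [haev, haev] at hpq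
    -- If the denominator vanishes, the quotient is 0 by convention, so the coefficient itself is 0
    -- and p = 0, q = 1 serve.
    by_cases hq : aeval (fun k => valueAt F (γ k)) q = 0
    · rw [hq, map_zero, div_zero, ← map_zero i] at hpq
      refine ⟨0, 1, by simp, by simp [hiinj hpq]⟩
    · refine ⟨p, q, hq, hiinj ?_⟩
      rw [map_mul, hpq, div_mul_cancel₀]
      rwa [Ne, ← map_zero i, hiinj.eq_iff]
  · exfalso
    have hL : ∀ d, IsIntegral k (i (coeff d F)) := by
      intro d
      obtain ⟨p, hp, hp0⟩ := isIntegral_coeff hcone hγ d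
      let j : MvPolynomial (Fin m) ℂ →+* k :=
        (aeval (R := ℂ) vE).toRingHom.codRestrict k.toSubfield (fun p => hle _ ⟨p, rfl⟩)
      refine ⟨p.map j, hp.map j, ?_⟩
      rw [Polynomial.eval₂_map]
      exact hp0
    have hfin : (Set.range (fun d => i (coeff d F))).Finite := by
      refine (((F.support.image fun d => i (coeff d F)).finite_toSet).union
        (Set.finite_singleton 0)).subset ?_
      rintro _ ⟨d, rfl⟩
      by_cases h : d ∈ F.support
      · left; simp only [Finset.coe_image]; exact ⟨d, h, rfl⟩
      · right; simp [notMem_support_iff.mp h]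
    -- Both specialised conjugates are limits of the family and agree on elements of k, in
    -- particular on all values at `γ`, but they differ at d.
    obtain ⟨y, y', h1, h2, h3⟩ := exists_conjugate_points (k := k) _ hfin hL (j := d)
      (by rintro ⟨c, hc⟩; exact hd (hc ▸ c.2))
    have hi0 : ∀ p : MvPolynomial (Fin n →₀ ℕ) ℂ, aeval (fun d => i (coeff d F)) p =
        i (aeval (fun d => coeff d F) p) := fun p => by
      rw [← AlgHom.comp_apply, comp_aeval]
    have hlim : IsLimitCoeff F y := fun p hp => (h1 p (by rw [hi0, hp, map_zero])).1
    have hlim' : IsLimitCoeff F y' := fun p hp => (h1 p (by rw [hi0, hp, map_zero])).2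
    refine h3 (congr_fun (hlim.eq_of_values hγ hlim' fun l => h2 _ ?_) d)
    rw [hi0, ← valueAt_eq]
    exact ⟨⟨vE l, IntermediateField.subset_adjoin ℂ _ ⟨l, rfl⟩⟩, rfl⟩

end Family

/-! ### Lying over for complex points, and limits of the family -/

theorem exists_ringHom_of_isIntegral_of_injective {R T : Type} [CommRing R] [CommRing T]
    [IsDomain R] [IsDomain T] [Algebra R T] [Algebra.IsIntegral R T]
    (hT : Function.Injective (algebraMap R T)) (φ : R →+* ℂ) (hφ : Function.Injective φ) :
    ∃ ψ : T →+* ℂ, ∀ r, ψ (algebraMap R T r) = φ r := by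
  let _ : Algebra R ℂ := φ.toAlgebra
  have : FaithfulSMul R ℂ := (faithfulSMul_iff_algebraMap_injective _ _).mpr hφ
  have : FaithfulSMul R T := (faithfulSMul_iff_algebraMap_injective _ _).mpr hT
  let l : T →ₐ[R] ℂ := IsAlgClosed.lift
  exact ⟨l.toRingHom, l.commutes⟩

/-- Lying over gives a prime of T above ker φ. The quotients form an integral extension of domains,
and a homomorphism to ℂ that is injective on the smaller one extends because ℂ is algebraically
closed. -/
theorem exists_ringHom_of_isIntegral {R T : Type} [CommRing R] [CommRing T] [Algebra R T]
    [Algebra.IsIntegral R T] (φ : R →+* ℂ) (hφ : RingHom.ker (algebraMap R T) ≤ RingHom.ker φ) :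
    ∃ ψ : T →+* ℂ, ∀ r, ψ (algebraMap R T r) = φ r := by
  have hP : (RingHom.ker φ).IsPrime := RingHom.ker_isPrime φ
  obtain ⟨Q, -, hQ, hQP⟩ := Ideal.exists_ideal_over_prime_of_isIntegral (RingHom.ker φ)
    (⊥ : Ideal T) hφ
  revert hP hQP
  have hker : ∀ r, r ∈ RingHom.ker φ → φ r = 0 := fun _ h => h
  have hinj : ∀ (h : ∀ r, r ∈ RingHom.ker φ → φ r = 0),
      Function.Injective (Ideal.Quotient.lift (RingHom.ker φ) φ h) :=
    fun h => RingHom.lift_injective_of_ker_le_ideal _ h le_rfl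
  revert hinj hker
  generalize RingHom.ker φ = P
  intro hker hinj hP hQP
  have : Q.LiesOver P := ⟨hQP.symm⟩
  have h0 : Function.Injective (algebraMap (R ⧸ P) (T ⧸ Q)) := by
    rw [injective_iff_map_eq_zero]
    intro r hr
    obtain ⟨r, rfl⟩ := Ideal.Quotient.mk_surjective r
    rw [Ideal.Quotient.algebraMap_mk_of_liesOver, Ideal.Quotient.eq_zero_iff_mem,
      ← Ideal.mem_comap, hQP] at hr
    exact Ideal.Quotient.eq_zero_iff_mem.mpr hr
  obtain ⟨ψ, hψ⟩ := exists_ringHom_of_isIntegral_of_injective (R := R ⧸ P) (T := T ⧸ Q)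
    h0 (Ideal.Quotient.lift P φ hker) (hinj hker)
  refine ⟨ψ.comp (Ideal.Quotient.mk Q), fun r => ?_⟩
  have := hψ (Ideal.Quotient.mk _ r)
  rw [Ideal.Quotient.algebraMap_mk_of_liesOver] at this
  exact this

theorem eq_zero_of_eval_eval {n : ℕ} {σ : Type} {G : MvPolynomial (Fin n) (MvPolynomial σ ℂ)}
    (h : ∀ ζ x, eval x (map (eval ζ) G) = 0) : G = 0 := by
  ext1 d
  refine MvPolynomial.funext fun ζ => ?_
  have : map (eval ζ) G = 0 := MvPolynomial.funext fun x => by simpa using h ζ x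
  rw [← coeff_map, this]; simp

section Family

variable {n m : ℕ} {σ : Type} {F : MvPolynomial (Fin n) (MvPolynomial σ ℂ)}

/-- Points of the closure of a family, from a lying over argument. -/
theorem exists_isLimitCoeff {M : Type} [CommRing M] [Algebra ℂ M] (i : MvPolynomial σ ℂ →ₐ[ℂ] M)
    {τ : Type} (f : MvPolynomial τ ℂ →ₐ[ℂ] M)
    (hint : ∀ d, f.toRingHom.IsIntegralElem (i (coeff d F))) {w : τ → ℂ}
    (hw : ∀ p, f p = 0 → eval w p = 0) :
    ∃ y, IsLimitCoeff F y ∧ ∀ q : MvPolynomial ((Fin n →₀ ℕ) ⊕ τ) ℂ,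
      aeval (Sum.elim (fun d => i (coeff d F)) (fun t => f (X t))) q = 0 →
        eval (Sum.elim y w) q = 0 := by
  -- The coefficients lie in the integral closure of the image of f, and evaluation at w kills the
  -- kernel of f, so it extends to a point of that integral closure.
  let _ : Algebra (MvPolynomial τ ℂ) M := f.toRingHom.toAlgebra
  let T := integralClosure (MvPolynomial τ ℂ) M
  obtain ⟨ψ, hψ⟩ := exists_ringHom_of_isIntegral (T := T) (eval w) (by
    intro p hp
    exact hw p (congr_arg (fun t : T => (t : M)) hp))
  let e : (Fin n →₀ ℕ) → T := fun d => ⟨i (coeff d F), hint d⟩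
  have key : ∀ q : MvPolynomial ((Fin n →₀ ℕ) ⊕ τ) ℂ,
      aeval (Sum.elim (fun d => i (coeff d F)) (fun t => f (X t))) q = 0 →
        eval (Sum.elim (fun d => ψ (e d)) w) q = 0 := by
    intro q hq
    let g : MvPolynomial ((Fin n →₀ ℕ) ⊕ τ) ℂ →+* T :=
      eval₂Hom ((algebraMap (MvPolynomial τ ℂ) T).comp C)
        (Sum.elim e (fun t => algebraMap (MvPolynomial τ ℂ) T (X t)))
    have h1 : (T.val.toRingHom).comp g =
        (aeval (R := ℂ) (Sum.elim (fun d => i (coeff d F)) (fun t => f (X t)))).toRingHom := by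
      refine MvPolynomial.ringHom_ext (fun a => ?_) (fun s => ?_)
      · simp [g]
        exact f.commutes a
      · rcases s with d | t
        · simp [g, e]
        · simp [g]; rfl
    have h2 : ψ.comp g = eval (Sum.elim (fun d => ψ (e d)) w) := by
      refine MvPolynomial.ringHom_ext (fun a => ?_) (fun s => ?_)
      · simp [g, hψ]
      · rcases s with d | t
        · simp [g]
        · simp [g, hψ]
    have h3 : g q = 0 := Subtype.ext ((DFunLike.congr_fun h1 q).trans hq)
    rw [← h2, RingHom.comp_apply, h3, map_zero]
  refine ⟨fun d => ψ (e d), fun p hp => ?_, key⟩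
  have := key (rename Sum.inl p) (by
    rw [aeval_rename, Sum.elim_comp_inl]
    have := congr_arg i hp
    rwa [map_zero, ← AlgHom.comp_apply, comp_aeval] at this)
  rwa [eval_rename, Sum.elim_comp_inl] at this

end Family

/-- The monic equation found in the fraction field has its coefficients in the polynomial ring,
which embeds. -/
theorem isIntegralElem_coeff {n m : ℕ} {σ : Type} {F : MvPolynomial (Fin n) (MvPolynomial σ ℂ)}
    {γ : Fin m → Fin n → ℚ} (hcone : ∀ (t : ℂ) (ζ : σ → ℂ), ∃ ζ', spec F ζ' = C t * spec F ζ)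
    (hγ : IsIdentificationSeq (polyClosure (Set.range (spec F))) γ) (d : Fin n →₀ ℕ) :
    (aeval (R := ℂ) (fun k => valueAt F (γ k))).toRingHom.IsIntegralElem (coeff d F) := by
  obtain ⟨p, hp, h⟩ := isIntegral_coeff hcone hγ d
  refine ⟨p, hp, IsFractionRing.injective _ (FractionRing (MvPolynomial σ ℂ)) ?_⟩
  rw [Polynomial.hom_eval₂, map_zero, ← h]
  congr 1
  refine MvPolynomial.ringHom_ext (fun a => ?_) (fun k => ?_)
  · simp; rfl
  · simp

/-! ### The query defined by a family, and its admissibility -/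

theorem mkPoint_eta {m n : ℕ} (w : QueryVar m n → ℂ) :
    mkPoint (fun k => w (Sum.inl k)) (fun i => w (Sum.inr (Sum.inl i)))
      (w (Sum.inr (Sum.inr ()))) = w := by
  ext s; rcases s with k | i | t <;> rfl

/-- The query defines on its database the family `F`, parameterised by the values at `γ`. -/
def QueryInput.DefinesFamily (I : QueryInput) {σ : Type}
    (F : MvPolynomial (Fin I.n) (MvPolynomial σ ℂ)) (γ : Fin I.m → Fin I.n → ℚ) : Prop :=
  ∀ u x y, mkPoint u x y ∈ I.A ↔
    ∃ ζ, (∀ k, eval (ratPoint (γ k)) (spec F ζ) = u k) ∧ eval x (spec F ζ) = y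

namespace QueryInput

variable {I : QueryInput} {σ : Type} {F : MvPolynomial (Fin I.n) (MvPolynomial σ ℂ)}
  {γ : Fin I.m → Fin I.n → ℚ}

/-- The values of a member of the family. -/
def valuePoint (F : MvPolynomial (Fin I.n) (MvPolynomial σ ℂ)) (γ : Fin I.m → Fin I.n → ℚ)
    (ζ : σ → ℂ) : Fin I.m → ℂ := fun k => eval (ratPoint (γ k)) (spec F ζ)

theorem eval_valuePoint (ζ : σ → ℂ) (p : MvPolynomial (Fin I.m) ℂ) :
    eval (valuePoint F γ ζ) p = eval ζ (aeval (fun k => valueAt F (γ k)) p) := by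
  rw [← aeval_eq_eval_apply ζ, ← AlgHom.comp_apply, comp_aeval, ← aeval_eq_eval_apply]
  congr 2
  ext k
  rw [valuePoint, ← eval_valueAt]; rfl

/-- The point of the family over `𝔸ⁿ`, as polynomials in parameters and variables. -/
def genericPoint (F : MvPolynomial (Fin I.n) (MvPolynomial σ ℂ)) (γ : Fin I.m → Fin I.n → ℚ) :
    MvPolynomial (QueryVar I.m I.n) ℂ →ₐ[ℂ] MvPolynomial (Fin I.n) (MvPolynomial σ ℂ) :=
  aeval (Sum.elim (fun k => C (valueAt F (γ k))) (Sum.elim X fun _ => F))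

theorem eval_genericPoint (ζ : σ → ℂ) (x : Fin I.n → ℂ) (p : MvPolynomial (QueryVar I.m I.n) ℂ) :
    eval x (map (eval ζ) (genericPoint F γ p)) =
      eval (mkPoint (valuePoint F γ ζ) x (eval x (spec F ζ))) p := by
  have : ((eval x).comp (map (eval ζ))).comp (genericPoint F γ).toRingHom =
      eval (mkPoint (valuePoint F γ ζ) x (eval x (spec F ζ))) := by
    refine MvPolynomial.ringHom_ext (fun a => ?_) (fun s => ?_)
    · simp [MvPolynomial.algebraMap_apply, MvPolynomial.algebraMap_eq]
    · rcases s with k | i | t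
      · simp [genericPoint, mkPoint, valuePoint, eval_valueAt]
      · simp [genericPoint, mkPoint]
      · simp [genericPoint, mkPoint, spec]
  exact DFunLike.congr_fun this p

namespace DefinesFamily

variable (hA : I.DefinesFamily F γ)
  (hcone : ∀ (t : ℂ) (ζ : σ → ℂ), ∃ ζ', spec F ζ' = C t * spec F ζ)
  (hγ : IsIdentificationSeq (polyClosure (Set.range (spec F))) γ)

include hA

theorem mem_A (ζ : σ → ℂ) (x : Fin I.n → ℂ) :
    mkPoint (valuePoint F γ ζ) x (eval x (spec F ζ)) ∈ I.A :=
  (hA _ _ _).mpr ⟨ζ, fun _ => rfl, rfl⟩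

theorem paramProj_A : paramProj I.A = Set.range (valuePoint F γ) := by
  ext u
  constructor
  · rintro ⟨w, hw, rfl⟩
    rw [← mkPoint_eta w, hA] at hw
    obtain ⟨ζ, h, -⟩ := hw
    exact ⟨ζ, funext h⟩
  · rintro ⟨ζ, rfl⟩
    exact ⟨_, mem_A hA ζ 0, rfl⟩

theorem mem_vanishingIdeal_V {p : MvPolynomial (Fin I.m) ℂ} :
    p ∈ vanishingIdeal ℂ I.V ↔ aeval (fun k => valueAt F (γ k)) p = 0 := by
  rw [V, mem_vanishingIdeal_zariskiClosure, paramProj_A hA]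
  simp only [Set.forall_mem_range, eval_valuePoint]
  exact ⟨fun h => MvPolynomial.funext fun ζ => by simpa using h ζ, fun h ζ => by rw [h, map_zero]⟩

/-- A is the image of the space of parameters times affine space under the polynomial map
`genericPoint`, and polynomials over ℂ are determined by their values. Hence the vanishing ideal is
the kernel of a map to a domain. -/
theorem vanishes_on_A_iff {p : MvPolynomial (QueryVar I.m I.n) ℂ} :
    (∀ w ∈ I.A, eval w p = 0) ↔ genericPoint F γ p = 0 := by
  constructor
  · intro h
    refine eq_zero_of_eval_eval fun ζ x => ?_
    rw [eval_genericPoint]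
    exact h _ (mem_A hA ζ x)
  · intro h w hw
    rw [← mkPoint_eta w] at hw ⊢
    obtain ⟨ζ, h1, h2⟩ := (hA _ _ _).mp hw
    rw [← funext h1, ← h2]
    change eval (mkPoint (valuePoint F γ ζ) _ _) p = 0
    rw [← eval_genericPoint, h, map_zero, map_zero]

theorem isPrime : (vanishingIdeal (σ := QueryVar I.m I.n) ℂ I.A).IsPrime := by
  have : vanishingIdeal (σ := QueryVar I.m I.n) ℂ I.A =
      RingHom.ker (genericPoint F γ).toRingHom := by
    ext p
    exact vanishes_on_A_iff hA
  rw [this]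
  exact RingHom.ker_isPrime _

include hγ in
theorem fiberIsGraph_A (ζ : σ → ℂ) : FiberIsGraph I.A (valuePoint F γ ζ) (spec F ζ) := by
  intro x y
  constructor
  · intro h
    obtain ⟨ζ', h1, h2⟩ := (hA _ _ _).mp h
    have hsub : ∀ ζ, spec F ζ ∈ polyClosure (Set.range (spec F)) := fun ζ =>
      subset_zariskiClosure _ ⟨_, ⟨ζ, rfl⟩, rfl⟩
    rw [← h2, hγ _ (hsub ζ') _ (hsub ζ) h1]
  · rintro rfl
    exact mem_A hA ζ x

/-- For fixed x, an equation of A becomes a polynomial relation between the coefficients of the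
family, and limits inherit such relations. -/
theorem mem_B_of_isLimitCoeff {y : (Fin I.n →₀ ℕ) → ℂ} (hy : IsLimitCoeff F y)
    (x : Fin I.n → ℂ) :
    mkPoint (fun k => eval y (valueForm F (ratPoint (γ k)))) x (eval x (polyOf F y)) ∈ I.B := by
  refine mem_zariskiClosure.mpr fun p hp => ?_
  let g : MvPolynomial (QueryVar I.m I.n) ℂ →ₐ[ℂ] MvPolynomial (Fin I.n →₀ ℕ) ℂ :=
    aeval (Sum.elim (fun k => valueForm F (ratPoint (γ k)))
      (Sum.elim (fun i => C (x i)) fun _ => valueForm F x))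
  have hg : ∀ z, eval z (g p) = eval (mkPoint (fun k => eval z (valueForm F (ratPoint (γ k)))) x
      (eval z (valueForm F x))) p := by
    intro z
    rw [← aeval_eq_eval_apply z, ← AlgHom.comp_apply, comp_aeval, ← aeval_eq_eval_apply]
    congr 2
    ext s
    rcases s with k | i | t <;> simp [mkPoint, aeval_eq_eval_apply]
  rw [eval_polyOf, ← hg]
  refine hy _ (MvPolynomial.funext fun ζ => ?_)
  have h1 : eval ζ (aeval (fun d => coeff d F) (g p)) =
      eval (fun d => coeff d (spec F ζ)) (g p) := by
    rw [← aeval_eq_eval_apply ζ, ← AlgHom.comp_apply, comp_aeval, ← aeval_eq_eval_apply]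
    congr 2
  rw [h1, hg]
  simp only [← eval_polyOf, polyOf_spec, map_zero]
  exact hp _ (mem_A hA ζ x)

include hcone hγ

/-- The coefficients are integral over the values, so a point of B lifts by lying over to a limit of
the family. The relations expressing the values and y through the coefficients survive the lifting.
-/
theorem exists_of_mem_B {w : QueryVar I.m I.n → ℂ} (hw : w ∈ I.B) :
    ∃ y, IsLimitCoeff F y ∧ (∀ k, w (Sum.inl k) = eval y (valueForm F (ratPoint (γ k)))) ∧
      w (Sum.inr (Sum.inr ())) = eval (fun i => w (Sum.inr (Sum.inl i))) (polyOf F y) := by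
  let i : MvPolynomial σ ℂ →ₐ[ℂ] MvPolynomial (Fin I.n) (MvPolynomial σ ℂ) :=
    IsScalarTower.toAlgHom ℂ _ _
  have hi : ∀ a, i a = C a := fun _ => rfl
  obtain ⟨y, hy, hq⟩ := exists_isLimitCoeff (F := F) i (genericPoint F γ) (w := w) (by
    intro d
    obtain ⟨p, hp, h⟩ := isIntegralElem_coeff hcone hγ d
    refine ⟨p.map (rename Sum.inl).toRingHom, hp.map _, ?_⟩
    rw [Polynomial.eval₂_map, ← map_zero i, ← h]
    change _ = i.toRingHom _
    rw [Polynomial.hom_eval₂]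
    congr 1
    refine MvPolynomial.ringHom_ext (fun a => ?_) (fun k => ?_)
    · simp [MvPolynomial.algebraMap_eq, hi]
    · simp [genericPoint, hi])
    (fun p hp => mem_zariskiClosure.mp hw p ((vanishes_on_A_iff hA).mpr hp))
  refine ⟨y, hy, fun k => ?_, ?_⟩
  · have := hq (X (Sum.inr (Sum.inl k)) - rename Sum.inl (valueForm F (ratPoint (γ k)))) (by
      rw [map_sub, aeval_X, aeval_rename, Sum.elim_comp_inl, sub_eq_zero, Sum.elim_inr,
        aeval_valueForm]
      simp only [genericPoint, aeval_X, Sum.elim_inl, valueAt_eq, aeval_valueForm, hi]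
      simp [MvPolynomial.algebraMap_apply, MvPolynomial.algebraMap_eq])
    rw [map_sub, eval_X, eval_rename, sub_eq_zero, Sum.elim_comp_inl] at this
    exact this
  · have := hq (X (Sum.inr (Sum.inr (Sum.inr ()))) - ∑ d ∈ F.support, X (Sum.inl d) *
      ∏ i, X (Sum.inr (Sum.inr (Sum.inl i))) ^ d i) (by
      rw [map_sub, aeval_X, sub_eq_zero, Sum.elim_inr]
      simp only [genericPoint, aeval_X, Sum.elim_inr, map_sum, map_mul, map_prod, map_pow,
        Sum.elim_inl, hi]
      conv_lhs => rw [F.as_sum]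
      refine Finset.sum_congr rfl fun d _ => ?_
      rw [monomial_eq, Finsupp.prod_fintype _ _ (by simp)])
    rw [map_sub, eval_X, sub_eq_zero, Sum.elim_inr] at this
    rw [this, eval_polyOf, ← aeval_eq_eval_apply y, aeval_valueForm]
    simp

theorem exists_of_mem_V {u : Fin I.m → ℂ} (hu : u ∈ I.V) :
    ∃ y, IsLimitCoeff F y ∧ ∀ k, u k = eval y (valueForm F (ratPoint (γ k))) := by
  obtain ⟨y, hy, hq⟩ := exists_isLimitCoeff (F := F) (AlgHom.id ℂ _)
    (aeval fun k => valueAt F (γ k)) (w := u) (isIntegralElem_coeff hcone hγ)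
    (fun p hp => hu p ((mem_vanishingIdeal_V hA).mpr hp |> fun h => by
      rw [V, mem_vanishingIdeal_zariskiClosure] at h; exact h))
  refine ⟨y, hy, fun k => ?_⟩
  have := hq (X (Sum.inr k) - rename Sum.inl (valueForm F (ratPoint (γ k)))) (by
    rw [map_sub, aeval_X, aeval_rename, Sum.elim_comp_inl, sub_eq_zero, Sum.elim_inr, aeval_X,
      valueAt_eq]; rfl)
  rw [map_sub, eval_X, eval_rename, sub_eq_zero, Sum.elim_comp_inl] at this
  exact this

/-- Every point of V or B lifts to a limit of the family, which gives surjectivity of the projection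
and polynomial fibers. Uniqueness of the limit with given values makes each fiber a single graph. -/
theorem isAdmissible : I.IsAdmissible := by
  refine ⟨⟨⟨_, mem_A hA 0 0⟩, fun u hu => ?_⟩, isPrime hA, ?_, ?_, ?_⟩
  · rw [paramProj_A hA] at hu
    obtain ⟨ζ, rfl⟩ := hu
    exact ⟨_, fiberIsGraph_A hA hγ ζ⟩
  · ext u
    constructor
    · rintro ⟨w, hw, rfl⟩
      refine mem_zariskiClosure.mpr fun p hp => ?_
      have := mem_zariskiClosure.mp hw (rename Sum.inl p) (fun a ha => by
        rw [eval_rename]; exact hp _ ⟨a, ha, rfl⟩)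
      rw [eval_rename] at this
      exact this
    · intro hu
      obtain ⟨y, hy, huy⟩ := exists_of_mem_V hA hcone hγ hu
      exact ⟨_, mem_B_of_isLimitCoeff hA hy 0, (funext huy).symm⟩
  · exact ⟨_, subset_zariskiClosure _ (mem_A hA 0 0)⟩
  · rintro u ⟨w, hw, rfl⟩
    obtain ⟨y, hy, hk, -⟩ := exists_of_mem_B hA hcone hγ hw
    refine ⟨polyOf F y, fun x t => ⟨fun h => ?_, ?_⟩⟩
    · obtain ⟨y', hy', hk', ht⟩ := exists_of_mem_B hA hcone hγ h
      have : y = y' := hy.eq_of_values hγ hy' fun k => by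
        rw [← hk, ← hk']; rfl
      rw [this]; exact ht
    · rintro rfl
      have := mem_B_of_isLimitCoeff hA hy x
      rwa [← funext hk] at this

end DefinesFamily

end QueryInput

/-! ### The function field of the parameter variety, and its scaling -/

theorem aeval_coeff_valueForm {n m : ℕ} {σ : Type} {F : MvPolynomial (Fin n) (MvPolynomial σ ℂ)}
    {γ : Fin m → Fin n → ℚ} (p : MvPolynomial (Fin m) ℂ) :
    aeval (fun d => coeff d F) (aeval (fun k => valueForm F (ratPoint (γ k))) p) =
      aeval (fun k => valueAt F (γ k)) p := by
  rw [← AlgHom.comp_apply, comp_aeval]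
  simp only [valueAt_eq]

theorem aeval_scale_valueForm {n m : ℕ} {σ : Type} {F : MvPolynomial (Fin n) (MvPolynomial σ ℂ)}
    {γ : Fin m → Fin n → ℚ} (p : MvPolynomial (Fin m) ℂ) :
    aeval (fun d => Polynomial.X * Polynomial.C (coeff d F))
        (aeval (fun k => valueForm F (ratPoint (γ k))) p) =
      aeval (fun k => Polynomial.X * Polynomial.C (valueAt F (γ k))) p := by
  rw [← AlgHom.comp_apply, comp_aeval]
  congr 2
  ext1 k
  rw [aeval_valueForm, valueAt_eq, aeval_valueForm, map_sum, Finset.mul_sum]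
  refine Finset.sum_congr rfl fun d _ => ?_
  rw [map_mul, mul_assoc]; rfl

namespace QueryInput

variable {I : QueryInput} {σ : Type} {F : MvPolynomial (Fin I.n) (MvPolynomial σ ℂ)}
  {γ : Fin I.m → Fin I.n → ℚ}

theorem exists_mul_ofPoly (a : I.K) :
    ∃ p q, I.ofPoly q ∈ nonZeroDivisors I.K ∧ a * I.ofPoly q = I.ofPoly p := by
  obtain ⟨⟨p, q⟩, h⟩ := IsLocalization.surj (nonZeroDivisors I.coordRing) a
  obtain ⟨p, rfl⟩ := Ideal.Quotient.mk_surjective p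
  obtain ⟨q', hq'⟩ := Ideal.Quotient.mk_surjective (q : I.coordRing)
  refine ⟨p, q', ?_, ?_⟩
  · have : IsUnit (I.ofPoly q') := by
      rw [ofPoly, hq']; exact IsLocalization.map_units I.K q
    exact this.mem_nonZeroDivisors
  · rw [ofPoly, hq']; exact h

namespace DefinesFamily

variable (hA : I.DefinesFamily F γ)
  (hcone : ∀ (t : ℂ) (ζ : σ → ℂ), ∃ ζ', spec F ζ' = C t * spec F ζ)
  (hγ : IsIdentificationSeq (polyClosure (Set.range (spec F))) γ)

include hA

theorem ofPoly_eq_zero_iff (p : MvPolynomial (Fin I.m) ℂ) :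
    I.ofPoly p = 0 ↔ aeval (fun k => valueAt F (γ k)) p = 0 := by
  rw [ofPoly, IsFractionRing.to_map_eq_zero_iff, Ideal.Quotient.eq_zero_iff_mem,
    mem_vanishingIdeal_V hA]

theorem isDomain : IsDomain I.coordRing := by
  have : (vanishingIdeal (σ := Fin I.m) ℂ I.V).IsPrime := by
    have : vanishingIdeal (σ := Fin I.m) ℂ I.V =
        RingHom.ker (aeval (R := ℂ) (fun k => valueAt F (γ k))).toRingHom := by
      ext p; exact mem_vanishingIdeal_V hA
    rw [this]; exact RingHom.ker_isPrime _
  exact Ideal.Quotient.isDomain _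

theorem exists_mul_eq (a : I.K) : ∃ p q, aeval (fun k => valueAt F (γ k)) q ≠ 0 ∧
    a * I.ofPoly q = I.ofPoly p := by
  have := isDomain hA
  obtain ⟨p, q, hq, h⟩ := exists_mul_ofPoly a
  exact ⟨p, q, fun h0 => nonZeroDivisors.ne_zero hq ((ofPoly_eq_zero_iff hA q).mpr h0), h⟩

theorem exists_lift {L : Type} [Field L] [Algebra ℂ L] (f : Fin I.m → L)
    (hf : ∀ p : MvPolynomial (Fin I.m) ℂ,
      aeval f p = 0 ↔ aeval (fun k => valueAt F (γ k)) p = 0) :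
    ∃ j : I.K →+* L, Function.Injective j ∧ ∀ p, j (I.ofPoly p) = aeval f p := by
  have := isDomain hA
  let g : I.coordRing →+* L := Ideal.Quotient.lift _ (aeval (R := ℂ) f).toRingHom
    (fun p hp => (hf p).mpr ((mem_vanishingIdeal_V hA).mp hp))
  have hg : Function.Injective g := by
    rw [injective_iff_map_eq_zero]
    intro p hp
    obtain ⟨p, rfl⟩ := Ideal.Quotient.mk_surjective p
    exact Ideal.Quotient.eq_zero_iff_mem.mpr ((mem_vanishingIdeal_V hA).mpr ((hf p).mp hp))
  refine ⟨IsFractionRing.lift hg, RingHom.injective _, fun p => ?_⟩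
  exact IsFractionRing.lift_algebraMap hg _

theorem exists_embedding : ∃ j : I.K →+* FractionRing (MvPolynomial σ ℂ), Function.Injective j ∧
    ∀ p, j (I.ofPoly p) = algebraMap _ _ (aeval (fun k => valueAt F (γ k)) p) := by
  have h : ∀ p : MvPolynomial (Fin I.m) ℂ, aeval (fun k => algebraMap (MvPolynomial σ ℂ)
      (FractionRing (MvPolynomial σ ℂ)) (valueAt F (γ k))) p =
      algebraMap _ _ (aeval (fun k => valueAt F (γ k)) p) := fun p =>
    aeval_algebraMap_apply _ _ p
  obtain ⟨j, hj, hjp⟩ := exists_lift hA (fun k => algebraMap (MvPolynomial σ ℂ)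
    (FractionRing (MvPolynomial σ ℂ)) (valueAt F (γ k))) (fun p => by
      rw [h, IsFractionRing.to_map_eq_zero_iff])
  exact ⟨j, hj, fun p => (hjp p).trans (h p)⟩

include hcone in
/-- Scaling by an indeterminate, on the function field of the parameter variety. -/
theorem exists_scaling : ∃ μ : I.K →+* FractionRing (Polynomial (MvPolynomial σ ℂ)),
    Function.Injective μ ∧ ∀ p, μ (I.ofPoly p) = algebraMap _ _
      (aeval (fun k => Polynomial.X * Polynomial.C (valueAt F (γ k))) p) := by
  have h : ∀ p : MvPolynomial (Fin I.m) ℂ,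
      aeval (fun k => algebraMap (Polynomial (MvPolynomial σ ℂ))
        (FractionRing (Polynomial (MvPolynomial σ ℂ)))
        (Polynomial.X * Polynomial.C (valueAt F (γ k)))) p =
      algebraMap _ _ (aeval (fun k => Polynomial.X * Polynomial.C (valueAt F (γ k))) p) := fun p =>
    aeval_algebraMap_apply _ _ p
  obtain ⟨j, hj, hjp⟩ := exists_lift hA (fun k => algebraMap (Polynomial (MvPolynomial σ ℂ))
        (FractionRing (Polynomial (MvPolynomial σ ℂ)))
        (Polynomial.X * Polynomial.C (valueAt F (γ k)))) (fun p => by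
      rw [h, IsFractionRing.to_map_eq_zero_iff]
      constructor
      · intro h0
        -- Putting T = 1 recovers the unscaled relation; the converse direction is the cone
        -- property.
        have h1 := congr_arg (Polynomial.aeval (R := MvPolynomial σ ℂ) (1 : MvPolynomial σ ℂ)) h0
        rw [map_zero] at h1
        rw [← h1]
        change _ = ((Polynomial.aeval (R := MvPolynomial σ ℂ) (1 : MvPolynomial σ ℂ)).restrictScalars ℂ) _
        rw [← AlgHom.comp_apply, comp_aeval]
        simp
      · intro h0
        rw [← aeval_coeff_valueForm] at h0
        rw [← aeval_scale_valueForm]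
        exact aeval_scale_eq_zero hcone h0)
  exact ⟨j, hj, fun p => (hjp p).trans (h p)⟩

include hcone in
/-- The scaling multiplies the coefficients of the generic member by the indeterminate. -/
theorem scaling_coeff {j : I.K →+* FractionRing (MvPolynomial σ ℂ)}
    (hj : ∀ p, j (I.ofPoly p) = algebraMap _ _ (aeval (fun k => valueAt F (γ k)) p))
    {μ : I.K →+* FractionRing (Polynomial (MvPolynomial σ ℂ))} (hinj : Function.Injective μ)
    (hμ : ∀ p, μ (I.ofPoly p) = algebraMap _ _
      (aeval (fun k => Polynomial.X * Polynomial.C (valueAt F (γ k))) p))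
    {κ : I.K} {d : Fin I.n →₀ ℕ} (hκ : j κ = algebraMap _ _ (coeff d F)) :
    μ κ = algebraMap _ _ (Polynomial.X * Polynomial.C (coeff d F)) := by
  obtain ⟨p, q, hq, h⟩ := exists_mul_eq hA κ
  have h1 : coeff d F * aeval (fun k => valueAt F (γ k)) q = aeval (fun k => valueAt F (γ k)) p := by
    apply IsFractionRing.injective (MvPolynomial σ ℂ) (FractionRing (MvPolynomial σ ℂ))
    rw [map_mul, ← hj, ← hj, ← hκ, ← map_mul, h]
  -- The equation coefficient · q(values) = p(values) is a polynomial relation between the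
  -- coefficients, because values are linear forms in them. So it persists after scaling.
  have h2 := aeval_scale_eq_zero hcone (p := X d * aeval (fun k => valueForm F (ratPoint (γ k))) q
    - aeval (fun k => valueForm F (ratPoint (γ k))) p) (by
      rw [map_sub, map_mul, aeval_X, aeval_coeff_valueForm, aeval_coeff_valueForm, h1, sub_self])
  rw [map_sub, map_mul, aeval_X, aeval_scale_valueForm, aeval_scale_valueForm,
    sub_eq_zero] at h2
  have hq0 : μ (I.ofPoly q) ≠ 0 := by
    intro h0
    rw [← map_zero μ] at h0
    exact hq ((ofPoly_eq_zero_iff hA q).mp (hinj h0))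
  apply mul_right_cancel₀ hq0
  rw [← map_mul, h, hμ, hμ, ← map_mul, h2]

end DefinesFamily

end QueryInput

/-! ### Existence of branching-free representations -/

namespace QueryInput

variable {I : QueryInput} {σ : Type} {F : MvPolynomial (Fin I.n) (MvPolynomial σ ℂ)}
  {γ : Fin I.m → Fin I.n → ℚ}

namespace DefinesFamily

variable (hA : I.DefinesFamily F γ)
  (hcone : ∀ (t : ℂ) (ζ : σ → ℂ), ∃ ζ', spec F ζ' = C t * spec F ζ)
  (hγ : IsIdentificationSeq (polyClosure (Set.range (spec F))) γ)

theorem isUnit_ofPoly (hA : I.DefinesFamily F γ) {q : MvPolynomial (Fin I.m) ℂ}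
    (hq : aeval (fun k => valueAt F (γ k)) q ≠ 0) : IsUnit (I.ofPoly q) := by
  have := isDomain hA
  exact IsUnit.mk0 _ (fun h => hq ((ofPoly_eq_zero_iff hA q).mp h))

include hA hcone hγ in
theorem exists_coeff_function {j : I.K →+* FractionRing (MvPolynomial σ ℂ)}
    (hj : ∀ p, j (I.ofPoly p) = algebraMap _ _ (aeval (fun k => valueAt F (γ k)) p))
    (d : Fin I.n →₀ ℕ) : ∃ κ : I.K, j κ = algebraMap _ _ (coeff d F) := by
  obtain ⟨p, q, hq, h⟩ := exists_coeff_mul_eq hcone hγ d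
  obtain ⟨b, hb⟩ := (isUnit_ofPoly hA hq).exists_right_inv
  refine ⟨I.ofPoly p * b, ?_⟩
  rw [map_mul, hj, ← h, map_mul, ← hj, mul_assoc, ← map_mul, hb, map_one, mul_one]

/-- The fraction p/q pulls back to the polynomial c on the space of parameters, so the value does
not depend on the fraction chosen. -/
theorem eq_of_hasValueAt {j : I.K →+* FractionRing (MvPolynomial σ ℂ)}
    (hj : ∀ p, j (I.ofPoly p) = algebraMap _ _ (aeval (fun k => valueAt F (γ k)) p))
    {κ : I.K} {c : MvPolynomial σ ℂ} (hκ : j κ = algebraMap _ _ c) {ζ : σ → ℂ} {t : ℂ}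
    (ht : I.HasValueAt κ (valuePoint F γ ζ) t) : t = eval ζ c := by
  obtain ⟨p, q, hq, h, htq⟩ := ht
  have h1 : c * aeval (fun k => valueAt F (γ k)) q = aeval (fun k => valueAt F (γ k)) p := by
    apply IsFractionRing.injective (MvPolynomial σ ℂ) (FractionRing (MvPolynomial σ ℂ))
    rw [map_mul, ← hj, ← hj, ← hκ, ← map_mul, h]
  rw [eval_valuePoint] at htq hq
  rw [eval_valuePoint, ← h1, map_mul] at htq
  exact mul_right_cancel₀ hq htq

include hcone hγ in
theorem isIntegralElem_coeff_function {j : I.K →+* FractionRing (MvPolynomial σ ℂ)}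
    (hinj : Function.Injective j)
    (hj : ∀ p, j (I.ofPoly p) = algebraMap _ _ (aeval (fun k => valueAt F (γ k)) p))
    {κ : I.K} {d : Fin I.n →₀ ℕ} (hκ : j κ = algebraMap _ _ (coeff d F)) :
    ((algebraMap I.coordRing I.K).comp (Ideal.Quotient.mk _)).IsIntegralElem κ := by
  obtain ⟨p, hp, h⟩ := isIntegralElem_coeff hcone hγ d
  refine ⟨p, hp, hinj ?_⟩
  rw [map_zero, Polynomial.hom_eval₂, hκ]
  have : j.comp ((algebraMap I.coordRing I.K).comp (Ideal.Quotient.mk _)) =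
      (algebraMap (MvPolynomial σ ℂ) (FractionRing (MvPolynomial σ ℂ))).comp
        (aeval (R := ℂ) (fun k => valueAt F (γ k))).toRingHom := RingHom.ext hj
  rw [this, ← Polynomial.hom_eval₂, h, map_zero]

include hcone hγ in
-- Integrality makes the coefficients finite at the place. Their values satisfy all relations of the
-- family, including the linear ones that express the values at `γ`.
theorem value_coeff_function {j : I.K →+* FractionRing (MvPolynomial σ ℂ)}
    (hinj : Function.Injective j)
    (hj : ∀ p, j (I.ofPoly p) = algebraMap _ _ (aeval (fun k => valueAt F (γ k)) p))
    {κ : (Fin I.n →₀ ℕ) → I.K} (hκ : ∀ d, j (κ d) = algebraMap _ _ (coeff d F))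
    {u : Fin I.m → ℂ} {ρ : ComplexPlace I.K} (hρ : I.IsCenteredAt ρ u) :
    ∃ y, IsLimitCoeff F y ∧ (∀ k, eval y (valueForm F (ratPoint (γ k))) = u k) ∧
      ∀ d, ∃ h : κ d ∈ ρ.finite, ρ.value ⟨_, h⟩ = y d := by
  have hfin : ∀ d, κ d ∈ ρ.finite := fun d =>
    ρ.mem_finite_of_isIntegralElem _ (fun r => (hρ r).1)
      (isIntegralElem_coeff_function hcone hγ hinj hj (hκ d))
  let _ : Algebra ℂ I.K :=
    (((algebraMap I.coordRing I.K).comp (Ideal.Quotient.mk _)).comp C).toAlgebra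
  have hC : ∀ a : ℂ, ∃ h : algebraMap ℂ I.K a ∈ ρ.finite, ρ.value ⟨_, h⟩ = a := by
    intro a
    obtain ⟨h, ha⟩ := hρ (C a)
    exact ⟨h, by rw [eval_C] at ha; exact ha⟩
  have hrel : ∀ (p : MvPolynomial (Fin I.n →₀ ℕ) ℂ),
      j (aeval κ p) = algebraMap _ _ (aeval (fun d => coeff d F) p) := by
    intro p
    have : j.comp (aeval (R := ℂ) κ).toRingHom =
      (algebraMap (MvPolynomial σ ℂ) (FractionRing (MvPolynomial σ ℂ))).comp
        (aeval (R := ℂ) (fun d => coeff d F)).toRingHom := by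
      refine MvPolynomial.ringHom_ext (fun a => ?_) (fun d => ?_)
      · have := hj (C a)
        simp only [algHom_C] at this
        simp only [RingHom.coe_comp, Function.comp_apply, AlgHom.toRingHom_eq_coe, RingHom.coe_coe,
          algHom_C]
        exact this
      · simp [hκ]
    exact DFunLike.congr_fun this p
  have hval := ComplexPlace.exists_value_aeval ρ hC (fun d => ⟨κ d, hfin d⟩)
  refine ⟨fun d => ρ.value ⟨κ d, hfin d⟩, fun p hp => ?_, fun k => ?_, fun d => ⟨hfin d, rfl⟩⟩
  · obtain ⟨h, hp'⟩ := hval p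
    rw [← hp']
    have h0 : aeval κ p = 0 := hinj (by rw [hrel, hp, map_zero, map_zero])
    rw [← map_zero ρ.value]
    exact congr_arg ρ.value (Subtype.ext h0)
  · obtain ⟨h, hp'⟩ := hval (valueForm F (ratPoint (γ k)))
    obtain ⟨h1, hX⟩ := hρ (X k)
    rw [eval_X] at hX
    rw [← hp', ← hX]
    have h0 : aeval κ (valueForm F (ratPoint (γ k))) = I.ofPoly (X k) := hinj (by
      rw [hrel, hj, aeval_X, valueAt_eq])
    exact congr_arg ρ.value (Subtype.ext h0)

include hA hcone hγ in
-- The coefficients of the generic member are the scalars. Their values at a place centred at u form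
-- a limit with values u, and by identification there is only one; so they do not depend on the
-- place.
theorem admitsBranchingFree : I.AdmitsBranchingFree := by
  classical
  obtain ⟨j, hinj, hj⟩ := exists_embedding hA
  choose κ hκ using exists_coeff_function hA hcone hγ hj
  -- The exponent 0 is added because a circuit has at least one node, even if F = 0.
  obtain ⟨β, hβs, hβ⟩ := Circuit.exists_circuit_sum (insert 0 F.support)
    ⟨0, Finset.mem_insert_self _ _⟩ κ
  refine ⟨β, isAdmissible hA hcone hγ, ?_, ?_⟩
  · intro u hu val hval f hf
    rw [paramProj_A hA] at hu
    obtain ⟨ζ, rfl⟩ := hu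
    have hfs : f = spec F ζ := MvPolynomial.funext fun x =>
      (fiberIsGraph_A hA hγ ζ x _).mp ((hf x _).mpr rfl)
    have h := hβ (MvPolynomial (Fin I.n) ℂ) X (fun θ => C (val θ))
    convert h using 1
    rw [hfs]
    have h1 : ∀ d ∈ insert 0 F.support, C (val (κ d)) * ∏ i, X i ^ d i =
        monomial d (coeff d (spec F ζ)) := by
      intro d hd
      rw [coeff_spec, ← eq_of_hasValueAt hj (hκ d) (hval _ ((hβs _).mpr ⟨d, hd, rfl⟩)),
        monomial_eq, Finsupp.prod_fintype _ _ (by simp)]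
    rw [Finset.sum_congr rfl h1]
    ext d
    simp only [coeff_sum, coeff_monomial, Finset.sum_ite_eq']
    split_ifs with h
    · rfl
    · rw [coeff_spec]
      simp only [Finset.mem_insert, not_or, notMem_support_iff] at h
      rw [h.2, map_zero]
  · intro u _ θ hθ
    obtain ⟨d, -, rfl⟩ := (hβs _).mp hθ
    by_cases h : ∃ ρ : ComplexPlace I.K, I.IsCenteredAt ρ u
    · obtain ⟨ρ, hρ⟩ := h
      obtain ⟨y, hy, hyu, -⟩ := value_coeff_function hcone hγ hinj hj hκ hρ
      refine ⟨y d, fun ρ' hρ' => ?_⟩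
      obtain ⟨y', hy', hyu', hv⟩ := value_coeff_function hcone hγ hinj hj hκ hρ'
      have : y = y' := hy.eq_of_values hγ hy' fun k => by rw [hyu, hyu']
      rw [this]; exact hv d
    · exact ⟨0, fun ρ hρ => (h ⟨ρ, hρ⟩).elim⟩

end DefinesFamily

end QueryInput

/-! ### The lower bound for the number of scalars -/

/-- The polynomials whose constant term is a complex number and whose linear term lies in the
given space. -/
def linearTermSubring {P : Type} [CommRing P] [Algebra ℂ P] (N : Submodule ℂ P) :
    Subring (Polynomial P) where
  carrier := {p | (∃ a : ℂ, p.coeff 0 = algebraMap ℂ P a) ∧ p.coeff 1 ∈ N}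
  mul_mem' := by
    rintro p q ⟨⟨a, ha⟩, hp⟩ ⟨⟨b, hb⟩, hq⟩
    refine ⟨⟨a * b, by rw [Polynomial.mul_coeff_zero, ha, hb, map_mul]⟩, ?_⟩
    -- Product rule: the linear term is a·q₁ + b·p₁. It stays in the ℂ-space N because the constant
    -- terms a and b are complex numbers.
    rw [Polynomial.mul_coeff_one, ha, hb, ← Algebra.smul_def, mul_comm, ← Algebra.smul_def]
    exact add_mem (N.smul_mem _ hq) (N.smul_mem _ hp)
  one_mem' := ⟨⟨1, by simp⟩, by simp [Polynomial.coeff_one]⟩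
  add_mem' := by
    rintro p q ⟨⟨a, ha⟩, hp⟩ ⟨⟨b, hb⟩, hq⟩
    exact ⟨⟨a + b, by simp [ha, hb]⟩, by simpa using add_mem hp hq⟩
  zero_mem' := ⟨⟨0, by simp⟩, by simp⟩
  neg_mem' := by
    rintro p ⟨⟨a, ha⟩, hp⟩
    exact ⟨⟨-a, by simp [ha]⟩, by simpa using hp⟩

/-- The monic equation splits over ℂ, and in a domain one of the linear factors must vanish at a. -/
theorem exists_algebraMap_of_isIntegral {P : Type} [CommRing P] [IsDomain P] [Algebra ℂ P] {a : P}
    (ha : IsIntegral ℂ a) : ∃ z : ℂ, a = algebraMap ℂ P z := by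
  obtain ⟨p, hp, h⟩ := ha
  have hs := IsAlgClosed.splits p
  rw [hs.eq_prod_roots_of_monic hp, Polynomial.eval₂_multiset_prod, Multiset.prod_eq_zero_iff,
    Multiset.mem_map] at h
  obtain ⟨q, hq, h⟩ := h
  obtain ⟨z, -, rfl⟩ := Multiset.mem_map.mp hq
  exact ⟨z, by simpa [sub_eq_zero] using h⟩

theorem card_le_ncard_of_linearIndependent {P κ : Type} [CommRing P] [Algebra ℂ P] {N : ℕ}
    {v : Fin N → P} (hv : LinearIndependent ℂ v) {s : Set κ} (hs : s.Finite) (f : κ → P)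
    (h : ∀ i, v i ∈ Submodule.span ℂ (f '' s)) : N ≤ s.ncard := by
  classical
  have : Finite (f '' s) := hs.image f
  have : Module.Finite ℂ (Submodule.span ℂ (f '' s)) := Module.Finite.span_of_finite ℂ (hs.image f)
  have h1 : LinearIndependent ℂ fun i => (⟨v i, h i⟩ : Submodule.span ℂ (f '' s)) :=
    LinearIndependent.of_comp (Submodule.subtype _) hv
  have h2 := h1.fintype_card_le_finrank
  rw [Fintype.card_fin] at h2
  have _ : Fintype (f '' s) := Fintype.ofFinite _
  calc N ≤ _ := h2
    _ ≤ (f '' s).toFinset.card := finrank_span_le_card _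
    _ = (f '' s).ncard := (Set.ncard_eq_toFinset_card' _).symm
    _ ≤ s.ncard := Set.ncard_image_le hs

theorem Circuit.map_nodeVal_X {ι κ R T : Type} [CommRing R] [CommRing T] (c : Circuit ι κ)
    (z : κ → R) (g : R →+* T) (p : ℕ) :
    map g (Circuit.nodeVal c X (fun s => C (z s)) p) =
      Circuit.nodeVal c X (fun s => C (g (z s))) p := by
  rw [Circuit.map_nodeVal]
  simp only [map_X, map_C]

namespace QueryInput

variable {I : QueryInput} {σ : Type} {F : MvPolynomial (Fin I.n) (MvPolynomial σ ℂ)}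
  {γ : Fin I.m → Fin I.n → ℚ}

/-- The scalars of a branching-free representation are integral over the coordinate ring. -/
theorem IsBranchingFreeRep.isIntegralElem (hA : I.DefinesFamily F γ)
    {β : Circuit (Fin I.n) I.K} (hβ : I.IsBranchingFreeRep β) {θ : I.K}
    (hθ : Gate.scalar θ ∈ β) :
    ((algebraMap I.coordRing I.K).comp (Ideal.Quotient.mk _)).IsIntegralElem θ := by
  have := DefinesFamily.isDomain hA
  let _ : Algebra ℂ I.K :=
    (((algebraMap I.coordRing I.K).comp (Ideal.Quotient.mk _)).comp C).toAlgebra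
  have hof : ∀ p, aeval (fun k => I.ofPoly (X k)) p = I.ofPoly p := by
    intro p
    have : (aeval (R := ℂ) (fun k => I.ofPoly (X k))).toRingHom =
        (algebraMap I.coordRing I.K).comp (Ideal.Quotient.mk _) := by
      refine MvPolynomial.ringHom_ext (fun a => ?_) (fun k => ?_)
      · simp; rfl
      · simp; rfl
    exact DFunLike.congr_fun this p
  by_contra hx
  obtain ⟨ρ, u, hu, hρ⟩ := ComplexPlace.exists_not_mem_finite (fun k => I.ofPoly (X k)) (x := θ)
    (fun ⟨p, hp, h⟩ => hx ⟨p, hp, by rw [← h]; congr 1; exact (RingHom.ext hof).symm⟩)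
  simp only [hof] at hu
  -- The place takes the class of p to p(u). If p vanishes on the parameters of A, its class is 0,
  -- so p(u) = 0.
  have huV : u ∈ I.V := by
    refine mem_zariskiClosure.mpr fun p hp => ?_
    obtain ⟨h, h'⟩ := hu p
    rw [← h', ← map_zero ρ.value]
    refine congr_arg ρ.value (Subtype.ext ?_)
    refine (DefinesFamily.ofPoly_eq_zero_iff hA p).mpr
      ((DefinesFamily.mem_vanishingIdeal_V hA).mp ?_)
    rw [V, mem_vanishingIdeal_zariskiClosure]
    exact hp
  obtain ⟨t, ht⟩ := hβ.2.2 u huV θ hθ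
  exact hρ (ht ρ hu).1

/-- A branching-free representation computes the generic member of the family. -/
theorem IsBranchingFreeRep.nodeVal_eq [Finite σ] (hA : I.DefinesFamily F γ)
    (hγ : IsIdentificationSeq (polyClosure (Set.range (spec F))) γ)
    {β : Circuit (Fin I.n) I.K} (hβ : I.IsBranchingFreeRep β)
    {j : I.K →+* FractionRing (MvPolynomial σ ℂ)}
    (hj : ∀ p, j (I.ofPoly p) = algebraMap _ _ (aeval (fun k => valueAt F (γ k)) p)) :
    Circuit.nodeVal β X (fun θ => C (j θ)) (β.length - 1) = map (algebraMap _ _) F := by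
  classical
  set E := FractionRing (MvPolynomial σ ℂ)
  set v : MvPolynomial (Fin I.m) ℂ →ₐ[ℂ] MvPolynomial σ ℂ := aeval (fun k => valueAt F (γ k)) with hv
  choose p q hq hpq using DefinesFamily.exists_mul_eq hA
  let S := {θ : I.K | Gate.scalar θ ∈ β}
  have hS : S.Finite := Circuit.finite_scalars β
  -- A finitely generated algebra containing the parameters and the images of all scalars. Its
  -- complex points specialise both at once.
  let T : Subalgebra ℂ E := Algebra.adjoin ℂ (Set.range (fun s => algebraMap (MvPolynomial σ ℂ) E (X s)) ∪ j '' S)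
  have hT : Algebra.FiniteType ℂ T :=
    (Subalgebra.fg_iff_finiteType _).mp ((Subalgebra.fg_def).mpr
      ⟨_, (Set.finite_range _).union (hS.image _), rfl⟩)
  have hXT : ∀ s, algebraMap (MvPolynomial σ ℂ) E (X s) ∈ T := fun s =>
    Algebra.subset_adjoin (Or.inl ⟨s, rfl⟩)
  let i : MvPolynomial σ ℂ →ₐ[ℂ] T := aeval (fun s => ⟨_, hXT s⟩)
  have hi : ∀ a, (i a : E) = algebraMap _ _ a := by
    intro a
    have : T.val.comp i = IsScalarTower.toAlgHom ℂ (MvPolynomial σ ℂ) E := by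
      ext s; simp [i]
    exact DFunLike.congr_fun this a
  have hi0 : ∀ a, a ≠ 0 → i a ≠ 0 := fun a ha h => ha (by
    have := congr_arg (fun t : T => (t : E)) h
    simp only [hi] at this
    exact (IsFractionRing.to_map_eq_zero_iff).mp this)
  -- Elements that are not scalars of β never enter the evaluation; the default 0 makes the map
  -- total.
  let e : I.K → T := fun θ => if h : θ ∈ S then ⟨j θ, Algebra.subset_adjoin (Or.inr ⟨θ, h, rfl⟩)⟩ else 0
  set G := Circuit.nodeVal β X (fun θ => C (e θ)) (β.length - 1) with hG
  have hGE : map (T.val.toRingHom) G = Circuit.nodeVal β X (fun θ => C (j θ)) (β.length - 1) := by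
    refine (Circuit.map_nodeVal_X _ _ _ _).trans ?_
    refine Circuit.nodeVal_congr ?_ _
    intro θ hθ
    have : θ ∈ S := hθ
    simp [e, this]
  have key : G = map i.toRingHom F := by
    by_contra hne
    obtain ⟨d, hd⟩ : ∃ d, coeff d G - coeff d (map i.toRingHom F) ≠ 0 := by
      by_contra! h
      exact hne (by ext1 d; exact sub_eq_zero.mp (h d))
    -- Where the product b of the denominators does not vanish, all scalars are defined. A point
    -- with b ≠ 0 at which the two coefficients differ would contradict condition (i) for that
    -- member.
    let b : MvPolynomial σ ℂ := ∏ θ ∈ hS.toFinset, v (q θ)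
    have hb : b ≠ 0 := Finset.prod_ne_zero_iff.mpr fun θ _ => hq θ
    obtain ⟨φ, hφ⟩ := exists_algHom_ne_zero (mul_ne_zero hd (hi0 b hb))
    rw [map_mul] at hφ
    let ζ : σ → ℂ := fun s => φ (i (X s))
    have hζ : ∀ a, φ (i a) = eval ζ a := by
      intro a
      have : φ.comp i = aeval ζ := by ext s; simp [ζ]
      exact DFunLike.congr_fun this a
    have hqζ : ∀ θ ∈ S, eval ζ (v (q θ)) ≠ 0 := by
      intro θ hθ h0
      apply hφ
      rw [hζ b, map_prod, Finset.prod_eq_zero (hS.mem_toFinset.mpr hθ) h0, mul_zero]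
    have hcomp := hβ.2.1 (valuePoint F γ ζ) (by rw [DefinesFamily.paramProj_A hA]; exact ⟨ζ, rfl⟩)
      (fun θ => φ (e θ)) (by
        intro θ hθ
        refine ⟨p θ, q θ, ?_, hpq θ, ?_⟩
        · rw [eval_valuePoint]; exact hqζ θ hθ
        · rw [eval_valuePoint, eval_valuePoint]
          change φ (e θ) * eval ζ (v (q θ)) = eval ζ (v (p θ))
          rw [← hζ, ← hζ, ← map_mul]
          congr 1
          apply Subtype.ext
          have hθ' : θ ∈ S := hθ
          simp only [e, hθ', dite_true, MulMemClass.coe_mul, hi]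
          rw [← hj, ← hj, ← map_mul, hpq]) _ (DefinesFamily.fiberIsGraph_A hA hγ ζ)
    rw [Circuit.computes_iff] at hcomp
    have h1 : map φ.toRingHom G = spec F ζ := by
      rw [← hcomp.2.2]
      exact Circuit.map_nodeVal_X _ _ _ _
    have h2 : map φ.toRingHom (map i.toRingHom F) = spec F ζ := by
      rw [map_map, spec]
      exact congr_arg (fun g => map g F) (RingHom.ext hζ)
    have h3 := congr_arg (coeff d) (h1.trans h2.symm)
    rw [coeff_map, coeff_map] at h3
    apply left_ne_zero_of_mul hφ
    rw [map_sub, sub_eq_zero]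
    exact h3
  rw [← hGE, key, map_map]
  exact congr_arg (fun g => map g F) (RingHom.ext hi)

/-- Along the scaling of the cone each scalar is a polynomial in T with constant term in ℂ. To first
order in T the circuit can only combine the linear terms of its scalars linearly, yet its output is
T · F; so independent coefficients of F require as many scalars. -/
theorem IsBranchingFreeRep.le_numScalars [Finite σ] (hA : I.DefinesFamily F γ)
    (hcone : ∀ (t : ℂ) (ζ : σ → ℂ), ∃ ζ', spec F ζ' = C t * spec F ζ)
    (hγ : IsIdentificationSeq (polyClosure (Set.range (spec F))) γ)
    {β : Circuit (Fin I.n) I.K} (hβ : I.IsBranchingFreeRep β) {N : ℕ} {d : Fin N → Fin I.n →₀ ℕ}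
    (hd : LinearIndependent ℂ fun i => coeff (d i) F) : N ≤ β.numScalars := by
  classical
  obtain ⟨j, hinj, hj⟩ := DefinesFamily.exists_embedding hA
  obtain ⟨μ, hμinj, hμ⟩ := DefinesFamily.exists_scaling hA hcone
  set L := FractionRing (Polynomial (MvPolynomial σ ℂ))
  let S := {θ : I.K | Gate.scalar θ ∈ β}
  have hS : S.Finite := Circuit.finite_scalars β
  have hη : ∀ θ, ∃ η : Polynomial (MvPolynomial σ ℂ), θ ∈ S → algebraMap _ _ η = μ θ ∧
      ∃ a : ℂ, η.coeff 0 = algebraMap _ _ a := by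
    intro θ
    by_cases hθ : θ ∈ S
    swap
    · exact ⟨0, fun h => (hθ h).elim⟩
    obtain ⟨f, hf, h⟩ := hβ.isIntegralElem hA hθ
    let g : MvPolynomial (Fin I.m) ℂ →ₐ[ℂ] Polynomial (MvPolynomial σ ℂ) :=
      aeval (fun k => Polynomial.X * Polynomial.C (valueAt F (γ k)))
    have hg : μ.comp ((algebraMap I.coordRing I.K).comp (Ideal.Quotient.mk _)) =
        (algebraMap (Polynomial (MvPolynomial σ ℂ)) L).comp g.toRingHom := RingHom.ext hμ
    have h1 := congr_arg μ h
    rw [Polynomial.hom_eval₂, map_zero, hg] at h1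
    -- θ is integral over ℂ[V], whose image lies in P[T], and P[T] is integrally closed.
    obtain ⟨η, hη⟩ := (IsIntegrallyClosed.isIntegral_iff (R := Polynomial (MvPolynomial σ ℂ))).mp
      ⟨f.map g.toRingHom, hf.map _, by rw [Polynomial.eval₂_map]; exact h1⟩
    refine ⟨η, fun _ => ⟨hη, exists_algebraMap_of_isIntegral ?_⟩⟩
    rw [← hη, ← Polynomial.hom_eval₂, map_eq_zero_iff _ (IsFractionRing.injective _ _)] at h1
    -- At T = 0 all scaled values vanish, so the monic equation acquires complex coefficients.
    have h2 := congr_arg (Polynomial.evalRingHom (0 : MvPolynomial σ ℂ)) h1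
    rw [Polynomial.hom_eval₂, map_zero] at h2
    refine ⟨f.map (eval 0), hf.map _, ?_⟩
    rw [Polynomial.eval₂_map, ← h2, Polynomial.coeff_zero_eq_eval_zero]
    congr 1
    refine MvPolynomial.ringHom_ext (fun a => ?_) (fun k => ?_)
    · simp [g, Polynomial.algebraMap_apply]
    · simp [g]
  choose η hη using hη
  refine card_le_ncard_of_linearIndependent hd hS (fun θ => (η θ).coeff 1) fun i => ?_
  -- The span of one vector per scalar, namely the linear term of its image in P[T].
  set N' : Submodule ℂ (MvPolynomial σ ℂ) := Submodule.span ℂ ((fun θ => (η θ).coeff 1) '' S) with hN'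
  let Λ := linearTermSubring N'
  let f : Λ →+* L := (algebraMap (Polynomial (MvPolynomial σ ℂ)) L).comp Λ.subtype
  have hmem : Circuit.nodeVal β X (fun θ => C (μ θ)) (β.length - 1) ∈
      (map (σ := Fin I.n) f).range := by
    refine Circuit.nodeVal_mem (map (σ := Fin I.n) f).range (fun i => ⟨X i, by simp⟩)
      (fun θ hθ => ?_) _
    obtain ⟨h1, h2⟩ := hη θ hθ
    refine ⟨C ⟨η θ, h2, Submodule.subset_span ⟨θ, hθ, rfl⟩⟩, ?_⟩
    rw [map_C, ← h1]; rfl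
  obtain ⟨G, hG⟩ := hmem
  set κ := coeff (d i) (Circuit.nodeVal β X (fun θ => C θ) (β.length - 1)) with hκ
  have hjκ : j κ = algebraMap _ _ (coeff (d i) F) := by
    rw [hκ, ← coeff_map, Circuit.map_nodeVal_X]
    rw [hβ.nodeVal_eq hA hγ hj, coeff_map]
  -- The coefficient of the output is T times that of F, and it lies in Λ. Its linear term, the
  -- coefficient of F itself, therefore lies in N'.
  have hμκ := DefinesFamily.scaling_coeff hA hcone hj hμinj hμ hjκ
  rw [hκ, ← coeff_map, Circuit.map_nodeVal_X] at hμκ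
  rw [← hG] at hμκ
  change coeff (d i) (map f G) = _ at hμκ
  rw [coeff_map] at hμκ
  have h : ((coeff (d i) G : Λ) : Polynomial (MvPolynomial σ ℂ)) = _ :=
    IsFractionRing.injective (Polynomial (MvPolynomial σ ℂ)) L hμκ
  have h2 := (coeff (d i) G).2.2
  rw [h] at h2
  simpa using h2

end QueryInput

/-! ### Computations with few essential multiplications -/

namespace Circuit

variable {n : ℕ}

/-- The positions of the essential multiplications. -/
def essential (c : Circuit (Fin n) ℂ) : Set ℕ :=
  {p | ∃ a b, c.nodeAt p = some (Gate.mul a b) ∧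
    nodeVal c X C a ∉ Set.range (C : ℂ → MvPolynomial (Fin n) ℂ) ∧
    nodeVal c X C b ∉ Set.range (C : ℂ → MvPolynomial (Fin n) ℂ)}

theorem lt_of_nodeAt {ι κ : Type} {c : Circuit ι κ} {p : ℕ} {g : Gate ι κ}
    (h : c.nodeAt p = some g) : p < c.length :=
  (List.getElem?_eq_some_iff.mp h).1

theorem finite_essential (c : Circuit (Fin n) ℂ) : c.essential.Finite :=
  (Set.finite_Iio c.length).subset fun _ ⟨_, _, h, _⟩ => lt_of_nodeAt h

theorem mem_essential_concat {c : Circuit (Fin n) ℂ} (hc : c.WellFormed) {g : Gate (Fin n) ℂ}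
    (hg : WellFormed (c ++ [g])) {p : ℕ} : p ∈ essential (c ++ [g]) ↔
      p ∈ essential c ∨ p = c.length ∧ ∃ a b, g = Gate.mul a b ∧
        nodeVal c X C a ∉ Set.range (C : ℂ → MvPolynomial (Fin n) ℂ) ∧
        nodeVal c X C b ∉ Set.range (C : ℂ → MvPolynomial (Fin n) ℂ) := by
  constructor
  · rintro ⟨a, b, h, ha, hb⟩
    have hab := hg p _ h
    rcases nodeAt_concat_eq_some h with h | ⟨rfl, rfl⟩
    · have hp := lt_of_nodeAt h
      rw [nodeVal_append (hab.1.trans hp)] at ha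
      rw [nodeVal_append (hab.2.trans hp)] at hb
      exact Or.inl ⟨a, b, h, ha, hb⟩
    · rw [nodeVal_append hab.1] at ha
      rw [nodeVal_append hab.2] at hb
      exact Or.inr ⟨rfl, a, b, rfl, ha, hb⟩
  · rintro (⟨a, b, h, ha, hb⟩ | ⟨rfl, a, b, rfl, ha, hb⟩)
    · have hab := hc p _ h
      have hp := lt_of_nodeAt h
      refine ⟨a, b, by rwa [nodeAt_append_left hp], ?_, ?_⟩
      · rwa [nodeVal_append (hab.1.trans hp)]
      · rwa [nodeVal_append (hab.2.trans hp)]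
    · have hab := hg _ _ (nodeAt_concat _)
      refine ⟨a, b, nodeAt_concat _, ?_, ?_⟩
      · rwa [nodeVal_append hab.1]
      · rwa [nodeVal_append hab.2]

end Circuit

open Circuit

theorem nonscalarSizeLE_iff {n L : ℕ} {f : MvPolynomial (Fin n) ℂ} :
    NonscalarSizeLE L f ↔ ∃ c : Circuit (Fin n) ℂ, c.WellFormed ∧ c.essential.ncard ≤ L ∧
      c ≠ [] ∧ nodeVal c X C (c.length - 1) = f := by
  constructor
  · rintro ⟨c, v, hv, ⟨p, hp, rfl⟩, hL⟩
    refine ⟨c, hv.wellFormed, ?_, by rintro rfl; simp at hp, ?_⟩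
    · convert hL using 2
      ext q
      refine exists_congr fun a => exists_congr fun b => and_congr_right fun h => ?_
      have hab := hv.wellFormed _ _ h
      have hq := lt_of_nodeAt h
      rw [hv.eq_nodeVal _ (hab.1.trans hq), hv.eq_nodeVal _ (hab.2.trans hq)]
    · rw [hv.eq_nodeVal p (by omega), ← hp, Nat.add_sub_cancel]
  · rintro ⟨c, hc, hL, hne, rfl⟩
    have := List.length_pos_iff.mpr hne
    exact ⟨c, _, hc.trace_nodeVal, ⟨c.length - 1, by omega, rfl⟩, hL⟩

/-- The polynomials in `s` are results of one computation with at most `L` essential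
multiplications. -/
def JointlyComputable {n : ℕ} (L : ℕ) (s : Set (MvPolynomial (Fin n) ℂ)) : Prop :=
  ∃ c : Circuit (Fin n) ℂ, c.WellFormed ∧ c.essential.ncard ≤ L ∧
    ∀ f ∈ s, ∃ p < c.length, nodeVal c X C p = f

namespace JointlyComputable

variable {n L : ℕ} {s t : Set (MvPolynomial (Fin n) ℂ)} {f g : MvPolynomial (Fin n) ℂ}

theorem mono (hs : JointlyComputable L s) (h : t ⊆ s) : JointlyComputable L t := by
  obtain ⟨c, hc, hL, hcs⟩ := hs
  exact ⟨c, hc, hL, fun f hf => hcs f (h hf)⟩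

theorem empty : JointlyComputable L (∅ : Set (MvPolynomial (Fin n) ℂ)) := by
  refine ⟨[], wellFormed_nil, ?_, by simp⟩
  have : essential ([] : Circuit (Fin n) ℂ) = ∅ := by
    ext p; simp [essential, nodeAt]
  simp [this]

theorem concat {c : Circuit (Fin n) ℂ}
    (hcs : ∀ f ∈ s, ∃ p < c.length, nodeVal c X C p = f) {g : Gate (Fin n) ℂ}
    (hg : WellFormed (c ++ [g])) (hL : (essential (c ++ [g])).ncard ≤ L)
    (hf : nodeVal (c ++ [g]) X C c.length = f) : JointlyComputable L (insert f s) := by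
  refine ⟨_, hg, hL, ?_⟩
  rintro h (rfl | hh)
  · exact ⟨c.length, by simp, hf⟩
  · obtain ⟨p, hp, rfl⟩ := hcs _ hh
    exact ⟨p, by simp; omega, nodeVal_append hp⟩

theorem concat_free {c : Circuit (Fin n) ℂ} (hc : c.WellFormed) (hcL : c.essential.ncard ≤ L)
    (hcs : ∀ f ∈ s, ∃ p < c.length, nodeVal c X C p = f) {g : Gate (Fin n) ℂ}
    (hg : WellFormed (c ++ [g]))
    (hfree : ∀ a b, g = Gate.mul a b →
      nodeVal c X C a ∈ Set.range (C : ℂ → MvPolynomial (Fin n) ℂ))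
    (hf : nodeVal (c ++ [g]) X C c.length = f) : JointlyComputable L (insert f s) := by
  refine concat hcs hg (le_trans (Set.ncard_le_ncard ?_ (finite_essential c)) hcL) hf
  intro p hp
  rcases (mem_essential_concat hc hg).mp hp with h | ⟨-, a, b, h, ha, -⟩
  · exact h
  · exact (ha (hfree a b h)).elim

theorem insert_X (hs : JointlyComputable L s) (i : Fin n) : JointlyComputable L (insert (X i) s) := by
  obtain ⟨c, hc, hL, hcs⟩ := hs
  exact concat_free hc hL hcs (hc.concat (g := Gate.input i) trivial) (by simp)
    (nodeVal_concat_input i)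

theorem insert_C (hs : JointlyComputable L s) (a : ℂ) : JointlyComputable L (insert (C a) s) := by
  obtain ⟨c, hc, hL, hcs⟩ := hs
  exact concat_free hc hL hcs (hc.concat (g := Gate.scalar a) trivial) (by simp)
    (nodeVal_concat_scalar a)

theorem insert_add (hs : JointlyComputable L s) (hf : f ∈ s) (hg : g ∈ s) :
    JointlyComputable L (insert (f + g) s) := by
  obtain ⟨c, hc, hL, hcs⟩ := hs
  obtain ⟨p, hp, rfl⟩ := hcs _ hf
  obtain ⟨q, hq, rfl⟩ := hcs _ hg
  exact concat_free hc hL hcs (hc.concat (g := Gate.add p q) ⟨hp, hq⟩) (by simp)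
    (nodeVal_concat_add hp hq)

theorem insert_C_mul (hs : JointlyComputable L s) (hf : f ∈ s) (a : ℂ) :
    JointlyComputable L (insert (C a * f) s) := by
  obtain ⟨c, hc, hL, hcs⟩ := hs.insert_C a
  obtain ⟨p, hp, hpa⟩ := hcs _ (Set.mem_insert _ _)
  obtain ⟨q, hq, rfl⟩ := hcs _ (Set.mem_insert_of_mem _ hf)
  refine (concat_free hc hL hcs (hc.concat (g := Gate.mul p q) ⟨hp, hq⟩) ?_
    (nodeVal_concat_mul hp hq)).mono ?_
  · intro a' b' h
    obtain ⟨rfl, rfl⟩ : p = a' ∧ q = b' := by simpa using h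
    exact ⟨a, hpa.symm⟩
  · rw [hpa]
    exact Set.insert_subset_insert (Set.subset_insert _ _)

theorem insert_mul (hs : JointlyComputable L s) (hf : f ∈ s) (hg : g ∈ s) :
    JointlyComputable (L + 1) (insert (f * g) s) := by
  obtain ⟨c, hc, hL, hcs⟩ := hs
  obtain ⟨p, hp, rfl⟩ := hcs _ hf
  obtain ⟨q, hq, rfl⟩ := hcs _ hg
  have hw := hc.concat (g := Gate.mul p q) ⟨hp, hq⟩
  refine concat hcs hw ?_ (nodeVal_concat_mul hp hq)
  refine (Set.ncard_le_ncard (t := insert c.length c.essential) ?_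
    ((finite_essential c).insert _)).trans ((Set.ncard_insert_le _ _).trans (by omega))
  intro k hk
  rcases (mem_essential_concat hc hw).mp hk with h | ⟨h, -⟩
  · exact Or.inr h
  · exact Or.inl h

theorem insert_span (hs : JointlyComputable L s)
    (hf : f ∈ Submodule.span ℂ (s ∪ insert 1 (Set.range X))) :
    JointlyComputable L (insert f s) := by
  -- The claim is generalised to larger sets because summands already computed have to stay
  -- available.
  have key : ∀ t, s ⊆ t → JointlyComputable L t → JointlyComputable L (insert f t) := by
    induction hf using Submodule.span_induction with
    | mem x hx =>
      intro t hst ht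
      rcases hx with hx | rfl | ⟨i, rfl⟩
      · rwa [Set.insert_eq_of_mem (hst hx)]
      · simpa using ht.insert_C 1
      · exact ht.insert_X i
    | zero => intro t _ ht; simpa using ht.insert_C 0
    | add x y _ _ hx hy =>
      intro t hst ht
      have h1 := hx t hst ht
      have h2 := hy _ (hst.trans (Set.subset_insert _ _)) h1
      exact (h2.insert_add (Set.mem_insert_of_mem _ (Set.mem_insert _ _))
        (Set.mem_insert _ _)).mono (Set.insert_subset_insert
          ((Set.subset_insert _ _).trans (Set.subset_insert _ _)))
    | smul a x _ hx =>
      intro t hst ht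
      rw [smul_eq_C_mul]
      exact ((hx t hst ht).insert_C_mul (Set.mem_insert _ _) a).mono
        (Set.insert_subset_insert (Set.subset_insert _ _))
  exact key s subset_rfl hs

theorem nonscalarSizeLE (hs : JointlyComputable L s) (hf : f ∈ s) : NonscalarSizeLE L f := by
  -- The output must be the last node; the free addition 0 + f moves f there.
  obtain ⟨c, hc, hL, hcs⟩ := hs.insert_C 0
  obtain ⟨p, hp, h0⟩ := hcs _ (Set.mem_insert _ _)
  obtain ⟨q, hq, hqf⟩ := hcs _ (Set.mem_insert_of_mem _ hf)
  have hw := hc.concat (g := Gate.add p q) ⟨hp, hq⟩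
  refine nonscalarSizeLE_iff.mpr ⟨_, hw, ?_, by simp, ?_⟩
  · refine le_trans (Set.ncard_le_ncard ?_ (finite_essential c)) hL
    intro k hk
    rcases (mem_essential_concat hc hw).mp hk with h | ⟨-, a, b, h, -⟩
    · exact h
    · simp at h
  · simp only [List.length_append, List.length_singleton, Nat.add_sub_cancel]
    rw [nodeVal_concat_add hp hq, h0, hqf, map_zero, zero_add]

end JointlyComputable

theorem NonscalarSizeLE.jointlyComputable {n L : ℕ} {f : MvPolynomial (Fin n) ℂ}
    (hf : NonscalarSizeLE L f) : JointlyComputable L {f} := by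
  obtain ⟨c, hc, hL, hne, rfl⟩ := nonscalarSizeLE_iff.mp hf
  have := List.length_pos_iff.mpr hne
  exact ⟨c, hc, hL, by rintro _ rfl; exact ⟨c.length - 1, by omega, rfl⟩⟩

theorem C_mul_mem_lowComplexity {L n : ℕ} {f : MvPolynomial (Fin n) ℂ} (hf : f ∈ lowComplexity L n)
    (t : ℂ) : C t * f ∈ lowComplexity L n :=
  (hf.jointlyComputable.insert_C_mul rfl t).nonscalarSizeLE (Set.mem_insert _ _)

theorem C_mem_lowComplexity (L n : ℕ) (t : ℂ) : C t ∈ lowComplexity L n :=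
  (JointlyComputable.empty.insert_C t).nonscalarSizeLE (Set.mem_insert _ _)

/-- One addition of a constant, then L squarings. These are the members that separate the
coefficients in the lower bound. -/
theorem X_add_C_pow_mem_lowComplexity (L : ℕ) {n : ℕ} (i : Fin n) (a : ℂ) :
    (X i + C a) ^ 2 ^ L ∈ lowComplexity L n := by
  have : JointlyComputable L {(X i + C a : MvPolynomial (Fin n) ℂ) ^ 2 ^ L} := by
    induction L with
    | zero =>
      have h := ((JointlyComputable.empty (n := n) (L := 0)).insert_C a).insert_X i
      simpa using (h.insert_add (Set.mem_insert _ _) (Set.mem_insert_of_mem _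
        (Set.mem_insert _ _))).mono (Set.singleton_subset_iff.mpr (Set.mem_insert _ _))
    | succ L ih =>
      rw [pow_succ, pow_mul, pow_two]
      exact (ih.insert_mul rfl rfl).mono (Set.singleton_subset_iff.mpr (Set.mem_insert _ _))
  exact this.nonscalarSizeLE rfl

/-! ### The generic circuit over the arithmetic database -/

section

open Circuit

theorem relS_arithmetic : Database.arithmetic.relS = addGraph ℂ := by
  funext a b c
  simp [Database.relS, Database.arithmetic, addGraph]

theorem relP_arithmetic : Database.arithmetic.relP = mulGraph ℂ := by
  funext a b c
  simp [Database.relP, Database.arithmetic, mulGraph]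

theorem psi_arithmetic {n r : ℕ} {c : Circuit (Fin n) (Fin r)} {z : Fin r → ℂ} {x : Fin n → ℂ}
    {y : ℂ} : Psi c Database.arithmetic z x y ↔ c.Computes x z y := by
  rw [Psi, relS_arithmetic, relP_arithmetic]; rfl

section Generic

variable {n r : ℕ} (c : Circuit (Fin n) (Fin r))

/-- The polynomial computed by a circuit over indeterminate scalars. -/
def genericPoly : MvPolynomial (Fin n) (MvPolynomial (Fin r) ℂ) :=
  nodeVal c X (fun s => C (X s)) (c.length - 1)

theorem spec_genericPoly (ζ : Fin r → ℂ) :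
    spec (genericPoly c) ζ = nodeVal c X (fun s => C (ζ s)) (c.length - 1) := by
  rw [spec, genericPoly, map_nodeVal_X]
  simp only [eval_X]

theorem eval_spec_genericPoly (ζ : Fin r → ℂ) (x : Fin n → ℂ) :
    eval x (spec (genericPoly c) ζ) = nodeVal c x ζ (c.length - 1) := by
  rw [spec_genericPoly, map_nodeVal]
  simp only [eval_X, eval_C]

end Generic

namespace IsGenericCircuit

variable {L n : ℕ} {c : Circuit (Fin n) (Fin (numGenericScalars L n))}
  (hc : IsGenericCircuit L n c)

include hc

/-- Neither property is part of the definition of a generic circuit. Both follow from the fact that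
the circuit computes at least one polynomial, here 0. -/
theorem wellFormed_and_ne_nil : c.WellFormed ∧ c ≠ [] := by
  obtain ⟨ζ, h⟩ := (hc _).mp (C_mem_lowComplexity L n 0)
  rw [computes_iff] at h
  exact ⟨h.1, h.2.1⟩

theorem range_spec : Set.range (spec (genericPoly c)) = lowComplexity L n := by
  obtain ⟨h1, h2⟩ := hc.wellFormed_and_ne_nil
  ext f
  rw [hc f]
  refine exists_congr fun ζ => ?_
  rw [computes_iff, spec_genericPoly]
  simp [h1, h2]

theorem cone (t : ℂ) (ζ : Fin (numGenericScalars L n) → ℂ) :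
    ∃ ζ', spec (genericPoly c) ζ' = C t * spec (genericPoly c) ζ := by
  have h := hc.range_spec
  have h1 : spec (genericPoly c) ζ ∈ lowComplexity L n := h ▸ ⟨ζ, rfl⟩
  have h2 := C_mul_mem_lowComplexity h1 t
  rwa [← h] at h2

theorem psi_iff {z : Fin (numGenericScalars L n) → ℂ} {x : Fin n → ℂ} {y : ℂ} :
    Psi c Database.arithmetic z x y ↔ eval x (spec (genericPoly c) z) = y := by
  obtain ⟨h1, h2⟩ := hc.wellFormed_and_ne_nil
  rw [psi_arithmetic, computes_iff, eval_spec_genericPoly]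
  simp [h1, h2]

theorem delta {m : ℕ} {γ : Fin m → Fin n → ℚ}
    (hγ : IsIdentificationSeq (polyClosure (lowComplexity L n)) γ) :
    Delta c γ Database.arithmetic := by
  refine ⟨?_, ?_, ?_, ?_⟩
  · rw [relS_arithmetic]; intro a b; simp [addGraph]
  · rw [relP_arithmetic]; intro a b; simp [mulGraph]
  · rintro F ⟨z, hz⟩ G ⟨z', hz'⟩ h
    simp only [hc.psi_iff] at hz hz'
    have hz1 : ∀ x, F x = eval x (spec (genericPoly c) z) := fun x => (hz x _).mp rfl
    have hz2 : ∀ x, G x = eval x (spec (genericPoly c) z') := fun x => (hz' x _).mp rfl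
    have hmem : ∀ z, spec (genericPoly c) z ∈ polyClosure (lowComplexity L n) := fun z =>
      subset_zariskiClosure _ ⟨_, hc.range_spec ▸ ⟨z, rfl⟩, rfl⟩
    have := hγ _ (hmem z) _ (hmem z') (fun k => by rw [← hz1, ← hz2, h])
    funext x
    rw [hz1, hz2, this]
  · exact ⟨fun x => eval x (spec (genericPoly c) 0), 0, fun x y => hc.psi_iff⟩

theorem definesFamily {m : ℕ} {γ : Fin m → Fin n → ℚ}
    (hγ : IsIdentificationSeq (polyClosure (lowComplexity L n)) γ)
    {φ : queryLang.Formula (QueryVar m n)} (hφ : ExpressesPhi c γ φ) :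
    QueryInput.DefinesFamily ⟨m, n, Database.arithmetic, φ⟩ (genericPoly c) γ := by
  intro u x y
  refine (hφ _ u x y).trans ?_
  simp only [Phi, hc.psi_iff, hc.delta hγ, and_true]
  exact exists_congr fun ζ => and_comm

/-- On the members (X + a)^(2^L) the coefficient of X^k is a nonzero multiple of a^(2^L - k), and
different powers of a are linearly independent. -/
theorem linearIndependent_coeff (i : Fin n) : LinearIndependent ℂ
    fun k : Fin (2 ^ L) => coeff (Finsupp.single i (k : ℕ)) (genericPoly c) := by
  rw [Fintype.linearIndependent_iff]
  intro lam hlam k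
  have hval : ∀ (a : ℂ) (k : Fin (2 ^ L)), coeff (Finsupp.single i (k : ℕ))
      ((X i + C a : MvPolynomial (Fin n) ℂ) ^ 2 ^ L) = a ^ (2 ^ L - (k : ℕ)) * (2 ^ L).choose k := by
    intro a k
    have h1 : (X i + C a : MvPolynomial (Fin n) ℂ) ^ 2 ^ L = ∑ m ∈ Finset.range (2 ^ L + 1),
        monomial (Finsupp.single i m) (a ^ (2 ^ L - m) * (2 ^ L).choose m) := by
      rw [add_pow]
      refine Finset.sum_congr rfl fun m _ => ?_
      rw [← C_mul_X_pow_eq_monomial, map_mul, map_pow, map_natCast]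
      ring
    have h2 : ∀ m : ℕ, Finsupp.single i m = Finsupp.single i (k : ℕ) ↔ m = k := fun m =>
      (Finsupp.single_injective i).eq_iff
    have h3 := k.2
    simp only [h1, coeff_sum, coeff_monomial, h2, Finset.sum_ite_eq', Finset.mem_range]
    rw [if_pos (by omega)]
  -- A linear relation, evaluated at parameters of (X + a)^(2^L), is a polynomial identity in a.
  have hzero : (∑ k : Fin (2 ^ L), Polynomial.C (lam k * (2 ^ L).choose k) *
      Polynomial.X ^ (2 ^ L - (k : ℕ)) : Polynomial ℂ) = 0 := by
    refine Polynomial.funext fun a => ?_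
    obtain ⟨ζ, hζ⟩ : (X i + C a : MvPolynomial (Fin n) ℂ) ^ 2 ^ L ∈
        Set.range (spec (genericPoly c)) := hc.range_spec ▸ X_add_C_pow_mem_lowComplexity L i a
    have h := congr_arg (eval ζ) hlam
    rw [map_sum, map_zero] at h
    rw [Polynomial.eval_finsetSum, Polynomial.eval_zero, ← h]
    refine Finset.sum_congr rfl fun k _ => ?_
    rw [smul_eval, ← coeff_spec, hζ, hval]
    simp only [Polynomial.eval_mul, Polynomial.eval_C, Polynomial.eval_pow, Polynomial.eval_X]
    ring
  have h := congr_arg (Polynomial.coeff · (2 ^ L - (k : ℕ))) hzero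
  simp only [Polynomial.finsetSum_coeff, Polynomial.coeff_C_mul, Polynomial.coeff_X_pow,
    Polynomial.coeff_zero] at h
  rw [Finset.sum_eq_single k] at h
  · have hk : ((2 ^ L).choose k : ℂ) ≠ 0 :=
      Nat.cast_ne_zero.mpr (Nat.choose_pos k.2.le).ne'
    simpa [hk] using h
  · intro b _ hb
    have h1 := b.2
    have h2 := k.2
    have h3 : (b : ℕ) ≠ k := fun h => hb (Fin.ext h)
    rw [if_neg (by omega), mul_zero]
  · simp

theorem exists_linearIndependent_coeff : ∃ d : Fin (2 ^ n) → Fin n →₀ ℕ, L = n →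
    LinearIndependent ℂ fun k => coeff (d k) (genericPoly c) := by
  -- Without variables there is no power of a variable; a single nonzero coefficient suffices since
  -- 2^0 = 1.
  rcases Nat.eq_zero_or_pos n with rfl | hn
  · refine ⟨0, fun _ => ?_⟩
    rw [Fintype.linearIndependent_iff]
    intro lam hlam k
    obtain ⟨ζ, hζ⟩ : (C 1 : MvPolynomial (Fin 0) ℂ) ∈ Set.range (spec (genericPoly c)) :=
      hc.range_spec ▸ C_mem_lowComplexity L 0 1
    have h := congr_arg (eval ζ) hlam
    have hu : (Finset.univ : Finset (Fin (2 ^ 0))) = {k} := by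
      
      ext b; simp only [Finset.mem_univ, Finset.mem_singleton, true_iff]
      exact Subsingleton.elim (α := Fin 1) b k
    rw [hu, Finset.sum_singleton, smul_eval, ← coeff_spec, hζ] at h
    simpa using h
  · refine ⟨fun k => Finsupp.single ⟨0, hn⟩ (k : ℕ), ?_⟩
    rintro rfl
    exact hc.linearIndependent_coeff _

end IsGenericCircuit

/-! ### Sequential time and the exponential lower bound -/

theorem Procedure.length_config_le (Q : Procedure) (I : QueryInput) (t : ℕ) :
    (Q.config I t).2.length ≤ t := by
  induction t with
  | zero => simp [config]
  | succ t ih =>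
    rw [config]
    split
    · omega
    · rename_i s o _
      cases o <;> simp <;> omega

theorem Procedure.OutputsInTime.numScalars_le {Q : Procedure} {I : QueryInput}
    {β : Circuit (Fin I.n) I.K} {t : ℕ} (h : Q.OutputsInTime I β t) : β.numScalars ≤ t := by
  refine (numScalars_le_length β).trans ?_
  rw [← h.2.2]
  exact Q.length_config_le I t

theorem branchingFree_lower_bound (n : ℕ) (c : Circuit (Fin n) (Fin (numGenericScalars n n)))
    (γ : Fin (numPoints n n) → Fin n → ℚ)
    (φ : queryLang.Formula (QueryVar (numPoints n n) n)) (hc : IsGenericCircuit n n c)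
    (hγ : IsIdentificationSeq (polyClosure (lowComplexity n n)) γ) (hφ : ExpressesPhi c γ φ) :
    QueryInput.AdmitsBranchingFree ⟨numPoints n n, n, Database.arithmetic, φ⟩ ∧
      ∀ (Q : Procedure) (𝓘 : Set QueryInput), Q.IsBranchingParsimonious 𝓘 →
        (⟨numPoints n n, n, Database.arithmetic, φ⟩ : QueryInput) ∈ 𝓘 →
        ∃ (β : Circuit (Fin n) (QueryInput.K ⟨numPoints n n, n, Database.arithmetic, φ⟩)) (t : ℕ),
          Q.OutputsInTime ⟨numPoints n n, n, Database.arithmetic, φ⟩ β t ∧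
          QueryInput.IsBranchingFreeRep ⟨numPoints n n, n, Database.arithmetic, φ⟩ β ∧
          2 ^ n ≤ β.numScalars ∧ 2 ^ n ≤ t := by
  have hA := hc.definesFamily hγ hφ
  have hγ' := hγ
  rw [← hc.range_spec] at hγ'
  have hadm := QueryInput.DefinesFamily.admitsBranchingFree hA hc.cone hγ'
  refine ⟨hadm, fun Q 𝓘 hQ hI => ?_⟩
  obtain ⟨β, t, ht, hβ⟩ := hQ _ hI hadm
  obtain ⟨d, hd⟩ := hc.exists_linearIndependent_coeff
  have h1 := hβ.le_numScalars hA hc.cone hγ' (hd rfl)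
  exact ⟨β, t, ht, hβ, h1, h1.trans ht.numScalars_le⟩

end

section

open Circuit

/-! ### A normal form for computations -/

section Chain

variable {R T : Type} [CommSemiring R] [CommSemiring T] {n : ℕ}

/-- The linear combination of `1`, the inputs, and the first `j` intermediate results, with the
coefficients from the row `s` of `z`. -/
def chainForm (z : ℕ → ℕ → R) (x : Fin n → R) (g : ℕ → R) (s j : ℕ) : R :=
  z s 0 + (∑ i : Fin n, z s (i + 1) * x i) + ∑ i ∈ Finset.range j, z s (n + 1 + i) * g i

/-- The intermediate results: products of two linear combinations of preceding ones. -/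
def chainStep (z : ℕ → ℕ → R) (x : Fin n → R) (j : ℕ) : R :=
  (z (2 * j) 0 + (∑ i : Fin n, z (2 * j) (i + 1) * x i) +
    ∑ i : Fin j, z (2 * j) (n + 1 + i) * chainStep z x i) *
  (z (2 * j + 1) 0 + (∑ i : Fin n, z (2 * j + 1) (i + 1) * x i) +
    ∑ i : Fin j, z (2 * j + 1) (n + 1 + i) * chainStep z x i)
termination_by j

theorem chainStep_eq (z : ℕ → ℕ → R) (x : Fin n → R) (j : ℕ) :
    chainStep z x j = chainForm z x (chainStep z x) (2 * j) j *
      chainForm z x (chainStep z x) (2 * j + 1) j := by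
  rw [chainStep]
  simp only [chainForm, Finset.sum_range]

/-- The result of a computation with `L` products. -/
def chainResult (L : ℕ) (z : ℕ → ℕ → R) (x : Fin n → R) : R :=
  chainForm z x (chainStep z x) (2 * L) L

theorem map_chainForm (φ : R →+* T) (z : ℕ → ℕ → R) (x : Fin n → R) (g : ℕ → R) (s j : ℕ) :
    φ (chainForm z x g s j) =
      chainForm (fun s t => φ (z s t)) (fun i => φ (x i)) (fun i => φ (g i)) s j := by
  simp [chainForm]

theorem map_chainStep (φ : R →+* T) (z : ℕ → ℕ → R) (x : Fin n → R) (j : ℕ) :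
    φ (chainStep z x j) = chainStep (fun s t => φ (z s t)) (fun i => φ (x i)) j := by
  induction j using Nat.strong_induction_on with
  | _ j ih =>
    rw [chainStep_eq, chainStep_eq, map_mul, map_chainForm, map_chainForm]
    congr 1 <;>
    · simp only [chainForm]
      congr 1
      exact Finset.sum_congr rfl fun i hi => by rw [ih i (Finset.mem_range.mp hi)]

theorem map_chainResult (φ : R →+* T) (L : ℕ) (z : ℕ → ℕ → R) (x : Fin n → R) :
    φ (chainResult L z x) = chainResult L (fun s t => φ (z s t)) (fun i => φ (x i)) := by
  rw [chainResult, map_chainForm, chainResult]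
  simp only [map_chainStep]

theorem chainForm_congr {z z' : ℕ → ℕ → R} {g g' : ℕ → R} (x : Fin n → R) {s j : ℕ}
    (hz : ∀ t < n + 1 + j, z s t = z' s t) (hg : ∀ i < j, g i = g' i) :
    chainForm z x g s j = chainForm z' x g' s j := by
  simp only [chainForm]
  congr 1
  · rw [hz 0 (by omega)]
    congr 1
    exact Finset.sum_congr rfl fun i _ => by rw [hz _ (by omega)]
  · refine Finset.sum_congr rfl fun i hi => ?_
    have := Finset.mem_range.mp hi
    rw [hz _ (by omega), hg _ this]

/-- Row s belongs to the product number s / 2 and sees only as many earlier products. The entries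
beyond column n + 1 + s / 2 are never read, which later reduces the number of parameters. -/
theorem chainStep_congr {z z' : ℕ → ℕ → R} (x : Fin n → R) {j : ℕ}
    (hz : ∀ s < 2 * j + 2, ∀ t < n + 1 + s / 2, z s t = z' s t) :
    chainStep z x j = chainStep z' x j := by
  induction j using Nat.strong_induction_on with
  | _ j ih =>
    have h : ∀ i < j, chainStep z x i = chainStep z' x i := fun i hi =>
      ih i hi fun s hs => hz s (by omega)
    rw [chainStep_eq, chainStep_eq,
      chainForm_congr x (fun t ht => hz (2 * j) (by omega) t (by omega)) h,
      chainForm_congr x (fun t ht => hz (2 * j + 1) (by omega) t (by omega)) h]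

theorem chainResult_congr {z z' : ℕ → ℕ → R} (x : Fin n → R) {L : ℕ}
    (hz : ∀ s < 2 * L + 1, ∀ t < n + 1 + s / 2, z s t = z' s t) :
    chainResult L z x = chainResult L z' x :=
  chainForm_congr x (fun t ht => hz _ (by omega) t (by omega))
    fun _ hi => chainStep_congr x fun s hs => hz s (by omega)

end Chain

section

variable {n : ℕ}

theorem chainForm_mem_span (z : ℕ → ℕ → ℂ) (g : ℕ → MvPolynomial (Fin n) ℂ) (s j : ℕ) :
    chainForm (fun s t => C (z s t)) X g s j ∈
      Submodule.span ℂ (g '' Set.Iio j ∪ insert 1 (Set.range X)) := by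
  simp only [chainForm, ← smul_eq_C_mul]
  refine add_mem (add_mem ?_ (sum_mem fun i _ => ?_)) (sum_mem fun i hi => ?_)
  · rw [← mul_one (C _), ← smul_eq_C_mul]
    exact Submodule.smul_mem _ _ (Submodule.subset_span (Or.inr (Or.inl rfl)))
  · exact Submodule.smul_mem _ _ (Submodule.subset_span (Or.inr (Or.inr ⟨i, rfl⟩)))
  · exact Submodule.smul_mem _ _ (Submodule.subset_span (Or.inl ⟨i, Finset.mem_range.mp hi, rfl⟩))

/-- The row r is independent of z and of its position, so it can be written into any row of a
matrix. -/
theorem exists_chainForm_eq {g : ℕ → MvPolynomial (Fin n) ℂ} {j : ℕ} {f : MvPolynomial (Fin n) ℂ}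
    (hf : f ∈ Submodule.span ℂ (g '' Set.Iio j ∪ insert 1 (Set.range X))) :
    ∃ r : ℕ → ℂ, ∀ z : ℕ → ℕ → ℂ, ∀ s, z s = r → chainForm (fun s t => C (z s t)) X g s j = f := by
  induction hf using Submodule.span_induction with
  | mem f hf =>
    rcases hf with ⟨k, hk, rfl⟩ | rfl | ⟨i, rfl⟩
    · refine ⟨Pi.single (n + 1 + k) 1, ?_⟩
      rintro z s hz
      simp only [chainForm, hz]
      rw [Finset.sum_eq_zero, Finset.sum_eq_single k]
      · simp
      · intro b _ hb
        simp [hb]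
      · intro h; exact (h (Finset.mem_range.mpr hk)).elim
      · intro i _
        have := i.2
        rw [Pi.single_apply, if_neg (by omega)]; simp
    · refine ⟨Pi.single 0 1, ?_⟩
      rintro z s hz
      simp [chainForm, hz]
    · refine ⟨Pi.single (i + 1) 1, ?_⟩
      rintro z s hz
      simp only [chainForm, hz]
      rw [Finset.sum_eq_single i, Finset.sum_eq_zero]
      · simp
      · intro k hk
        have := i.2
        rw [Pi.single_apply, if_neg (by omega)]; simp
      · intro b _ hb
        have : (b : ℕ) ≠ i := fun h => hb (Fin.ext h)
        rw [Pi.single_apply, if_neg (by omega)]; simp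
      · simp
  | zero => exact ⟨0, fun z s hz => by simp [chainForm, hz]⟩
  | add f f' _ _ hf hf' =>
    obtain ⟨r, hr⟩ := hf
    obtain ⟨r', hr'⟩ := hf'
    refine ⟨r + r', fun z s hz => ?_⟩
    rw [← hr (fun _ => r) 0 rfl, ← hr' (fun _ => r') 0 rfl]
    simp only [chainForm, hz, Pi.add_apply, map_add, add_mul, Finset.sum_add_distrib]
    ring
  | smul a f _ hf =>
    obtain ⟨r, hr⟩ := hf
    refine ⟨a • r, fun z s hz => ?_⟩
    rw [← hr (fun _ => r) 0 rfl, smul_eq_C_mul]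
    simp only [chainForm, hz, Pi.smul_apply, smul_eq_mul, map_mul, mul_add, Finset.mul_sum,
      mul_assoc]

/-- Linear combinations are free, and each product of the chain costs one essential multiplication.
-/
theorem nonscalarSizeLE_chainResult (L : ℕ) (z : ℕ → ℕ → ℂ) :
    NonscalarSizeLE L (chainResult L (fun s t => C (z s t)) X : MvPolynomial (Fin n) ℂ) := by
  set g : ℕ → MvPolynomial (Fin n) ℂ := chainStep (fun s t => C (z s t)) X with hg
  have key : ∀ j, JointlyComputable j (g '' Set.Iio j) := by
    intro j
    induction j with
    | zero => exact JointlyComputable.empty.mono (by simp)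
    | succ j ih =>
      have h1 := ih.insert_span (chainForm_mem_span z g (2 * j) j)
      have h2 := h1.insert_span (Submodule.span_mono
        (Set.union_subset_union_left _ (Set.subset_insert _ _))
        (chainForm_mem_span z g (2 * j + 1) j))
      refine (h2.insert_mul (Set.mem_insert_of_mem _ (Set.mem_insert _ _))
        (Set.mem_insert _ _)).mono ?_
      rintro _ ⟨i, hi, rfl⟩
      rcases Nat.lt_succ_iff_lt_or_eq.mp hi with h | rfl
      · exact Or.inr (Or.inr (Or.inr ⟨i, h, rfl⟩))
      · left; rw [hg, chainStep_eq]
  exact ((key L).insert_span (chainForm_mem_span z g (2 * L) L)).nonscalarSizeLE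
    (Set.mem_insert _ _)

/-- The results of a well formed circuit are linear combinations of `1`, the inputs, and a chain of
products. -/
theorem exists_chain_of_wellFormed (c : Circuit (Fin n) ℂ) (hc : c.WellFormed) :
    ∃ z : ℕ → ℕ → ℂ, ∀ p < c.length, nodeVal c X C p ∈ Submodule.span ℂ
      (chainStep (fun s t => C (z s t)) X '' Set.Iio c.essential.ncard ∪
        insert 1 (Set.range (X : Fin n → MvPolynomial (Fin n) ℂ))) := by
  induction c using List.reverseRecOn with
  | nil => exact ⟨0, by simp⟩
  | append_singleton c g ih =>
    have hc' : WellFormed c := by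
      intro p g' hp
      exact hc p g' (by rw [nodeAt_append_left (lt_of_nodeAt hp)]; exact hp)
    obtain ⟨z, hz⟩ := ih hc'
    set N := (essential c).ncard with hN
    have hsub : essential c ⊆ essential (c ++ [g]) := fun p hp =>
      (mem_essential_concat hc' hc).mpr (Or.inl hp)
    by_cases hess : c.length ∈ essential (c ++ [g])
    · obtain ⟨a, b, hab, ha, hb⟩ := hess
      rw [nodeAt_concat] at hab
      obtain rfl := Option.some.inj hab
      have hlt := hc _ _ (nodeAt_concat _)
      have hcard : (essential (c ++ [Gate.mul a b])).ncard = N + 1 := by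
        rw [hN, ← Set.ncard_insert_of_notMem (a := c.length) _ (finite_essential c)]
        · congr 1
          ext p
          rw [mem_essential_concat hc' hc, Set.mem_insert_iff, or_comm]
          refine or_congr_left ⟨fun h => h.1, fun h => ⟨h, a, b, rfl, ?_, ?_⟩⟩
          · rwa [nodeVal_append hlt.1] at ha
          · rwa [nodeVal_append hlt.2] at hb
        · rintro ⟨a, b, h, -⟩
          exact absurd (lt_of_nodeAt h) (lt_irrefl _)
      obtain ⟨r, hr⟩ := exists_chainForm_eq (hz a hlt.1)
      obtain ⟨r', hr'⟩ := exists_chainForm_eq (hz b hlt.2)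
      -- The new essential product becomes number N of the chain, with its two factors in rows 2N
      -- and 2N + 1; earlier products only use rows below 2N.
      let z' : ℕ → ℕ → ℂ := Function.update (Function.update z (2 * N) r) (2 * N + 1) r'
      have hz' : ∀ s < 2 * N, z' s = z s := by
        intro s hs
        simp only [z']
        rw [Function.update_of_ne (by omega), Function.update_of_ne (by omega)]
      have hstep : ∀ i < N, chainStep (fun s t => C (z' s t)) X i =
          chainStep (fun s t => C (z s t)) (X : Fin n → MvPolynomial (Fin n) ℂ) i := by
        intro i hi
        exact chainStep_congr _ fun s hs t _ => by rw [hz' s (by omega)]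
      have hform : ∀ s, chainForm (fun s t => C (z' s t)) X (chainStep (fun s t => C (z' s t)) X) s N =
          chainForm (fun s t => C (z' s t)) X (chainStep (fun s t => C (z s t))
            (X : Fin n → MvPolynomial (Fin n) ℂ)) s N := fun s =>
        chainForm_congr _ (fun _ _ => rfl) hstep
      have hlast : chainStep (fun s t => C (z' s t)) (X : Fin n → MvPolynomial (Fin n) ℂ) N =
          nodeVal c X C a * nodeVal c X C b := by
        rw [chainStep_eq, hform, hform, hr z' (2 * N), hr' z' (2 * N + 1)]
        · simp [z']
        · simp only [z']
          rw [Function.update_of_ne (by omega), Function.update_self]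
      refine ⟨z', fun p hp => ?_⟩
      rw [hcard]
      rcases Nat.lt_or_ge p c.length with h | h
      · rw [nodeVal_append h]
        refine Submodule.span_mono (Set.union_subset_union_left _ ?_) (hz p h)
        rintro _ ⟨i, hi, rfl⟩
        exact ⟨i, Nat.lt_succ_of_lt hi, hstep i hi⟩
      · have hpe : p = c.length := by simp at hp; omega
        rw [hpe, nodeVal_concat_mul hlt.1 hlt.2, ← hlast]
        exact Submodule.subset_span (Or.inl ⟨N, Nat.lt_succ_self N, rfl⟩)
    · refine ⟨z, fun p hp => ?_⟩
      have hle : N ≤ (essential (c ++ [g])).ncard := Set.ncard_le_ncard hsub (finite_essential _)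
      have hmono := Submodule.span_mono (R := ℂ) (Set.union_subset_union_left
        (insert 1 (Set.range (X : Fin n → MvPolynomial (Fin n) ℂ)))
        (Set.image_mono (f := chainStep (fun s t => C (z s t)) X) (Set.Iio_subset_Iio hle)))
      refine hmono ?_
      rcases Nat.lt_or_ge p c.length with h | h
      · rw [nodeVal_append h]
        exact hz p h
      · have hpe : p = c.length := by simp at hp; omega
        subst hpe
        have hlt := hc _ _ (nodeAt_concat _)
        cases g with
        | input i =>
          rw [nodeVal_concat_input]
          exact Submodule.subset_span (Or.inr (Or.inr ⟨i, rfl⟩))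
        | scalar a =>
          rw [nodeVal_concat_scalar, ← mul_one (C a), ← smul_eq_C_mul]
          exact Submodule.smul_mem _ _ (Submodule.subset_span (Or.inr (Or.inl rfl)))
        | add a b =>
          rw [nodeVal_concat_add hlt.1 hlt.2]
          exact add_mem (hz a hlt.1) (hz b hlt.2)
        | sub a b =>
          rw [nodeVal_sub (nodeAt_concat _) hlt, nodeVal_append hlt.1, nodeVal_append hlt.2]
          exact sub_mem (hz a hlt.1) (hz b hlt.2)
        | mul a b =>
          rw [nodeVal_concat_mul hlt.1 hlt.2]
          -- A multiplication that is not essential has a constant factor, so its result is a scalar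
          -- multiple of an earlier one.
          by_cases ha : nodeVal c X C a ∈ Set.range (C : ℂ → MvPolynomial (Fin n) ℂ)
          · obtain ⟨t, ht⟩ := ha
            rw [← ht, ← smul_eq_C_mul]
            exact Submodule.smul_mem _ _ (hz b hlt.2)
          · by_cases hb : nodeVal c X C b ∈ Set.range (C : ℂ → MvPolynomial (Fin n) ℂ)
            · obtain ⟨t, ht⟩ := hb
              rw [← ht, mul_comm, ← smul_eq_C_mul]
              exact Submodule.smul_mem _ _ (hz a hlt.1)
            · exact (hess ((mem_essential_concat hc' hc).mpr
                (Or.inr ⟨rfl, a, b, rfl, ha, hb⟩))).elim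

theorem nonscalarSizeLE_iff_chainResult {L : ℕ} {f : MvPolynomial (Fin n) ℂ} :
    NonscalarSizeLE L f ↔ ∃ z : ℕ → ℕ → ℂ, chainResult L (fun s t => C (z s t)) X = f := by
  constructor
  · intro hf
    obtain ⟨c, hc, hL, hne, rfl⟩ := nonscalarSizeLE_iff.mp hf
    obtain ⟨z, hz⟩ := exists_chain_of_wellFormed c hc
    have hlen := List.length_pos_iff.mpr hne
    have h := Submodule.span_mono (R := ℂ) (Set.union_subset_union_left
      (insert 1 (Set.range (X : Fin n → MvPolynomial (Fin n) ℂ)))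
      (Set.image_mono (f := chainStep (fun s t => C (z s t)) X) (Set.Iio_subset_Iio hL)))
      (hz (c.length - 1) (by omega))
    obtain ⟨r, hr⟩ := exists_chainForm_eq h
    -- The row 2L is reserved for the output; the products numbered below L do not read it.
    refine ⟨Function.update z (2 * L) r, ?_⟩
    rw [← hr (Function.update z (2 * L) r) (2 * L) (Function.update_self _ _ _)]
    refine chainForm_congr _ (fun _ _ => rfl) fun i hi => ?_
    exact chainStep_congr _ fun s hs t _ => by rw [Function.update_of_ne (by omega)]
  · rintro ⟨z, rfl⟩
    exact nonscalarSizeLE_chainResult L z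

end

end

/-! ### Roots at iterated powers of two -/

section PseudoRemainder

variable {R T : Type} [CommRing R] [CommRing T]

/-- The coefficients of the pseudo-remainder of `X ^ a` modulo `∑ i ≤ e, h i X ^ i`. -/
def pseudoRem (h : ℕ → R) (e : ℕ) : ℕ → ℕ → R
  | 0, b => if b = 0 then 1 else 0
  | a + 1, b => h e * (if b = 0 then 0 else pseudoRem h e a (b - 1)) -
      h b * pseudoRem h e a (e - 1)

theorem map_pseudoRem (φ : R →+* T) (h : ℕ → R) (e a b : ℕ) :
    φ (pseudoRem h e a b) = pseudoRem (fun i => φ (h i)) e a b := by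
  induction a generalizing b with
  | zero => simp only [pseudoRem]; split_ifs <;> simp
  | succ a ih =>
    simp only [pseudoRem, map_sub, map_mul, ih]
    split_ifs <;> simp [ih]

/-- Multiply the relation for a by h_e · t; the only term of degree e that appears is removed by
replacing h_e · t^e with minus the lower terms. -/
theorem pseudoRem_spec {h : ℕ → R} {e : ℕ} (he : 0 < e) {t : R}
    (ht : ∑ i ∈ Finset.range (e + 1), h i * t ^ i = 0) (a : ℕ) :
    h e ^ a * t ^ a = ∑ b : Fin e, pseudoRem h e a b * t ^ (b : ℕ) := by
  obtain ⟨e, rfl⟩ : ∃ e', e = e' + 1 := ⟨e - 1, by omega⟩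
  rw [Fin.sum_univ_eq_sum_range (fun b => pseudoRem h (e + 1) a b * t ^ b)]
  induction a with
  | zero => simp [pseudoRem]
  | succ a ih =>
    have h1 : h (e + 1) ^ (a + 1) * t ^ (a + 1) =
        h (e + 1) * t * (h (e + 1) ^ a * t ^ a) := by ring
    rw [Finset.sum_range_succ] at ht ih
    have h2 : h (e + 1) * t ^ (e + 1) = - ∑ i ∈ Finset.range (e + 1), h i * t ^ i :=
      eq_neg_of_add_eq_zero_right ht
    have h3 : h (e + 1) * t * (pseudoRem h (e + 1) a e * t ^ e) =
      pseudoRem h (e + 1) a e * (h (e + 1) * t ^ (e + 1)) := by ring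
    rw [h1, ih, mul_add, h3, h2]
    simp only [pseudoRem, sub_mul, Finset.sum_sub_distrib, Nat.add_sub_cancel]
    rw [Finset.sum_range_succ' (fun i => h (e + 1) * (if i = 0 then 0 else
      pseudoRem h (e + 1) a (i - 1)) * t ^ i)]
    simp only [Nat.add_sub_cancel, Nat.add_eq_zero_iff, one_ne_zero, and_false, if_false, if_true,
      mul_zero, zero_mul, add_zero]
    rw [mul_neg, ← sub_eq_add_neg, Finset.mul_sum, Finset.mul_sum]
    congr 1
    · exact Finset.sum_congr rfl fun i _ => by ring
    · exact Finset.sum_congr rfl fun i _ => by ring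

theorem abs_pseudoRem_le {h : ℕ → ℤ} {H : ℤ} (hh : ∀ i, |h i| ≤ H) (e a b : ℕ) :
    |pseudoRem h e a b| ≤ (2 * H) ^ a := by
  have hH : 0 ≤ H := (abs_nonneg _).trans (hh 0)
  induction a generalizing b with
  | zero => simp only [pseudoRem]; split_ifs <;> simp
  | succ a ih =>
    have h0 : 0 ≤ (2 * H) ^ a := by positivity
    simp only [pseudoRem]
    refine (abs_sub _ _).trans ?_
    rw [abs_mul, abs_mul, pow_succ]
    have h1 : |h e| * |if b = 0 then 0 else pseudoRem h e a (b - 1)| ≤ H * (2 * H) ^ a := by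
      refine mul_le_mul (hh e) ?_ (abs_nonneg _) hH
      split_ifs
      · simpa using h0
      · exact ih _
    have h2 : |h b| * |pseudoRem h e a (e - 1)| ≤ H * (2 * H) ^ a :=
      mul_le_mul (hh b) (ih _) (abs_nonneg _) hH
    linarith

theorem totalDegree_pseudoRem_le {τ : Type} {h : ℕ → MvPolynomial τ ℤ} {δ : ℕ}
    (hh : ∀ i, (h i).totalDegree ≤ δ) (e a b : ℕ) :
    (pseudoRem h e a b).totalDegree ≤ a * δ := by
  induction a generalizing b with
  | zero => simp only [pseudoRem]; split_ifs <;> simp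
  | succ a ih =>
    simp only [pseudoRem]
    refine (totalDegree_sub _ _).trans (max_le ?_ ?_)
    · refine (totalDegree_mul _ _).trans ?_
      have := hh e
      split_ifs
      · simp only [totalDegree_zero]; nlinarith
      · have := ih (b - 1); nlinarith
    · refine (totalDegree_mul _ _).trans ?_
      have := hh b
      have := ih (e - 1)
      nlinarith

/-- The coefficients of a product of powers of roots, in terms of the reduced products. -/
def powerCoeff {m : ℕ} (h : ℕ → R) (e A : ℕ) (a : Fin m → Fin A) (b : Fin m → Fin e) : R :=
  h e ^ (m * A - ∑ k, (a k : ℕ)) * ∏ k, pseudoRem h e (a k) (b k)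

theorem sum_le_mul {m A : ℕ} (a : Fin m → Fin A) : ∑ k, (a k : ℕ) ≤ m * A := by
  calc ∑ k, (a k : ℕ) ≤ ∑ _k : Fin m, A := Finset.sum_le_sum fun k _ => (a k).2.le
    _ = m * A := by simp

theorem map_powerCoeff (φ : R →+* T) {m : ℕ} (h : ℕ → R) (e A : ℕ) (a : Fin m → Fin A)
    (b : Fin m → Fin e) :
    φ (powerCoeff h e A a b) = powerCoeff (fun i => φ (h i)) e A a b := by
  simp only [powerCoeff, map_mul, map_pow, map_prod, map_pseudoRem]

/-- The extra power of h_e in `powerCoeff` gives all exponents a the same factor on the left, so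
that sums over sets of exponents can be compared. -/
theorem powerCoeff_spec {m : ℕ} {h : ℕ → R} {e A : ℕ} (he : 0 < e) {t : Fin m → R}
    (ht : ∀ k, ∑ i ∈ Finset.range (e + 1), h i * t k ^ i = 0) (a : Fin m → Fin A) :
    h e ^ (m * A) * ∏ k, t k ^ (a k : ℕ) =
      ∑ b : Fin m → Fin e, powerCoeff h e A a b * ∏ k, t k ^ (b k : ℕ) := by
  have h1 : h e ^ (m * A) = h e ^ (m * A - ∑ k, (a k : ℕ)) * ∏ k, h e ^ (a k : ℕ) := by
    rw [Finset.prod_pow_eq_pow_sum, ← pow_add, Nat.sub_add_cancel (sum_le_mul a)]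
  rw [h1, mul_assoc, ← Finset.prod_mul_distrib]
  simp only [pseudoRem_spec he (ht _), powerCoeff, mul_assoc, ← Finset.mul_sum]
  rw [Finset.prod_univ_sum, Fintype.piFinset_univ]
  simp only [Finset.prod_mul_distrib]

theorem abs_powerCoeff_le {m : ℕ} {h : ℕ → ℤ} {H : ℤ} (hh : ∀ i, |h i| ≤ H) {e A : ℕ}
    (a : Fin m → Fin A) (b : Fin m → Fin e) :
    |powerCoeff h e A a b| ≤ (2 * H) ^ (m * A) := by
  have hH : 0 ≤ H := (abs_nonneg _).trans (hh 0)
  rw [powerCoeff, abs_mul, abs_pow, Finset.abs_prod]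
  calc |h e| ^ (m * A - ∑ k, (a k : ℕ)) * ∏ k, |pseudoRem h e (a k) (b k)|
      ≤ (2 * H) ^ (m * A - ∑ k, (a k : ℕ)) * ∏ k, (2 * H) ^ (a k : ℕ) := by
        refine mul_le_mul (pow_le_pow_left₀ (abs_nonneg _) ((hh e).trans (by linarith)) _)
          (Finset.prod_le_prod (fun _ _ => abs_nonneg _) fun k _ => abs_pseudoRem_le hh _ _ _)
          (Finset.prod_nonneg fun _ _ => abs_nonneg _) (by positivity)
    _ = (2 * H) ^ (m * A) := by
        rw [Finset.prod_pow_eq_pow_sum, ← pow_add, Nat.sub_add_cancel (sum_le_mul a)]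

theorem totalDegree_powerCoeff_le {τ : Type} {m : ℕ} {h : ℕ → MvPolynomial τ ℤ} {δ : ℕ}
    (hh : ∀ i, (h i).totalDegree ≤ δ) {e A : ℕ} (a : Fin m → Fin A) (b : Fin m → Fin e) :
    (powerCoeff h e A a b).totalDegree ≤ m * A * δ := by
  rw [powerCoeff]
  refine (totalDegree_mul _ _).trans ?_
  have h1 : (h e ^ (m * A - ∑ k, (a k : ℕ))).totalDegree ≤ (m * A - ∑ k, (a k : ℕ)) * δ :=
    (totalDegree_pow _ _).trans (Nat.mul_le_mul_left _ (hh e))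
  have h2 : (∏ k, pseudoRem h e (a k) (b k)).totalDegree ≤ (∑ k, (a k : ℕ)) * δ := by
    refine (totalDegree_finsetProd _ _).trans ?_
    rw [Finset.sum_mul]
    exact Finset.sum_le_sum fun k _ => totalDegree_pseudoRem_le hh _ _ _
  calc _ ≤ (m * A - ∑ k, (a k : ℕ)) * δ + (∑ k, (a k : ℕ)) * δ := Nat.add_le_add h1 h2
    _ = m * A * δ := by rw [← add_mul, Nat.sub_add_cancel (sum_le_mul a)]

end PseudoRemainder

/-- The product for a is 2 to the number with base-A digits a. Different a give different powers of
two, and binary expansions are unique. -/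
theorem eq_of_sum_two_pow_eq {m A : ℕ} {I J : Finset (Fin m → Fin A)}
    (h : ∑ a ∈ I, ∏ k : Fin m, ((2 : ℂ) ^ A ^ (k : ℕ)) ^ (a k : ℕ) =
      ∑ a ∈ J, ∏ k : Fin m, ((2 : ℂ) ^ A ^ (k : ℕ)) ^ (a k : ℕ)) : I = J := by
  classical
  have hinj : Function.Injective fun a : Fin m → Fin A => (finFunctionFinEquiv a : ℕ) :=
    Fin.val_injective.comp finFunctionFinEquiv.injective
  have h1 : ∀ a : Fin m → Fin A, ∏ k : Fin m, ((2 : ℂ) ^ A ^ (k : ℕ)) ^ (a k : ℕ) =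
      ((2 ^ (finFunctionFinEquiv a : ℕ) : ℕ) : ℂ) := by
    intro a
    rw [finFunctionFinEquiv_apply, ← Finset.prod_pow_eq_pow_sum]
    push_cast
    exact Finset.prod_congr rfl fun k _ => by rw [← pow_mul, mul_comm]
  simp only [h1, ← Nat.cast_sum, Nat.cast_inj] at h
  rw [← Finset.sum_image (f := fun i => 2 ^ i) (fun a _ b _ hab => hinj hab),
    ← Finset.sum_image (f := fun i => 2 ^ i) (fun a _ b _ hab => hinj hab)] at h
  exact Finset.image_injective hinj (Finset.geomSum_injective le_rfl h)

/-- A pigeonhole argument for the values of bounded polynomials on a grid. -/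
theorem exists_powerCoeff_relation {τ : Type} [Fintype τ] {m e A G H δ : ℕ}
    (p : ℕ → MvPolynomial τ ℤ) (hdeg : ∀ i, (p i).totalDegree ≤ δ)
    (hH : ∀ i (ζ : τ → ℕ), (∀ s, ζ s < G) → |eval (fun s => (ζ s : ℤ)) (p i)| ≤ H)
    (hG : m * A * δ < G)
    (hcount : (2 * (A ^ m * (2 * H) ^ (m * A)) + 1) ^ (G ^ Fintype.card τ * e ^ m) < 2 ^ A ^ m) :
    ∃ I J : Finset (Fin m → Fin A), I ≠ J ∧ ∀ b : Fin m → Fin e,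
      ∑ a ∈ I, powerCoeff p e A a b = ∑ a ∈ J, powerCoeff p e A a b := by
  classical
  set B := A ^ m * (2 * H) ^ (m * A) with hB
  let v : Finset (Fin m → Fin A) → (τ → Fin G) × (Fin m → Fin e) → ℤ := fun I w =>
    ∑ a ∈ I, powerCoeff (fun i => eval (fun s => ((w.1 s : ℕ) : ℤ)) (p i)) e A a w.2
  have hv : ∀ I w, |v I w| ≤ B := by
    intro I w
    refine (Finset.abs_sum_le_sum_abs _ _).trans ?_
    refine (Finset.sum_le_card_nsmul _ _ _ fun a _ => abs_powerCoeff_le (H := H)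
      (fun i => hH i (fun s => w.1 s) fun s => (w.1 s).2) a w.2).trans ?_
    rw [nsmul_eq_mul, hB]
    push_cast
    refine mul_le_mul_of_nonneg_right ?_ (by positivity)
    have := Finset.card_le_univ I
    simp only [Fintype.card_fun, Fintype.card_fin] at this
    exact_mod_cast this
  -- The values lie between -B and B; shifting by B counts them as 2B + 1 possibilities.
  let f : Finset (Fin m → Fin A) → ((τ → Fin G) × (Fin m → Fin e) → Fin (2 * B + 1)) := fun I w =>
    ⟨(v I w + B).toNat, by have := abs_le.mp (hv I w); omega⟩
  obtain ⟨I, J, hIJ, hf⟩ := Fintype.exists_ne_map_eq_of_card_lt f (by simpa using hcount)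
  refine ⟨I, J, hIJ, fun b => ?_⟩
  rw [← sub_eq_zero]
  -- The difference of the two sums vanishes on a grid of side G, which exceeds its degree.
  refine eq_zero_of_eval_zero_at_prod_finset _
    (fun _ => (Finset.range G).map ⟨_, Nat.cast_injective (R := ℤ)⟩) (fun s => ?_) fun x hx => ?_
  · rw [Finset.card_map, Finset.card_range]
    refine (degreeOf_le_totalDegree _ _).trans_lt (lt_of_le_of_lt ?_ hG)
    refine (totalDegree_sub _ _).trans (max_le ?_ ?_)
    · exact totalDegree_finsetSum_le fun a _ => totalDegree_powerCoeff_le hdeg a b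
    · exact totalDegree_finsetSum_le fun a _ => totalDegree_powerCoeff_le hdeg a b
  · have hx' : ∀ s, ∃ k : Fin G, x s = ((k : ℕ) : ℤ) := by
      intro s
      obtain ⟨k, hk, hkx⟩ := Finset.mem_map.mp (hx s)
      exact ⟨⟨k, Finset.mem_range.mp hk⟩, hkx.symm⟩
    choose ζ hζ using hx'
    obtain rfl : x = fun s => ((ζ s : ℕ) : ℤ) := funext hζ
    have h1 : v I (ζ, b) = v J (ζ, b) := by
      have h2 := congr_arg Fin.val (congr_fun hf (ζ, b))
      have h3 := abs_le.mp (hv I (ζ, b))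
      have h4 := abs_le.mp (hv J (ζ, b))
      simp only [f] at h2
      omega
    rw [map_sub, map_sum, map_sum, sub_eq_zero]
    simp only [map_powerCoeff]
    exact h1

/-- If y ≠ 0, reduction modulo y expresses all products of powers of the roots through e^m reduced
ones. There are more sets of exponents than possible coefficient vectors, so two sets have identical
reductions for p, hence for y, and their sums of powers of two agree. -/
theorem eq_zero_of_roots {τ : Type} [Fintype τ] {m M A G H δ : ℕ} (hm : 0 < m)
    (p : ℕ → MvPolynomial τ ℤ) (hdeg : ∀ i, (p i).totalDegree ≤ δ)
    (hH : ∀ i (ζ : τ → ℕ), (∀ s, ζ s < G) → |eval (fun s => (ζ s : ℤ)) (p i)| ≤ H)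
    (hG : m * A * δ < G)
    (hcount : (2 * (A ^ m * (2 * H) ^ (m * A)) + 1) ^ (G ^ Fintype.card τ * M ^ m) < 2 ^ A ^ m)
    {y : ℕ → ℂ} (hy : ∀ q : MvPolynomial ℕ ℤ, aeval p q = 0 → aeval y q = 0)
    (hM : ∀ i, M ≤ i → y i = 0)
    (hroot : ∀ k : Fin m, ∑ i ∈ Finset.range M, y i * ((2 : ℂ) ^ A ^ (k : ℕ)) ^ i = 0) : y = 0 := by
  classical
  by_contra hne
  obtain ⟨i₀, hi₀⟩ := Function.ne_iff.mp hne
  -- Leading coefficients may vanish in the limit y, so reduction is done modulo the actual degree e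
  -- of y; the counting hypothesis covers every e below M.
  obtain ⟨e, hye, hmax⟩ : ∃ e, y e ≠ 0 ∧ ∀ i, e < i → y i = 0 := by
    refine ⟨Nat.findGreatest (fun i => y i ≠ 0) M, Nat.findGreatest_spec (P := fun i => y i ≠ 0)
      (m := i₀) ?_ hi₀, fun i hi => ?_⟩
    · by_contra h
      exact hi₀ (hM _ (by omega))
    · by_contra h
      by_cases hiM : i ≤ M
      · exact Nat.findGreatest_is_greatest hi hiM h
      · exact h (hM _ (by omega))
  have heM : e < M := by
    by_contra h
    exact hye (hM _ (by omega))
  have hroot' : ∀ k : Fin m,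
      ∑ i ∈ Finset.range (e + 1), y i * ((2 : ℂ) ^ A ^ (k : ℕ)) ^ i = 0 := by
    intro k
    rw [← hroot k]
    refine Finset.sum_subset (Finset.range_subset_range.mpr heM) fun i _ hi => ?_
    rw [hmax i (by simpa using hi), zero_mul]
  -- A nonzero constant has no root, and there is at least one root because m > 0.
  have he : 0 < e := by
    rcases Nat.eq_zero_or_pos e with rfl | h
    · have := hroot' ⟨0, hm⟩
      simp at this
      exact (hye this).elim
    · exact h
  obtain ⟨I, J, hIJ, hrel⟩ := exists_powerCoeff_relation (e := e) p hdeg hH hG (by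
    refine lt_of_le_of_lt (Nat.pow_le_pow_right (by omega) ?_) hcount
    exact Nat.mul_le_mul_left _ (Nat.pow_le_pow_left heM.le _))
  have hrely : ∀ b : Fin m → Fin e,
      ∑ a ∈ I, powerCoeff y e A a b = ∑ a ∈ J, powerCoeff y e A a b := by
    intro b
    have h := hy (∑ a ∈ I, powerCoeff X e A a b - ∑ a ∈ J, powerCoeff X e A a b) (by
      rw [map_sub, map_sum, map_sum, sub_eq_zero, ← AlgHom.coe_toRingHom]
      simp only [map_powerCoeff]
      simpa using hrel b)
    rw [map_sub, map_sum, map_sum, sub_eq_zero, ← AlgHom.coe_toRingHom] at h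
    simp only [map_powerCoeff] at h
    simpa using h
  refine hIJ (eq_of_sum_two_pow_eq (mul_left_cancel₀ (pow_ne_zero (m * A) hye) ?_))
  rw [Finset.mul_sum, Finset.mul_sum]
  simp only [powerCoeff_spec he hroot']
  rw [Finset.sum_comm, Finset.sum_comm (s := J)]
  refine Finset.sum_congr rfl fun b _ => ?_
  rw [← Finset.sum_mul, hrely, Finset.sum_mul]

/-! ### Degrees and values of chains -/

section ChainBounds

/-- The degree function is abstract because it is used twice: for the total degree in the inputs and
for the largest degree of a coefficient in the parameters. -/
theorem chainForm_degree_le {R : Type} [CommSemiring R] {n : ℕ} (δ : R → ℕ) (h0 : δ 0 = 0)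
    (hadd : ∀ a b, δ (a + b) ≤ max (δ a) (δ b)) (hmul : ∀ a b, δ (a * b) ≤ δ a + δ b)
    {z : ℕ → ℕ → R} {x : Fin n → R} (hz : ∀ s t, δ (z s t) ≤ 1) (hx : ∀ i, δ (x i) ≤ 1)
    {g : ℕ → R} {s j e : ℕ} (he : 1 ≤ e) (hg : ∀ i < j, δ (g i) ≤ e) :
    δ (chainForm z x g s j) ≤ e + 1 := by
  have hsum : ∀ {ι : Type} (s : Finset ι) (f : ι → R) (d : ℕ), (∀ i ∈ s, δ (f i) ≤ d) →
      δ (∑ i ∈ s, f i) ≤ d := by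
    intro ι s f d hf
    exact Finset.sum_induction f (fun a => δ a ≤ d)
      (fun a b ha hb => (hadd a b).trans (max_le ha hb)) (by rw [h0]; exact Nat.zero_le _) hf
  refine (hadd _ _).trans (max_le ((hadd _ _).trans (max_le ?_ ?_)) ?_)
  · exact (hz _ _).trans (by omega)
  · refine hsum _ _ _ fun i _ => (hmul _ _).trans ?_
    have := hz s (i + 1)
    have := hx i
    omega
  · refine hsum _ _ _ fun i hi => (hmul _ _).trans ?_
    have := hz s (n + 1 + i)
    have := hg i (Finset.mem_range.mp hi)
    omega

theorem chainResult_degree_lt {R : Type} [CommSemiring R] {n : ℕ} (δ : R → ℕ) (h0 : δ 0 = 0)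
    (hadd : ∀ a b, δ (a + b) ≤ max (δ a) (δ b)) (hmul : ∀ a b, δ (a * b) ≤ δ a + δ b)
    {z : ℕ → ℕ → R} {x : Fin n → R} (hz : ∀ s t, δ (z s t) ≤ 1) (hx : ∀ i, δ (x i) ≤ 1) (L : ℕ) :
    δ (chainResult L z x) < 2 ^ (L + 2) := by
  -- If the earlier products have degree at most 3·2^j - 2, both factors have degree at most 3·2^j -
  -- 1, and the next product has degree at most 3·2^(j+1) - 2.
  have hstep : ∀ j, ∀ i < j, δ (chainStep z x i) + 2 ≤ 3 * 2 ^ j := by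
    intro j
    induction j with
    | zero => intro i hi; omega
    | succ j ih =>
      intro i hi
      have hpos := Nat.one_le_two_pow (n := j)
      have hp : 2 ^ (j + 1) = 2 * 2 ^ j := by ring
      rcases Nat.lt_succ_iff_lt_or_eq.mp hi with h | rfl
      · have := ih i h; omega
      · have hform : ∀ s, δ (chainForm z x (chainStep z x) s i) ≤ (3 * 2 ^ i - 2) + 1 := fun s =>
          chainForm_degree_le δ h0 hadd hmul hz hx (by omega) fun k hk => by
            have := ih k hk; omega
        have h1 := hform (2 * i)
        have h2 := hform (2 * i + 1)
        have h3 := hmul (chainForm z x (chainStep z x) (2 * i) i)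
          (chainForm z x (chainStep z x) (2 * i + 1) i)
        rw [← chainStep_eq] at h3
        omega
  have hpos := Nat.one_le_two_pow (n := L)
  have hp : 2 ^ (L + 2) = 4 * 2 ^ L := by ring
  have : δ (chainResult L z x) ≤ (3 * 2 ^ L - 2) + 1 :=
    chainForm_degree_le δ h0 hadd hmul hz hx (by omega) fun k hk => by
      have := hstep L k hk; omega
  omega

/-- There are at most 2n + 1 terms, each at most G times the bound for the earlier products, and U
absorbs (2n + 1)·G. -/
theorem chainForm_le {n G U E s j : ℕ} {z : ℕ → ℕ → ℕ} {g : ℕ → ℕ} (hG : 1 ≤ G)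
    (hU : (2 * n + 1) * G ≤ U) (hj : j ≤ n) (hz : ∀ s t, z s t ≤ G) (hg : ∀ i < j, g i ≤ U ^ E) :
    chainForm z (fun _ : Fin n => 1) g s j ≤ U ^ (E + 1) := by
  have hU1 : 1 ≤ U := le_trans (by nlinarith) hU
  have hUE : 1 ≤ U ^ E := Nat.one_le_pow _ _ hU1
  have h1 : ∑ i : Fin n, z s (i + 1) * 1 ≤ n * (G * U ^ E) := by
    refine (Finset.sum_le_card_nsmul _ _ (G * U ^ E) fun i _ => ?_).trans (by simp)
    rw [mul_one]
    have := hz s (i + 1)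
    nlinarith
  have h2 : ∑ i ∈ Finset.range j, z s (n + 1 + i) * g i ≤ n * (G * U ^ E) := by
    refine (Finset.sum_le_card_nsmul _ _ (G * U ^ E) fun i hi => ?_).trans ?_
    · exact Nat.mul_le_mul (hz _ _) (hg i (Finset.mem_range.mp hi))
    · rw [Finset.card_range, smul_eq_mul]
      exact Nat.mul_le_mul_right _ hj
  have h3 : z s 0 ≤ G * U ^ E := by
    have := hz s 0
    nlinarith
  calc chainForm z (fun _ : Fin n => 1) g s j
      ≤ G * U ^ E + n * (G * U ^ E) + n * (G * U ^ E) := Nat.add_le_add (Nat.add_le_add h3 h1) h2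
    _ = ((2 * n + 1) * G) * U ^ E := by ring
    _ ≤ U * U ^ E := Nat.mul_le_mul_right _ hU
    _ = U ^ (E + 1) := by ring

theorem chainResult_le {n G U : ℕ} {z : ℕ → ℕ → ℕ} (hG : 1 ≤ G) (hU : (2 * n + 1) * G ≤ U)
    (hz : ∀ s t, z s t ≤ G) : chainResult n z (fun _ : Fin n => 1) ≤ U ^ 2 ^ (n + 1) := by
  have hU1 : 1 ≤ U := le_trans (by nlinarith) hU
  -- The exponents follow E ↦ 2(E + 1), starting from 0.
  have hstep : ∀ j ≤ n, ∀ i < j, chainStep z (fun _ : Fin n => 1) i ≤ U ^ (2 ^ (j + 1) - 2) := by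
    intro j
    induction j with
    | zero => intro _ i hi; omega
    | succ j ih =>
      intro hj i hi
      have hpos := Nat.one_le_two_pow (n := j)
      have hp : 2 ^ (j + 1) = 2 * 2 ^ j := by ring
      have hp' : 2 ^ (j + 2) = 4 * 2 ^ j := by ring
      rcases Nat.lt_succ_iff_lt_or_eq.mp hi with h | rfl
      · exact (ih (by omega) i h).trans (Nat.pow_le_pow_right hU1 (by omega))
      · rw [chainStep_eq]
        refine (Nat.mul_le_mul (chainForm_le hG hU (by omega) hz (ih (by omega)))
          (chainForm_le hG hU (by omega) hz (ih (by omega)))).trans ?_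
        rw [← pow_add]
        exact Nat.pow_le_pow_right hU1 (by omega)
  have hpos := Nat.one_le_two_pow (n := n)
  have hp : 2 ^ (n + 1) = 2 * 2 ^ n := by ring
  exact (chainForm_le hG hU le_rfl hz (hstep n le_rfl)).trans
    (Nat.pow_le_pow_right hU1 (by omega))

end ChainBounds

/-! ### A parametrisation of the polynomials of low complexity -/

/-- Index set of the parameters. -/
abbrev ChainParam (n : ℕ) : Type := (Fin (2 * n + 1) × Fin (n + 1)) ⊕ (Fin (2 * n - 1) × Fin n)

/-- The matrix of the coefficients of a chain. -/
def chainMatrix {R : Type} [Zero R] {n : ℕ} (w : ChainParam n → R) (s t : ℕ) : R :=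
  if h : s < 2 * n + 1 ∧ t < n + 1 then w (Sum.inl (⟨s, h.1⟩, ⟨t, h.2⟩))
  else if h : s - 2 < 2 * n - 1 ∧ t - (n + 1) < n then
    w (Sum.inr (⟨s - 2, h.1⟩, ⟨t - (n + 1), h.2⟩)) else 0

section ChainMember

variable {R T : Type} [CommSemiring R] [CommSemiring T] {n : ℕ}

/-- The polynomial of low complexity with the given parameters. -/
def chainMember (w : ChainParam n → R) : MvPolynomial (Fin n) R :=
  chainResult n (fun s t => C (chainMatrix w s t)) X

theorem map_chainMatrix (φ : R →+* T) (w : ChainParam n → R) (s t : ℕ) :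
    φ (chainMatrix w s t) = chainMatrix (fun i => φ (w i)) s t := by
  simp only [chainMatrix]
  split_ifs <;> simp

theorem chainMatrix_prop {P : R → Prop} (h0 : P 0) {w : ChainParam n → R} (hw : ∀ i, P (w i))
    (s t : ℕ) : P (chainMatrix w s t) := by
  simp only [chainMatrix]
  split_ifs
  · exact hw _
  · exact hw _
  · exact h0

theorem map_chainMember (φ : R →+* T) (w : ChainParam n → R) :
    map φ (chainMember w) = chainMember (fun i => φ (w i)) := by
  rw [chainMember, map_chainResult, chainMember]
  simp only [map_C, map_X, map_chainMatrix]

theorem eval_one_chainMember (w : ChainParam n → R) :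
    eval (fun _ => 1) (chainMember w) = chainResult n (chainMatrix w) fun _ : Fin n => 1 := by
  rw [chainMember, map_chainResult]
  simp only [eval_C, eval_X]

theorem totalDegree_chainMember_lt (w : ChainParam n → R) :
    (chainMember w).totalDegree < 2 ^ (n + 2) := by
  refine chainResult_degree_lt totalDegree totalDegree_zero totalDegree_add totalDegree_mul
    (fun _ _ => by simp) (fun i => ?_) n
  rw [X]
  exact (totalDegree_monomial_le _ _).trans (by simp)

end ChainMember

theorem lowComplexity_eq_range_chainMember (n : ℕ) :
    lowComplexity n n = Set.range (chainMember : (ChainParam n → ℂ) → _) := by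
  ext f
  constructor
  · intro hf
    obtain ⟨z, rfl⟩ := nonscalarSizeLE_iff_chainResult.mp hf
    refine ⟨Sum.elim (fun i => z i.1 i.2) fun i => z (i.1 + 2) (i.2 + (n + 1)),
      chainResult_congr _ fun s hs t ht => ?_⟩
    congr 1
    -- For rows 0 and 1 the truncated difference s - 2 selects meaningless entries, but these rows
    -- have no earlier products and only the first n + 1 columns are compared.
    simp only [chainMatrix]
    split_ifs with h1 h2
    · rfl
    · simp only [Sum.elim_inr]
      congr 1 <;> omega
    · omega
  · rintro ⟨w, rfl⟩
    exact nonscalarSizeLE_chainResult n _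

theorem totalDegree_coeff_chainMember_lt {n : ℕ} (d : Fin n →₀ ℕ) :
    (coeff d (chainMember (X : ChainParam n → MvPolynomial (ChainParam n) ℤ))).totalDegree <
      2 ^ (n + 2) := by
  classical
  let δ : MvPolynomial (Fin n) (MvPolynomial (ChainParam n) ℤ) → ℕ := fun F =>
    F.support.sup fun d => (coeff d F).totalDegree
  have hδ : ∀ F d, (coeff d F).totalDegree ≤ δ F := by
    intro F d
    by_cases hd : d ∈ F.support
    · exact Finset.le_sup (f := fun d => (coeff d F).totalDegree) hd
    · rw [notMem_support_iff.mp hd]; simp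
  refine (hδ _ d).trans_lt (chainResult_degree_lt δ ?_ ?_ ?_ (fun s t => ?_) (fun i => ?_) n)
  · simp [δ]
  · intro a b
    refine Finset.sup_le fun d _ => ?_
    rw [coeff_add]
    exact (totalDegree_add _ _).trans (max_le_max (hδ _ _) (hδ _ _))
  · intro a b
    refine Finset.sup_le fun d _ => ?_
    rw [coeff_mul]
    exact totalDegree_finsetSum_le fun x _ =>
      (totalDegree_mul _ _).trans (Nat.add_le_add (hδ _ _) (hδ _ _))
  · refine Finset.sup_le fun d _ => ?_
    rw [coeff_C]
    split_ifs
    · exact chainMatrix_prop (P := fun p : MvPolynomial (ChainParam n) ℤ => p.totalDegree ≤ 1)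
        (by simp) (fun i => by simp) s t
    · simp
  · refine Finset.sup_le fun d _ => ?_
    rw [coeff_X]
    split_ifs <;> simp

/-- For natural parameters all coefficients are natural numbers, so each is at most their sum, the
value at (1, …, 1). -/
theorem coeff_chainMember_bounds {n G U : ℕ} (hG : 1 ≤ G) (hU : (2 * n + 1) * G ≤ U)
    (d : Fin n →₀ ℕ) {ζ : ChainParam n → ℕ} (hζ : ∀ i, ζ i ≤ G) :
    0 ≤ eval (fun i => (ζ i : ℤ)) (coeff d (chainMember X)) ∧
      eval (fun i => (ζ i : ℤ)) (coeff d (chainMember X)) ≤ ((U ^ 2 ^ (n + 1) : ℕ) : ℤ) := by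
  classical
  have h1 : eval (fun i => (ζ i : ℤ)) (coeff d (chainMember X)) =
      ((coeff d (chainMember ζ) : ℕ) : ℤ) := by
    rw [← coeff_map, map_chainMember]
    simp only [eval_X]
    have := map_chainMember (Nat.castRingHom ℤ) ζ
    simp only [Nat.coe_castRingHom] at this
    rw [← this, coeff_map]; rfl
  rw [h1]
  refine ⟨Int.natCast_nonneg _, Int.ofNat_le.mpr ?_⟩
  refine le_trans ?_ (chainResult_le hG hU
    (fun s t => chainMatrix_prop (P := fun k => k ≤ G) (Nat.zero_le _) hζ s t))
  rw [← eval_one_chainMember, eval_eq]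
  by_cases hd : d ∈ (chainMember ζ).support
  · have := Finset.single_le_sum (f := fun d => coeff d (chainMember ζ) *
      ∏ i ∈ d.support, (1 : ℕ) ^ d i) (fun _ _ => Nat.zero_le _) hd
    simpa using this
  · rw [notMem_support_iff.mp hd]; exact Nat.zero_le _

/-! ### Identification sequences of iterated powers of two -/

section Kronecker

variable {n N : ℕ}

/-- The exponent vector of the digits to base `N`. -/
def digitExponent (i : Fin (N ^ n)) : Fin n →₀ ℕ :=
  Finsupp.equivFunOnFinite.symm fun j => (finFunctionFinEquiv.symm i j : ℕ)

theorem sum_digitExponent (i : Fin (N ^ n)) :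
    ∑ j : Fin n, digitExponent i j * N ^ (j : ℕ) = i := by
  conv_rhs => rw [← finFunctionFinEquiv.apply_symm_apply i, finFunctionFinEquiv_apply]
  rfl

theorem digitExponent_injective : Function.Injective (digitExponent : Fin (N ^ n) → _) := by
  intro i i' h
  apply finFunctionFinEquiv.symm.injective
  ext j
  exact DFunLike.congr_fun h j

theorem exists_digitExponent_eq {d : Fin n →₀ ℕ} (hd : ∀ j, d j < N) :
    ∃ i : Fin (N ^ n), digitExponent i = d := by
  refine ⟨finFunctionFinEquiv fun j => ⟨d j, hd j⟩, ?_⟩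
  ext j
  simp [digitExponent]

/-- The Kronecker substitution. -/
theorem eval_pow_eq_sum {f : MvPolynomial (Fin n) ℂ} (hf : ∀ d, (∃ j, N ≤ d j) → coeff d f = 0)
    (t : ℂ) : eval (fun j : Fin n => t ^ N ^ (j : ℕ)) f =
      ∑ i : Fin (N ^ n), coeff (digitExponent i) f * t ^ (i : ℕ) := by
  classical
  have hprod : ∀ d : Fin n →₀ ℕ, ∏ j : Fin n, (t ^ N ^ (j : ℕ)) ^ d j =
      t ^ ∑ j : Fin n, d j * N ^ (j : ℕ) := by
    intro d
    rw [← Finset.prod_pow_eq_pow_sum]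
    exact Finset.prod_congr rfl fun j _ => by rw [← pow_mul, mul_comm]
  have hsub : f.support ⊆ Finset.univ.image (digitExponent (n := n) (N := N)) := by
    intro d hd
    obtain ⟨i, hi⟩ := exists_digitExponent_eq (N := N) (d := d) fun j => by
      by_contra h
      exact (mem_support_iff.mp hd) (hf d ⟨j, not_lt.mp h⟩)
    exact Finset.mem_image.mpr ⟨i, Finset.mem_univ _, hi⟩
  rw [eval_eq']
  simp only [hprod]
  rw [Finset.sum_subset hsub fun d _ hd => by rw [notMem_support_iff.mp hd, zero_mul],
    Finset.sum_image fun a _ b _ h => digitExponent_injective h]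
  simp only [sum_digitExponent]

end Kronecker

/-- The points `(t, t ^ N, t ^ N ^ 2, …)` for iterated powers `t` of two. -/
def powerPoint (m n N A : ℕ) (k : Fin m) (j : Fin n) : ℚ := (2 ^ A ^ (k : ℕ)) ^ N ^ (j : ℕ)

theorem ratPoint_powerPoint {m n N A : ℕ} (k : Fin m) :
    ratPoint (powerPoint m n N A k) = fun j : Fin n => ((2 : ℂ) ^ A ^ (k : ℕ)) ^ N ^ (j : ℕ) := by
  funext j
  simp [ratPoint, powerPoint]

/-- A polynomial relation between differences of coefficients extends to the closure. -/
theorem aeval_sub_eq_zero_of_mem_polyClosure {n : ℕ} {W : Set (MvPolynomial (Fin n) ℂ)}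
    (d : ℕ → Fin n →₀ ℕ) (a : ℕ → ℂ) {q : MvPolynomial ℕ ℤ}
    (h : ∀ f ∈ W, ∀ g ∈ W, aeval (fun i => a i * (coeff (d i) f - coeff (d i) g)) q = 0)
    {f g : MvPolynomial (Fin n) ℂ} (hf : f ∈ polyClosure W) (hg : g ∈ polyClosure W) :
    aeval (fun i => a i * (coeff (d i) f - coeff (d i) g)) q = 0 := by
  let Q : (ℕ → MvPolynomial (Fin n →₀ ℕ) ℂ) → MvPolynomial (Fin n →₀ ℕ) ℂ := fun v => aeval v q
  have hQ : ∀ (v : ℕ → MvPolynomial (Fin n →₀ ℕ) ℂ) (w : (Fin n →₀ ℕ) → ℂ),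
      eval w (Q v) = aeval (fun i => eval w (v i)) q := by
    intro v w
    exact (map_aeval v (eval w) q).trans (congr_arg
      (fun φ : ℤ →+* ℂ => eval₂ φ (fun i => eval w (v i)) q) (RingHom.ext_int _ _))
  -- The two arguments pass to the closure one after the other: first f with g fixed in W, then g
  -- with f fixed in the closure.
  have h1 : ∀ g ∈ W, aeval (fun i => a i * (coeff (d i) f - coeff (d i) g)) q = 0 := by
    intro g hg
    have := mem_zariskiClosure.mp hf (Q fun i => C (a i) * (X (d i) - C (coeff (d i) g))) (by
      rintro _ ⟨f, hf, rfl⟩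
      rw [hQ]
      simpa [coeffVector] using h f hf g hg)
    rw [hQ] at this
    simpa [coeffVector] using this
  have := mem_zariskiClosure.mp hg (Q fun i => C (a i) * (C (coeff (d i) f) - X (d i))) (by
    rintro _ ⟨g, hg, rfl⟩
    rw [hQ]
    simpa [coeffVector] using h1 g hg)
  rw [hQ] at this
  simpa [coeffVector] using this

theorem coeff_eq_zero_of_mem_polyClosure {n : ℕ} {W : Set (MvPolynomial (Fin n) ℂ)}
    {d : Fin n →₀ ℕ} (h : ∀ f ∈ W, coeff d f = 0) {f : MvPolynomial (Fin n) ℂ}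
    (hf : f ∈ polyClosure W) : coeff d f = 0 := by
  have := mem_zariskiClosure.mp hf (X d) (by rintro _ ⟨f, hf, rfl⟩; simpa [coeffVector] using h f hf)
  simpa [coeffVector] using this

/-- All exponents are below N, so Kronecker substitution turns f - g into a univariate polynomial
with the same coefficients, which vanishes at m iterated powers of two. Its coefficients satisfy
every integral relation between the differences of two generic members, so `eq_zero_of_roots`
applies. -/
theorem isIdentificationSeq_powerPoint {m n A G U : ℕ} (hm : 0 < m)
    (hU : (2 * n + 1) * G ≤ U) (hG : m * A * 2 ^ (n + 2) < G)
    (hcount : (2 * (A ^ m * (2 * U ^ 2 ^ (n + 1)) ^ (m * A)) + 1) ^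
      (G ^ (2 * (4 * n ^ 2 + 2 * n + 1)) * ((2 ^ (n + 2)) ^ n) ^ m) < 2 ^ A ^ m) :
    IsIdentificationSeq (polyClosure (lowComplexity n n)) (powerPoint m n (2 ^ (n + 2)) A) := by
  classical
  intro f hf g hg hfg
  set N := 2 ^ (n + 2) with hN
  have hdeg : ∀ f ∈ polyClosure (lowComplexity n n), ∀ d, (∃ j, N ≤ d j) → coeff d f = 0 := by
    rintro f hf d ⟨j, hj⟩
    refine coeff_eq_zero_of_mem_polyClosure (fun f hf => ?_) hf
    rw [lowComplexity_eq_range_chainMember] at hf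
    obtain ⟨w, rfl⟩ := hf
    refine coeff_eq_zero_of_totalDegree_lt ((totalDegree_chainMember_lt w).trans_le
      (hj.trans ?_))
    by_cases h : j ∈ d.support
    · exact Finset.single_le_sum (f := fun i => d i) (fun _ _ => Nat.zero_le _) h
    · rw [Finsupp.notMem_support_iff.mp h]; exact Nat.zero_le _
  have hNpos : 0 < N ^ n := by positivity
  -- The exponents are indexed by all natural numbers; the factor a below removes the indices from
  -- N^n on.
  let d : ℕ → Fin n →₀ ℕ := fun i =>
    digitExponent (N := N) ⟨i % N ^ n, Nat.mod_lt _ hNpos⟩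
  have hdi : ∀ i : Fin (N ^ n), d i = digitExponent i := by
    intro i
    simp only [d]
    congr 1
    exact Fin.ext (Nat.mod_eq_of_lt i.2)
  let a : ℕ → ℤ := fun i => if i < N ^ n then 1 else 0
  let c : (Fin n →₀ ℕ) → MvPolynomial (ChainParam n) ℤ := fun d => coeff d (chainMember X)
  let p : ℕ → MvPolynomial (ChainParam n ⊕ ChainParam n) ℤ := fun i =>
    C (a i) * (rename Sum.inl (c (d i)) - rename Sum.inr (c (d i)))
  let y : ℕ → ℂ := fun i => a i * (coeff (d i) f - coeff (d i) g)
  -- The parameters of the two members together. Counting all (2n + 1)² matrix entries per member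
  -- would be too wasteful for the final inequality when n = 1.
  have hcard : Fintype.card (ChainParam n ⊕ ChainParam n) ≤ 2 * (4 * n ^ 2 + 2 * n + 1) := by
    simp only [Fintype.card_sum, Fintype.card_prod, Fintype.card_fin]
    rcases Nat.eq_zero_or_pos n with rfl | hn
    · simp
    · obtain ⟨k, rfl⟩ : ∃ k, n = k + 1 := ⟨n - 1, by omega⟩
      have : 2 * (k + 1) - 1 = 2 * k + 1 := by omega
      rw [this]
      nlinarith
  have hy0 : y = 0 := by
    refine eq_zero_of_roots hm p (δ := 2 ^ (n + 2)) (M := N ^ n) (H := U ^ 2 ^ (n + 1)) ?_ ?_ hG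
      ?_ ?_ ?_ ?_
    · intro i
      refine (totalDegree_mul _ _).trans ?_
      rw [totalDegree_C, zero_add]
      refine (totalDegree_sub _ _).trans (max_le ?_ ?_) <;>
      · refine (totalDegree_rename_le _ _).trans (totalDegree_coeff_chainMember_lt _).le
    · intro i ζ hζ
      simp only [p, map_mul, eval_C, map_sub, eval_rename]
      have h1 := coeff_chainMember_bounds (G := G) (by omega) hU (d i)
        (ζ := fun s => ζ (Sum.inl s)) (fun s => (hζ _).le)
      have h2 := coeff_chainMember_bounds (G := G) (by omega) hU (d i)
        (ζ := fun s => ζ (Sum.inr s)) (fun s => (hζ _).le)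
      rw [abs_mul]
      have h3 : |a i| ≤ 1 := by simp only [a]; split_ifs <;> simp
      refine (mul_le_mul h3 (abs_le.mpr ?_) (abs_nonneg _) zero_le_one).trans (one_mul _).le
      change _ ≤ eval (fun s => (ζ (Sum.inl s) : ℤ)) _ - eval (fun s => (ζ (Sum.inr s) : ℤ)) _ ∧
        eval (fun s => (ζ (Sum.inl s) : ℤ)) _ - eval (fun s => (ζ (Sum.inr s) : ℤ)) _ ≤ _
      constructor <;> simp only [c] <;> linarith [h1.1, h1.2, h2.1, h2.2]
    · refine lt_of_le_of_lt (Nat.pow_le_pow_right (by omega) ?_) hcount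
      exact Nat.mul_le_mul_right _ (Nat.pow_le_pow_right (by omega) hcard)
    · intro q hq
      refine aeval_sub_eq_zero_of_mem_polyClosure d (fun i => (a i : ℂ)) ?_ hf hg
      rw [lowComplexity_eq_range_chainMember]
      rintro _ ⟨w, rfl⟩ _ ⟨w', rfl⟩
      have h := congr_arg (eval₂Hom (Int.castRingHom ℂ) (Sum.elim w w')) hq
      rw [map_zero, map_aeval] at h
      rw [← h, aeval_def]
      congr 1
      · exact RingHom.ext_int _ _
      · funext i
        have hw : ∀ w : ChainParam n → ℂ, eval₂ (Int.castRingHom ℂ) w (c (d i)) =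
            coeff (d i) (chainMember w) := by
          intro w
          have := map_chainMember (eval₂Hom (Int.castRingHom ℂ) w) X
          simp only [coe_eval₂Hom, eval₂_X] at this
          rw [← this, coeff_map]; rfl
        simp only [p, map_mul, map_sub, coe_eval₂Hom, eval₂_C, eval₂_rename, Sum.elim_comp_inl,
          Sum.elim_comp_inr, hw]
        rfl
    · intro i hi
      simp only [y, a, if_neg (not_lt.mpr hi)]
      simp
    · intro k
      have h1 := hfg k
      rw [ratPoint_powerPoint, eval_pow_eq_sum (hdeg f hf), eval_pow_eq_sum (hdeg g hg),
        ← sub_eq_zero, ← Finset.sum_sub_distrib] at h1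
      rw [Finset.sum_range, ← h1]
      refine Finset.sum_congr rfl fun i _ => ?_
      simp only [y, hdi, a, if_pos i.2]
      push_cast
      ring
  ext e
  by_cases he : ∃ j, N ≤ e j
  · rw [hdeg f hf e he, hdeg g hg e he]
  · push Not at he
    obtain ⟨i, rfl⟩ := exists_digitExponent_eq he
    have := congr_fun hy0 i
    simp only [y, hdi, a, if_pos i.2, Pi.zero_apply, Int.cast_one, one_mul] at this
    exact sub_eq_zero.mp this

/-- The exponent of the growth of the identification sequence. -/
def growthExponent (n : ℕ) : ℕ := 95 * n ^ 2

theorem numPoints_le {n : ℕ} (hn : 1 ≤ n) : numPoints n n ≤ 2 ^ (5 * n) := by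
  have hm' : numPoints n n = 16 * n ^ 2 + 2 := by rw [numPoints]; ring
  rw [hm', pow_mul]
  induction n, hn using Nat.le_induction with
  | base => norm_num
  | succ k hk ih =>
    have h := ih (by rw [numPoints]; ring)
    have h2 : (2 ^ 5 : ℕ) ^ (k + 1) = 32 * (2 ^ 5) ^ k := by ring
    rw [h2]
    nlinarith

/-- All quantities are bounded by powers of two and only the exponents of the exponents are
compared. The exponent α occurs about 8n² times on the left, from the grid, and 16n² + 2 times on
the right, from the points. -/
theorem count_lt {n : ℕ} (hn : 1 ≤ n) :
    (2 * ((2 ^ growthExponent n) ^ numPoints n n *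
      (2 * (2 ^ (growthExponent n + 8 * n + 3)) ^ 2 ^ (n + 1)) ^
        (numPoints n n * 2 ^ growthExponent n)) + 1) ^
      ((2 ^ (growthExponent n + 6 * n + 3)) ^ (2 * (4 * n ^ 2 + 2 * n + 1)) *
        ((2 ^ (n + 2)) ^ n) ^ numPoints n n) < 2 ^ (2 ^ growthExponent n) ^ numPoints n n := by
  set α := growthExponent n with hα
  set m := numPoints n n with hm
  have hm' : m = 16 * n ^ 2 + 2 := by rw [hm, numPoints]; ring
  have hα' : α = 95 * n ^ 2 := rfl
  have hm2 : m ≤ 2 ^ (5 * n) := numPoints_le hn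
  have hα2 : α + 8 * n + 3 ≤ 2 ^ α := by
    have h1 : α + 8 * n + 3 ≤ 2 * α := by nlinarith
    have h2 : α - 1 < 2 ^ (α - 1) := Nat.lt_two_pow_self
    have h3 : 2 ^ α = 2 * 2 ^ (α - 1) := by
      rw [← pow_succ']
      congr 1
      have : 1 ≤ α := by nlinarith
      omega
    omega
  set β := 2 + α * m + m * 2 ^ α * (1 + (α + 8 * n + 3) * 2 ^ (n + 1)) with hβ
  have hbase : 2 * ((2 ^ α) ^ m * (2 * (2 ^ (α + 8 * n + 3)) ^ 2 ^ (n + 1)) ^ (m * 2 ^ α)) + 1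
      ≤ 2 ^ β := by
    have h1 : (2 * (2 ^ (α + 8 * n + 3)) ^ 2 ^ (n + 1)) ^ (m * 2 ^ α) =
        2 ^ (m * 2 ^ α * (1 + (α + 8 * n + 3) * 2 ^ (n + 1))) := by
      rw [← pow_mul, ← pow_succ', ← pow_mul]
      congr 1; ring
    rw [h1, ← pow_mul, ← pow_add, hβ, add_assoc 2, pow_add 2 2]
    have := Nat.one_le_two_pow (n := α * m + m * 2 ^ α * (1 + (α + 8 * n + 3) * 2 ^ (n + 1)))
    omega
  have hβ2 : β ≤ 2 ^ (2 * α + 6 * n + 3) := by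
    have h0 : 1 ≤ m := by omega
    have h1 := Nat.one_le_two_pow (n := n + 1)
    have h2 : α ≤ 2 ^ α := Nat.lt_two_pow_self.le
    have h3 : 1 ≤ 2 ^ α := Nat.one_le_two_pow
    set E := m * 2 ^ α * ((α + 8 * n + 3) * 2 ^ (n + 1)) with hE
    have h4 : m * 2 ^ α * 3 ≤ E := Nat.mul_le_mul_left _ (by nlinarith)
    have h5 : α * m ≤ m * 2 ^ α := by rw [mul_comm]; exact Nat.mul_le_mul_left _ h2
    have h6 : 1 ≤ m * 2 ^ α := by nlinarith
    calc β = 2 + α * m + m * 2 ^ α + E := by rw [hβ, hE]; ring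
      _ ≤ 4 * E := by omega
      _ ≤ 4 * (2 ^ (5 * n) * 2 ^ α * (2 ^ α * 2 ^ (n + 1))) := by
          refine Nat.mul_le_mul_left _ ?_
          exact Nat.mul_le_mul (Nat.mul_le_mul_right _ hm2) (Nat.mul_le_mul_right _ hα2)
      _ = 2 ^ (2 * α + 6 * n + 3) := by
          rw [show (4 : ℕ) = 2 ^ 2 by norm_num, ← pow_add, ← pow_add, ← pow_add, ← pow_add]
          congr 1; ring
  refine lt_of_le_of_lt (Nat.pow_le_pow_left hbase _) ?_
  rw [← pow_mul]
  refine Nat.pow_lt_pow_right (by norm_num) ?_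
  calc β * ((2 ^ (α + 6 * n + 3)) ^ (2 * (4 * n ^ 2 + 2 * n + 1)) * ((2 ^ (n + 2)) ^ n) ^ m)
      ≤ 2 ^ (2 * α + 6 * n + 3) *
        ((2 ^ (α + 6 * n + 3)) ^ (2 * (4 * n ^ 2 + 2 * n + 1)) * ((2 ^ (n + 2)) ^ n) ^ m) :=
        Nat.mul_le_mul_right _ hβ2
    _ = 2 ^ (2 * α + 6 * n + 3 + ((α + 6 * n + 3) * (2 * (4 * n ^ 2 + 2 * n + 1)) +
        (n + 2) * n * m)) := by
        rw [← pow_mul, ← pow_mul, ← pow_mul, ← pow_add, ← pow_add]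
        congr 1; ring
    _ < 2 ^ (α * m) := by
        refine Nat.pow_lt_pow_right (by norm_num) ?_
        -- The tight case is n = 1, where the inequality reads 16α + 189 < 18α. This is why α is
        -- 95n².
        obtain ⟨k, rfl⟩ : ∃ k, n = k + 1 := ⟨n - 1, by omega⟩
        have : α * m = 2 * α + 6 * (k + 1) + 3 + ((α + 6 * (k + 1) + 3) *
            (2 * (4 * (k + 1) ^ 2 + 2 * (k + 1) + 1)) + ((k + 1) + 2) * (k + 1) * m) +
            (1 + 1082 * k + 2844 * k ^ 2 + 2516 * k ^ 3 + 744 * k ^ 4) := by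
          rw [hm', hα']; ring
        rw [this]
        omega
    _ = (2 ^ α) ^ m := pow_mul _ _ _

theorem isIdentificationSeq_growthExponent {n : ℕ} (hn : 1 ≤ n) :
    IsIdentificationSeq (polyClosure (lowComplexity n n))
      (powerPoint (numPoints n n) n (2 ^ (n + 2)) (2 ^ growthExponent n)) := by
  have hm' : numPoints n n = 16 * n ^ 2 + 2 := by rw [numPoints]; ring
  refine isIdentificationSeq_powerPoint (G := 2 ^ (growthExponent n + 6 * n + 3))
    (by omega) ?_ ?_ (count_lt hn)
  · have h1 : 2 * n + 1 ≤ 2 ^ (2 * n) := by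
      have := Nat.lt_two_pow_self (n := 2 * n)
      omega
    calc (2 * n + 1) * 2 ^ (growthExponent n + 6 * n + 3)
        ≤ 2 ^ (2 * n) * 2 ^ (growthExponent n + 6 * n + 3) := Nat.mul_le_mul_right _ h1
      _ = 2 ^ (growthExponent n + 8 * n + 3) := by rw [← pow_add]; congr 1; ring
  · have hm2 := numPoints_le hn
    calc numPoints n n * 2 ^ growthExponent n * 2 ^ (n + 2)
        ≤ 2 ^ (5 * n) * 2 ^ growthExponent n * 2 ^ (n + 2) :=
          Nat.mul_le_mul_right _ (Nat.mul_le_mul_right _ hm2)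
      _ = 2 ^ (growthExponent n + 6 * n + 2) := by
          rw [← pow_add, ← pow_add]; congr 1; ring
      _ < 2 ^ (growthExponent n + 6 * n + 3) := Nat.pow_lt_pow_right (by norm_num) (by omega)

section

open Circuit

/-! ### Generic circuits -/

/-- The polynomials in `s` are results of one circuit without subtractions, with at most `K` nodes,
over indeterminate scalars. -/
def JointlyBuilt {n r : ℕ} (K : ℕ) (s : Set (MvPolynomial (Fin n) (MvPolynomial (Fin r) ℂ))) :
    Prop :=
  ∃ c : Circuit (Fin n) (Fin r), c.WellFormed ∧ (∀ a b, Gate.sub a b ∉ c) ∧ c.length ≤ K ∧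
    ∀ f ∈ s, ∃ p < c.length, nodeVal c X (fun i => C (X i : MvPolynomial (Fin r) ℂ)) p = f

namespace JointlyBuilt

variable {n r K : ℕ} {s t : Set (MvPolynomial (Fin n) (MvPolynomial (Fin r) ℂ))}
  {f g : MvPolynomial (Fin n) (MvPolynomial (Fin r) ℂ)}

theorem mono (hs : JointlyBuilt K s) (h : t ⊆ s) : JointlyBuilt K t := by
  obtain ⟨c, hc, hsub, hK, hcs⟩ := hs
  exact ⟨c, hc, hsub, hK, fun f hf => hcs f (h hf)⟩

theorem empty : JointlyBuilt 0 (∅ : Set (MvPolynomial (Fin n) (MvPolynomial (Fin r) ℂ))) :=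
  ⟨[], wellFormed_nil, by simp, by simp, by simp⟩

theorem concat {c : Circuit (Fin n) (Fin r)} (hsub : ∀ a b, Gate.sub a b ∉ c) (hK : c.length ≤ K)
    (hcs : ∀ f ∈ s, ∃ p < c.length, nodeVal c X (fun i => C (X i : MvPolynomial (Fin r) ℂ)) p = f)
    {g : Gate (Fin n) (Fin r)} (hg : WellFormed (c ++ [g])) (hgs : ∀ a b, g ≠ Gate.sub a b)
    (hf : nodeVal (c ++ [g]) X (fun i => C (X i : MvPolynomial (Fin r) ℂ)) c.length = f) :
    JointlyBuilt (K + 1) (insert f s) := by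
  refine ⟨_, hg, fun a b h => ?_, by simpa using hK, ?_⟩
  · rcases List.mem_append.mp h with h | h
    · exact hsub a b h
    · exact hgs a b (List.mem_singleton.mp h).symm
  · rintro h (rfl | hh)
    · exact ⟨c.length, by simp, hf⟩
    · obtain ⟨p, hp, rfl⟩ := hcs _ hh
      exact ⟨p, by simp; omega, nodeVal_append hp⟩

theorem insert_X (hs : JointlyBuilt K s) (i : Fin n) : JointlyBuilt (K + 1) (insert (X i) s) := by
  obtain ⟨c, hc, hsub, hK, hcs⟩ := hs
  exact concat hsub hK hcs (hc.concat (g := Gate.input i) trivial) (by simp)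
    (nodeVal_concat_input i)

theorem insert_scalar (hs : JointlyBuilt K s) (i : Fin r) :
    JointlyBuilt (K + 1) (insert (C (X i)) s) := by
  obtain ⟨c, hc, hsub, hK, hcs⟩ := hs
  exact concat hsub hK hcs (hc.concat (g := Gate.scalar i) trivial) (by simp)
    (nodeVal_concat_scalar i)

theorem insert_add (hs : JointlyBuilt K s) (hf : f ∈ s) (hg : g ∈ s) :
    JointlyBuilt (K + 1) (insert (f + g) s) := by
  obtain ⟨c, hc, hsub, hK, hcs⟩ := hs
  obtain ⟨p, hp, rfl⟩ := hcs _ hf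
  obtain ⟨q, hq, rfl⟩ := hcs _ hg
  exact concat hsub hK hcs (hc.concat (g := Gate.add p q) ⟨hp, hq⟩) (by simp)
    (nodeVal_concat_add hp hq)

theorem insert_mul (hs : JointlyBuilt K s) (hf : f ∈ s) (hg : g ∈ s) :
    JointlyBuilt (K + 1) (insert (f * g) s) := by
  obtain ⟨c, hc, hsub, hK, hcs⟩ := hs
  obtain ⟨p, hp, rfl⟩ := hcs _ hf
  obtain ⟨q, hq, rfl⟩ := hcs _ hg
  exact concat hsub hK hcs (hc.concat (g := Gate.mul p q) ⟨hp, hq⟩) (by simp)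
    (nodeVal_concat_mul hp hq)

/-- Each summand costs three nodes: the scalar, its product with y i, and the addition. -/
theorem insert_add_sum {ι : Type} (T : Finset ι) (e : ι → Fin r)
    (y : ι → MvPolynomial (Fin n) (MvPolynomial (Fin r) ℂ)) (hs : JointlyBuilt K s)
    (hy : ∀ i ∈ T, y i ∈ s) (hf : f ∈ s) :
    JointlyBuilt (K + 3 * T.card) (insert (f + ∑ i ∈ T, C (X (e i)) * y i) s) := by
  classical
  induction T using Finset.induction_on with
  | empty => simpa [Set.insert_eq_of_mem hf] using hs
  | insert i T hi ih =>
    have h1 := ih fun k hk => hy k (Finset.mem_insert_of_mem hk)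
    have h2 := h1.insert_scalar (e i)
    have h3 := h2.insert_mul (Set.mem_insert _ _) (Set.mem_insert_of_mem _
      (Set.mem_insert_of_mem _ (hy i (Finset.mem_insert_self _ _))))
    have h4 := h3.insert_add (Set.mem_insert_of_mem _ (Set.mem_insert_of_mem _
      (Set.mem_insert _ _))) (Set.mem_insert _ _)
    rw [Finset.card_insert_of_notMem hi, Finset.sum_insert hi,
      add_comm (C (X (e i)) * y i), ← add_assoc, mul_add, ← add_assoc]
    exact h4.mono (Set.insert_subset_insert (((Set.subset_insert _ _).trans
      (Set.subset_insert _ _)).trans (Set.subset_insert _ _)))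

theorem insert_chainForm (e : ℕ → ℕ → Fin r)
    (y : ℕ → MvPolynomial (Fin n) (MvPolynomial (Fin r) ℂ)) (k j : ℕ) (hs : JointlyBuilt K s)
    (hx : ∀ i, X i ∈ s) (hy : ∀ i < j, y i ∈ s) :
    JointlyBuilt (K + (1 + 3 * n + 3 * j))
      (insert (chainForm (fun k t => C (X (e k t))) X y k j) s) := by
  have h1 := hs.insert_scalar (e k 0)
  have h2 := h1.insert_add_sum Finset.univ (fun i : Fin n => e k (i + 1)) X
    (fun i _ => Set.mem_insert_of_mem _ (hx i)) (Set.mem_insert _ _)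
  have h3 := h2.insert_add_sum (Finset.range j) (fun i => e k (n + 1 + i)) y
    (fun i hi => Set.mem_insert_of_mem _ (Set.mem_insert_of_mem _ (hy i (Finset.mem_range.mp hi))))
    (Set.mem_insert _ _)
  rw [Finset.card_univ, Fintype.card_fin, Finset.card_range, add_assoc, add_assoc, ← add_assoc 1]
    at h3
  exact h3.mono (Set.insert_subset_insert ((Set.subset_insert _ _).trans (Set.subset_insert _ _)))

theorem chain (e : ℕ → ℕ → Fin r) {L : ℕ} (j : ℕ) (hj : j ≤ L) :
    JointlyBuilt (n + j * (3 + 6 * n + 6 * L)) (Set.range X ∪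
      chainStep (fun k t => C (X (e k t))) (X : Fin n → MvPolynomial (Fin n) _) '' Set.Iio j) := by
  induction j with
  | zero =>
    have : ∀ T : Finset (Fin n), JointlyBuilt (r := r) T.card (X '' (T : Set (Fin n))) := by
      classical
      intro T
      induction T using Finset.induction_on with
      | empty => simpa using empty
      | insert i T hi ih =>
        rw [Finset.card_insert_of_notMem hi, Finset.coe_insert, Set.image_insert_eq]
        exact ih.insert_X i
    simpa using this Finset.univ
  | succ j ih =>
    have h0 := ih (by omega)
    have h1 := h0.insert_chainForm e (chainStep (fun k t => C (X (e k t))) X) (2 * j) j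
      (fun i => Or.inl ⟨i, rfl⟩) (fun i hi => Or.inr ⟨i, hi, rfl⟩)
    have h2 := h1.insert_chainForm e (chainStep (fun k t => C (X (e k t))) X) (2 * j + 1) j
      (fun i => Or.inr (Or.inl ⟨i, rfl⟩)) (fun i hi => Or.inr (Or.inr ⟨i, hi, rfl⟩))
    have h3 := h2.insert_mul (Set.mem_insert_of_mem _ (Set.mem_insert _ _)) (Set.mem_insert _ _)
    rw [← chainStep_eq] at h3
    obtain ⟨c, hc, hsub, hK, hcs⟩ := h3
    refine ⟨c, hc, hsub, hK.trans ?_, fun f hf => hcs f ?_⟩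
    · rw [add_mul j, one_mul]; omega
    · rcases hf with hf | ⟨i, hi, rfl⟩
      · exact Or.inr (Or.inr (Or.inr (Or.inl hf)))
      · rcases Nat.lt_succ_iff_lt_or_eq.mp hi with h | rfl
        · exact Or.inr (Or.inr (Or.inr (Or.inr ⟨i, h, rfl⟩)))
        · exact Or.inl rfl

theorem exists_circuit (hs : JointlyBuilt K s) (hf : f ∈ s) :
    ∃ c : Circuit (Fin n) (Fin r), c.WellFormed ∧ (∀ a b, Gate.sub a b ∉ c) ∧ c.length ≤ K ∧
      c ≠ [] ∧ genericPoly c = f := by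
  obtain ⟨c, hc, hsub, hK, hcs⟩ := hs
  obtain ⟨p, hp, rfl⟩ := hcs f hf
  -- The circuit is cut off after the node of f, which thereby becomes the output.
  have hlen : (c.take (p + 1)).length = p + 1 := by rw [List.length_take]; omega
  refine ⟨c.take (p + 1), ?_, fun a b h => hsub a b (List.mem_of_mem_take h), by omega, ?_, ?_⟩
  · intro q g hq
    refine hc q g ?_
    conv_lhs => rw [← List.take_append_drop (p + 1) c]
    rw [nodeAt_append_left (lt_of_nodeAt hq)]
    exact hq
  · intro h
    rw [h] at hlen
    simp at hlen
  · rw [genericPoly, hlen, Nat.add_sub_cancel]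
    conv_rhs => rw [← List.take_append_drop (p + 1) c]
    rw [nodeVal_append (by omega)]

end JointlyBuilt

/-- A position in a square matrix, as an index of a scalar of the generic circuit. -/
def scalarIndex (L n s t : ℕ) : Fin (numGenericScalars L n) :=
  ⟨(s * (L + n + 1) + t) % numGenericScalars L n, Nat.mod_lt _ (by rw [numGenericScalars]; positivity)⟩

/-- The matrix of a chain with n products has 2n + 1 rows and at most 2n + 1 relevant columns, so
its entries fit into the r scalars. Avoiding subtractions matters for databases that are not
arithmetic. -/
theorem exists_genericCircuit (n : ℕ) : ∃ c : Circuit (Fin n) (Fin (numGenericScalars n n)),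
    IsGenericCircuit n n c ∧ c.WellFormed ∧ (∀ a b, Gate.sub a b ∉ c) ∧ c ≠ [] ∧
      c.length ≤ 12 * n ^ 2 + 10 * n + 1 := by
  have h1 := (JointlyBuilt.chain (n := n) (scalarIndex n n) n le_rfl).insert_chainForm
    (scalarIndex n n) (chainStep (fun k t => C (X (scalarIndex n n k t))) X) (2 * n) n
    (fun i => Or.inl ⟨i, rfl⟩) (fun i hi => Or.inr ⟨i, hi, rfl⟩)
  obtain ⟨c, hc, hsub, hlen, hne, hpoly⟩ := h1.exists_circuit (Set.mem_insert _ _)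
  change genericPoly c = chainResult n (fun k t => C (X (scalarIndex n n k t))) X at hpoly
  refine ⟨c, fun f => ?_, hc, hsub, hne, hlen.trans ?_⟩
  · have hspec : ∀ ζ : Fin (numGenericScalars n n) → ℂ, nodeVal c X (fun s => C (ζ s)) (c.length - 1) =
        chainResult n (fun k t => C (ζ (scalarIndex n n k t))) X := by
      intro ζ
      rw [← spec_genericPoly, hpoly, spec, map_chainResult]
      simp only [map_C, map_X, eval_X]
    simp only [computes_iff, hspec]
    rw [show f ∈ lowComplexity n n ↔ NonscalarSizeLE n f from Iff.rfl,
      nonscalarSizeLE_iff_chainResult]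
    constructor
    · rintro ⟨z, rfl⟩
      -- The scalars list the matrix row by row, so quotient and remainder recover the position.
      refine ⟨fun k => z (k / (n + n + 1)) (k % (n + n + 1)), hc, hne,
        chainResult_congr _ fun s hs t ht => ?_⟩
      have ht' : t < n + n + 1 := by omega
      have hlt : s * (n + n + 1) + t < numGenericScalars n n := by
        rw [numGenericScalars, pow_two]
        nlinarith
      simp only [scalarIndex, Nat.mod_eq_of_lt hlt]
      rw [Nat.mul_add_mod_of_lt ht', mul_comm, Nat.mul_add_div (by omega), Nat.div_eq_of_lt ht',
        add_zero]
    · rintro ⟨ζ, -, -, rfl⟩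
      exact ⟨_, rfl⟩
  · nlinarith

end

section

open FirstOrder Language

/-! ### Prenex formulas and their length -/

section Formulas

variable {α β : Type}

theorem termSize_relabel (g : α → β) (t : queryLang.Term α) :
    termSize (t.relabel g) = termSize t := by
  induction t with
  | var a => rfl
  | func f ts ih => simp only [Term.relabel, termSize, ih]

theorem formulaSize_relabel {j k : ℕ} (g : α → β ⊕ Fin j) (φ : queryLang.BoundedFormula α k) :
    formulaSize (φ.relabel g) = formulaSize φ := by
  induction φ with
  | falsum => rfl
  | equal s t =>
    simp only [BoundedFormula.relabel, BoundedFormula.mapTermRel, formulaSize, termSize_relabel]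
  | rel R ts =>
    simp only [BoundedFormula.relabel, BoundedFormula.mapTermRel, formulaSize, termSize_relabel]
  | imp φ ψ ih1 ih2 => rw [BoundedFormula.relabel_imp, formulaSize, formulaSize, ih1, ih2]
  | all φ ih => rw [BoundedFormula.relabel_all, formulaSize, formulaSize, ih]

theorem PrenexAlt.relabel {j k a : ℕ} {q : Bool} (g : α → β ⊕ Fin j)
    {φ : queryLang.BoundedFormula α k} (h : PrenexAlt q a φ) : PrenexAlt q a (φ.relabel g) := by
  induction h with
  | of_isQF q h => exact .of_isQF q (h.relabel g)
  | ex h ih => rw [BoundedFormula.relabel_ex]; exact .ex ih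
  | all h ih => rw [BoundedFormula.relabel_all]; exact .all ih
  | alternate h ih => exact .alternate ih

theorem formulaSize_not {k : ℕ} (φ : queryLang.BoundedFormula α k) :
    formulaSize φ.not = formulaSize φ + 2 := by
  show 1 + formulaSize φ + 1 = _; omega

theorem formulaSize_ex {k : ℕ} (φ : queryLang.BoundedFormula α (k + 1)) :
    formulaSize φ.ex = formulaSize φ + 5 := by
  
  have : formulaSize φ.ex = formulaSize φ.not.all.not := rfl
  rw [this, formulaSize_not, formulaSize, formulaSize_not]; omega

theorem formulaSize_exs {k : ℕ} (φ : queryLang.BoundedFormula α k) :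
    formulaSize φ.exs = formulaSize φ + 5 * k := by
  induction k with
  | zero => rfl
  | succ k ih => rw [BoundedFormula.exs, ih, formulaSize_ex]; omega

theorem formulaSize_alls {k : ℕ} (φ : queryLang.BoundedFormula α k) :
    formulaSize φ.alls = formulaSize φ + k := by
  induction k with
  | zero => rfl
  | succ k ih => rw [BoundedFormula.alls, ih, formulaSize]; omega

theorem PrenexAlt.exs {k a : ℕ} {φ : queryLang.BoundedFormula α k} (h : PrenexAlt false a φ) :
    PrenexAlt false a φ.exs := by
  induction k with
  | zero => exact h
  | succ k ih => exact ih (.ex h)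

theorem PrenexAlt.alls {k a : ℕ} {φ : queryLang.BoundedFormula α k} (h : PrenexAlt true a φ) :
    PrenexAlt true a φ.alls := by
  induction k with
  | zero => exact h
  | succ k ih => exact ih (.all h)

/-- The quantifiers `iExs` and `iAlls` enumerate β by a chosen cardinality; this identifies the
number of quantifiers they introduce. -/
theorem card_eq_choose [Finite β] : Classical.choose (Finite.exists_equiv_fin β) = Nat.card β := by
  have e := Classical.choice (Classical.choose_spec (Finite.exists_equiv_fin β))
  rw [Nat.card_congr e, Nat.card_fin]

theorem formulaSize_iExs [Finite β] (φ : queryLang.Formula (α ⊕ β)) :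
    formulaSize (φ.iExs β) = formulaSize φ + 5 * Nat.card β := by
  rw [Formula.iExs, formulaSize_exs, formulaSize_relabel, ← card_eq_choose, add_zero]

theorem formulaSize_iAlls [Finite β] (φ : queryLang.Formula (α ⊕ β)) :
    formulaSize (φ.iAlls β) = formulaSize φ + Nat.card β := by
  rw [Formula.iAlls, formulaSize_alls, formulaSize_relabel, ← card_eq_choose, add_zero]

theorem PrenexAlt.iExs [Finite β] {a : ℕ} {φ : queryLang.Formula (α ⊕ β)}
    (h : PrenexAlt false a φ) : PrenexAlt false a (φ.iExs β) :=
  (h.relabel _).exs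

theorem PrenexAlt.iAlls [Finite β] {a : ℕ} {φ : queryLang.Formula (α ⊕ β)}
    (h : PrenexAlt true a φ) : PrenexAlt true a (φ.iAlls β) :=
  (h.relabel _).alls

variable (D : Database)

theorem holds_iExs [Finite β] {φ : queryLang.Formula (α ⊕ β)} {w : α → ℂ} :
    Holds D (φ.iExs β) w ↔ ∃ b : β → ℂ, Holds D φ (Sum.elim w b) :=
  @Formula.realize_iExs queryLang ℂ D.toStructure _ _ _ _ _

theorem holds_iAlls [Finite β] {φ : queryLang.Formula (α ⊕ β)} {w : α → ℂ} :
    Holds D (φ.iAlls β) w ↔ ∀ b : β → ℂ, Holds D φ (Sum.elim w b) :=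
  @Formula.realize_iAlls queryLang ℂ D.toStructure _ _ _ _ _

/-- The formula `a = b`. -/
def eqFormula (a b : α) : queryLang.Formula α :=
  .equal (.var (Sum.inl a)) (.var (Sum.inl b))

/-- The formula `a * a = b`. -/
def squareFormula (a b : α) : queryLang.Formula α :=
  .equal (.func QueryFunc.mul ![.var (Sum.inl a), .var (Sum.inl a)]) (.var (Sum.inl b))

/-- The formula `a = 1 + 1`. -/
def twoFormula (a : α) : queryLang.Formula α :=
  .equal (.var (Sum.inl a)) (.func QueryFunc.add ![.func QueryFunc.one Fin.elim0, .func QueryFunc.one Fin.elim0])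

/-- The formula `R(a, b, c)`. -/
def relFormula (R : QueryRel 3) (a b c : α) : queryLang.Formula α :=
  .rel (L := queryLang) (n := 0) R ![.var (Sum.inl a), .var (Sum.inl b), .var (Sum.inl c)]

/-- The conjunction of finitely many formulas. -/
def allOf {K : ℕ} (f : Fin K → queryLang.Formula α) : queryLang.Formula α :=
  ((List.finRange K).map f).foldr (· ⊓ ·) ⊤

/-- The disjunction of finitely many formulas. -/
def oneOf {K : ℕ} (f : Fin K → queryLang.Formula α) : queryLang.Formula α :=
  ((List.finRange K).map f).foldr (· ⊔ ·) ⊥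

variable {D} {w : α → ℂ}

theorem holds_eqFormula {a b : α} : Holds D (eqFormula a b) w ↔ w a = w b := Iff.rfl

theorem holds_squareFormula {a b : α} : Holds D (squareFormula a b) w ↔ w a * w a = w b := Iff.rfl

theorem holds_twoFormula {a : α} : Holds D (twoFormula a) w ↔ w a = 1 + 1 := Iff.rfl

theorem holds_relFormula_S {a b c : α} :
    Holds D (relFormula .S a b c) w ↔ D.relS (w a) (w b) (w c) := by
  refine iff_of_eq (congr_arg (· ∈ D.S) (?_ : (fun i => _) = _))
  funext i
  fin_cases i <;> rfl

theorem holds_relFormula_P {a b c : α} :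
    Holds D (relFormula .P a b c) w ↔ D.relP (w a) (w b) (w c) := by
  refine iff_of_eq (congr_arg (· ∈ D.P) (?_ : (fun i => _) = _))
  funext i
  fin_cases i <;> rfl

theorem holds_inf {φ ψ : queryLang.Formula α} : Holds D (φ ⊓ ψ) w ↔ Holds D φ w ∧ Holds D ψ w :=
  @BoundedFormula.realize_inf queryLang ℂ D.toStructure _ _ _ _ _ _

theorem holds_sup {φ ψ : queryLang.Formula α} : Holds D (φ ⊔ ψ) w ↔ Holds D φ w ∨ Holds D ψ w :=
  @BoundedFormula.realize_sup queryLang ℂ D.toStructure _ _ _ _ _ _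

theorem holds_imp {φ ψ : queryLang.Formula α} :
    Holds D (BoundedFormula.imp φ ψ) w ↔ (Holds D φ w → Holds D ψ w) :=
  @BoundedFormula.realize_imp queryLang ℂ D.toStructure _ _ _ _ _ _

theorem holds_not {φ : queryLang.Formula α} :
    Holds D (BoundedFormula.not φ) w ↔ ¬ Holds D φ w :=
  @BoundedFormula.realize_not queryLang ℂ D.toStructure _ _ _ _ _

theorem holds_allOf {K : ℕ} {f : Fin K → queryLang.Formula α} :
    Holds D (allOf f) w ↔ ∀ k, Holds D (f k) w :=
  (@BoundedFormula.realize_foldr_inf queryLang ℂ D.toStructure _ _ _ _ _).trans (by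
    simp only [List.forall_mem_map, List.mem_finRange, true_implies]; rfl)

theorem holds_oneOf {K : ℕ} {f : Fin K → queryLang.Formula α} :
    Holds D (oneOf f) w ↔ ∃ k, Holds D (f k) w :=
  (@BoundedFormula.realize_foldr_sup queryLang ℂ D.toStructure _ _ _ _ _).trans (by
    simp only [List.mem_map, List.mem_finRange, true_and, exists_exists_eq_and]; rfl)

theorem formulaSize_eqFormula (a b : α) : formulaSize (eqFormula a b) = 3 := by
  simp [eqFormula, formulaSize, termSize]

theorem formulaSize_squareFormula (a b : α) : formulaSize (squareFormula a b) = 5 := by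
  simp [squareFormula, formulaSize, termSize]

theorem formulaSize_twoFormula (a : α) : formulaSize (twoFormula a) = 5 := by
  simp [twoFormula, formulaSize, termSize]

theorem formulaSize_relFormula (R : QueryRel 3) (a b c : α) :
    formulaSize (relFormula R a b c) = 4 := by
  simp [relFormula, formulaSize, termSize, Fin.sum_univ_three]

theorem formulaSize_inf (φ ψ : queryLang.Formula α) :
    formulaSize (φ ⊓ ψ) = formulaSize φ + formulaSize ψ + 5 := by
  have : formulaSize (φ ⊓ ψ) = formulaSize (BoundedFormula.imp φ ψ.not).not := rfl
  rw [this, formulaSize_not, formulaSize, formulaSize_not]; omega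

theorem formulaSize_sup (φ ψ : queryLang.Formula α) :
    formulaSize (φ ⊔ ψ) = formulaSize φ + formulaSize ψ + 3 := by
  have : formulaSize (φ ⊔ ψ) = formulaSize (BoundedFormula.imp φ.not ψ) := rfl
  rw [this, formulaSize, formulaSize_not]; omega

theorem formulaSize_top : formulaSize (⊤ : queryLang.Formula α) = 3 := rfl

theorem formulaSize_allOf_le {K s : ℕ} {f : Fin K → queryLang.Formula α}
    (hf : ∀ k, formulaSize (f k) ≤ s) : formulaSize (allOf f) ≤ 3 + K * (s + 5) := by
  have key : ∀ l : List (Fin K),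
      formulaSize ((l.map f).foldr (· ⊓ ·) ⊤) ≤ 3 + l.length * (s + 5) := by
    intro l
    induction l with
    | nil => exact (formulaSize_top (α := α)).le.trans (Nat.le_add_right _ _)
    | cons k l ih =>
      rw [List.map_cons, List.foldr_cons, formulaSize_inf, List.length_cons]
      have := hf k
      nlinarith
  have h := key (List.finRange K)
  rw [List.length_finRange] at h
  exact h

theorem formulaSize_oneOf_le {K s : ℕ} {f : Fin K → queryLang.Formula α}
    (hf : ∀ k, formulaSize (f k) ≤ s) : formulaSize (oneOf f) ≤ 1 + K * (s + 3) := by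
  have key : ∀ l : List (Fin K),
      formulaSize ((l.map f).foldr (· ⊔ ·) ⊥) ≤ 1 + l.length * (s + 3) := by
    intro l
    induction l with
    | nil => exact (Nat.le_refl 1 : formulaSize (⊥ : queryLang.Formula α) ≤ 1).trans (Nat.le_add_right _ _)
    | cons k l ih =>
      rw [List.map_cons, List.foldr_cons, formulaSize_sup, List.length_cons]
      have := hf k
      nlinarith
  have h := key (List.finRange K)
  rw [List.length_finRange] at h
  exact h

theorem isQF_eqFormula (a b : α) : (eqFormula a b).IsQF := (BoundedFormula.IsAtomic.equal _ _).isQF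

theorem isQF_squareFormula (a b : α) : (squareFormula a b).IsQF :=
  (BoundedFormula.IsAtomic.equal _ _).isQF

theorem isQF_twoFormula (a : α) : (twoFormula a).IsQF := (BoundedFormula.IsAtomic.equal _ _).isQF

theorem isQF_relFormula (R : QueryRel 3) (a b c : α) : (relFormula R a b c).IsQF :=
  (BoundedFormula.IsAtomic.rel _ _).isQF

theorem isQF_allOf {K : ℕ} {f : Fin K → queryLang.Formula α} (hf : ∀ k, (f k).IsQF) :
    (allOf f).IsQF := by
  rw [allOf]
  induction List.finRange K with
  | nil => exact BoundedFormula.IsQF.top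
  | cons k l ih => exact (hf k).inf ih

theorem isQF_oneOf {K : ℕ} {f : Fin K → queryLang.Formula α} (hf : ∀ k, (f k).IsQF) :
    (oneOf f).IsQF := by
  rw [oneOf]
  induction List.finRange K with
  | nil => exact BoundedFormula.isQF_bot
  | cons k l ih => exact (hf k).sup ih

end Formulas

/-! ### Formulas for circuits and for repeated squaring -/

section CircuitFormulas

variable {α : Type} {n r : ℕ}

/-- The formula for a node at the position `p`. -/
def gateFormula (v : ℕ → α) (x : Fin n → α) (z : Fin r → α) (p : ℕ) :
    Gate (Fin n) (Fin r) → queryLang.Formula α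
  | .input i => eqFormula (v p) (x i)
  | .scalar s => eqFormula (v p) (z s)
  | .add a b => relFormula .S (v a) (v b) (v p)
  | .sub a b => relFormula .S (v p) (v b) (v a)
  | .mul a b => relFormula .P (v a) (v b) (v p)

/-- The formula expressing that `v` is the sequence of values of the nodes. -/
def traceFormula (c : Circuit (Fin n) (Fin r)) (v : ℕ → α) (x : Fin n → α) (z : Fin r → α) :
    queryLang.Formula α :=
  allOf fun p : Fin c.length => gateFormula v x z p (c.get p)

/-- The order conditions on operands are not expressed by the formula; they hold because the circuit
is well formed. -/
theorem holds_traceFormula {c : Circuit (Fin n) (Fin r)} (hc : c.WellFormed) {D : Database}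
    {w : α → ℂ} {v : ℕ → α} {x : Fin n → α} {z : Fin r → α} :
    Holds D (traceFormula c v x z) w ↔
      c.Trace D.relS D.relP (fun i => w (x i)) (fun s => w (z s)) (fun p => w (v p)) := by
  rw [traceFormula, holds_allOf]
  have key : ∀ (p : ℕ) (g : Gate (Fin n) (Fin r)), c.nodeAt p = some g →
      (Holds D (gateFormula v x z p g) w ↔
        match g with
        | .input i => w (v p) = w (x i)
        | .scalar s => w (v p) = w (z s)
        | .add a b => a < p ∧ b < p ∧ D.relS (w (v a)) (w (v b)) (w (v p))
        | .sub a b => a < p ∧ b < p ∧ D.relS (w (v p)) (w (v b)) (w (v a))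
        | .mul a b => a < p ∧ b < p ∧ D.relP (w (v a)) (w (v b)) (w (v p))) := by
    intro p g hg
    have hw := hc p g hg
    cases g with
    | input i => exact holds_eqFormula
    | scalar s => exact holds_eqFormula
    | add a b => exact holds_relFormula_S.trans ⟨fun h => ⟨hw.1, hw.2, h⟩, fun h => h.2.2⟩
    | sub a b => exact holds_relFormula_S.trans ⟨fun h => ⟨hw.1, hw.2, h⟩, fun h => h.2.2⟩
    | mul a b => exact holds_relFormula_P.trans ⟨fun h => ⟨hw.1, hw.2, h⟩, fun h => h.2.2⟩
  constructor
  · intro h p g hg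
    obtain ⟨hp, hpg⟩ := List.getElem?_eq_some_iff.mp hg
    have h1 := h ⟨p, hp⟩
    rw [List.get_eq_getElem, hpg] at h1
    have h2 := (key p g hg).mp h1
    cases g <;> exact h2
  · intro h p
    have h2 : ∀ g, c.nodeAt p = some g → Holds D (gateFormula v x z p g) w := by
      intro g hg
      have h1 := h p g hg
      refine (key p g hg).mpr ?_
      cases g <;> exact h1
    exact h2 _ (List.getElem?_eq_getElem p.2)

theorem formulaSize_traceFormula_le (c : Circuit (Fin n) (Fin r)) (v : ℕ → α) (x : Fin n → α)
    (z : Fin r → α) : formulaSize (traceFormula c v x z) ≤ 3 + c.length * 9 := by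
  refine formulaSize_allOf_le fun p => ?_
  cases c.get p <;> simp [gateFormula, formulaSize_eqFormula, formulaSize_relFormula]

theorem isQF_traceFormula (c : Circuit (Fin n) (Fin r)) (v : ℕ → α) (x : Fin n → α)
    (z : Fin r → α) : (traceFormula c v x z).IsQF := by
  refine isQF_allOf fun p => ?_
  cases c.get p <;> simp only [gateFormula, isQF_eqFormula, isQF_relFormula]

/-- The formula expressing that `v 0, …, v K` is a sequence of repeated squares. -/
def squaringFormula (K : ℕ) (v : ℕ → α) (p : α) : queryLang.Formula α :=
  eqFormula (v 0) p ⊓ allOf fun j : Fin K => squareFormula (v j) (v (j + 1))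

theorem holds_squaringFormula {D : Database} {w : α → ℂ} {K : ℕ} {v : ℕ → α} {p : α} :
    Holds D (squaringFormula K v p) w ↔ ∀ j ≤ K, w (v j) = w p ^ 2 ^ j := by
  rw [squaringFormula, holds_inf, holds_allOf, holds_eqFormula]
  simp only [holds_squareFormula]
  constructor
  · rintro ⟨h0, h⟩ j hj
    induction j with
    | zero => simpa using h0
    | succ j ih => rw [← h ⟨j, hj⟩, ih (by omega), ← pow_add, pow_succ 2, mul_two]
  · intro h
    refine ⟨by simpa using h 0 (Nat.zero_le _), fun j => ?_⟩
    have := j.2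
    rw [h j (by omega), h (j + 1) (by omega), ← pow_add, pow_succ 2, mul_two]

theorem formulaSize_squaringFormula_le (K : ℕ) (v : ℕ → α) (p : α) :
    formulaSize (squaringFormula K v p) ≤ 11 + K * 10 := by
  have := formulaSize_allOf_le (f := fun j : Fin K => squareFormula (v j) (v (j + 1))) (s := 5)
    fun j => (formulaSize_squareFormula _ _).le
  rw [squaringFormula, formulaSize_inf, formulaSize_eqFormula]
  omega

theorem isQF_squaringFormula (K : ℕ) (v : ℕ → α) (p : α) : (squaringFormula K v p).IsQF :=
  (isQF_eqFormula _ _).inf (isQF_allOf fun _ => isQF_squareFormula _ _)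

end CircuitFormulas

end

/-! ### Evaluation of circuits over arbitrary binary operations -/

namespace Circuit

variable {ι κ R : Type} {c : Circuit ι κ} {S P : R → R → R → Prop} {x : ι → R} {z : κ → R}

theorem Trace.congr {v v' : ℕ → R} (hv : c.Trace S P x z v)
    (h : ∀ p < c.length, v p = v' p) : c.Trace S P x z v' := by
  intro p g hg
  have hp := lt_of_nodeAt hg
  have h1 := hv p g hg
  cases g with
  | input i => exact (h p hp).symm.trans h1
  | scalar s => exact (h p hp).symm.trans h1
  | add a b =>
    refine ⟨h1.1, h1.2.1, ?_⟩
    rw [← h p hp, ← h a (h1.1.trans hp), ← h b (h1.2.1.trans hp)]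
    exact h1.2.2
  | sub a b =>
    refine ⟨h1.1, h1.2.1, ?_⟩
    rw [← h p hp, ← h a (h1.1.trans hp), ← h b (h1.2.1.trans hp)]
    exact h1.2.2
  | mul a b =>
    refine ⟨h1.1, h1.2.1, ?_⟩
    rw [← h p hp, ← h a (h1.1.trans hp), ← h b (h1.2.1.trans hp)]
    exact h1.2.2

theorem Trace.concat {v : ℕ → R} (hv : c.Trace S P x z v) (g : Gate ι κ)
    (hg : match g with
      | .input i => v c.length = x i
      | .scalar s => v c.length = z s
      | .add a b => a < c.length ∧ b < c.length ∧ S (v a) (v b) (v c.length)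
      | .sub a b => a < c.length ∧ b < c.length ∧ S (v c.length) (v b) (v a)
      | .mul a b => a < c.length ∧ b < c.length ∧ P (v a) (v b) (v c.length)) :
    Trace (c ++ [g]) S P x z v := by
  intro p g' hp
  rcases nodeAt_concat_eq_some hp with h | ⟨rfl, rfl⟩
  · exact hv p g' h
  · exact hg

/-- The values are defined node by node. Subtractions are excluded because an arbitrary operation
graph need not be solvable for its first argument. -/
theorem WellFormed.exists_trace (hc : c.WellFormed) (hsub : ∀ a b, Gate.sub a b ∉ c)
    (hS : ∀ a b, ∃ d, S a b d) (hP : ∀ a b, ∃ d, P a b d) (x : ι → R) (z : κ → R) (r : R) :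
    ∃ v : ℕ → R, Trace c S P x z v := by
  induction c using List.reverseRecOn with
  | nil => exact ⟨fun _ => r, fun p g h => by simp [nodeAt] at h⟩
  | append_singleton c g ih =>
    have hc' : WellFormed c := by
      intro p g' hp
      exact hc p g' (by rw [nodeAt_append_left (lt_of_nodeAt hp)]; exact hp)
    obtain ⟨v, hv⟩ := ih hc' fun a b h => hsub a b (List.mem_append_left _ h)
    have hv' : ∀ e, Trace c S P x z (Function.update v c.length e) := fun e =>
      hv.congr fun p hp => (Function.update_of_ne hp.ne _ _).symm
    have hlt := hc _ _ (nodeAt_concat g)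
    cases g with
    | input i => exact ⟨_, (hv' (x i)).concat _ (by simp)⟩
    | scalar s => exact ⟨_, (hv' (z s)).concat _ (by simp)⟩
    | add a b =>
      obtain ⟨d, hd⟩ := hS (v a) (v b)
      refine ⟨_, (hv' d).concat _ ⟨hlt.1, hlt.2, ?_⟩⟩
      rwa [Function.update_of_ne hlt.1.ne, Function.update_of_ne hlt.2.ne, Function.update_self]
    | sub a b => exact absurd (List.mem_append_right _ (List.mem_singleton_self _)) (hsub a b)
    | mul a b =>
      obtain ⟨d, hd⟩ := hP (v a) (v b)
      refine ⟨_, (hv' d).concat _ ⟨hlt.1, hlt.2, ?_⟩⟩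
      rwa [Function.update_of_ne hlt.1.ne, Function.update_of_ne hlt.2.ne, Function.update_self]

theorem Trace.unique (hsub : ∀ a b, Gate.sub a b ∉ c)
    (hS : ∀ a b d d', S a b d → S a b d' → d = d') (hP : ∀ a b d d', P a b d → P a b d' → d = d')
    {v v' : ℕ → R} (hv : c.Trace S P x z v) (hv' : c.Trace S P x z v') :
    ∀ p < c.length, v p = v' p := by
  intro p
  induction p using Nat.strong_induction_on with
  | _ p ih =>
    intro hp
    have hg : c.nodeAt p = some ((c)[p]) := List.getElem?_eq_getElem hp
    have hmem : (c)[p] ∈ c := List.getElem_mem hp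
    generalize (c)[p] = g at hg hmem
    have h1 := hv p g hg
    have h2 := hv' p g hg
    cases g with
    | input i => exact h1.trans h2.symm
    | scalar s => exact h1.trans h2.symm
    | add a b =>
      obtain ⟨ha, hb, h1⟩ := h1
      rw [ih a ha (ha.trans hp), ih b hb (hb.trans hp)] at h1
      exact hS _ _ _ _ h1 h2.2.2
    | sub a b => exact absurd hmem (hsub a b)
    | mul a b =>
      obtain ⟨ha, hb, h1⟩ := h1
      rw [ih a ha (ha.trans hp), ih b hb (hb.trans hp)] at h1
      exact hP _ _ _ _ h1 h2.2.2

theorem relEval_iff (hne : c ≠ []) {y : R} :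
    c.RelEval S P x z y ↔ ∃ v, c.Trace S P x z v ∧ v (c.length - 1) = y := by
  have hpos := List.length_pos_iff.mpr hne
  constructor
  · rintro ⟨v, hv, p, hp, h⟩
    exact ⟨v, hv, by rwa [← hp, Nat.add_sub_cancel]⟩
  · rintro ⟨v, hv, h⟩
    exact ⟨v, hv, _, by omega, h⟩

end Circuit

/-! ### A prenex form of `Phi` with two quantifier alternations -/

section PrenexForm

/-- A finite sequence, extended periodically. -/
def periodic {α : Type} {K : ℕ} (f : Fin (K + 1) → α) (i : ℕ) : α := f (Fin.ofNat (K + 1) i)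

theorem exists_periodic {α : Type} {K : ℕ} (g : ℕ → α) :
    ∃ f : Fin (K + 1) → α, ∀ i ≤ K, periodic f i = g i :=
  ⟨fun i => g i, fun _ hi => congr_arg g (Nat.mod_eq_of_lt (Nat.lt_succ_of_le hi))⟩

variable {n r m : ℕ} (c : Circuit (Fin n) (Fin r)) (D : Database) (α : ℕ)

/-- The quantifier-free part of a prenex form of `Phi`, for identification sequences of iterated
powers of two.  The parameter `t` lists these powers, `s`, `ζ` and `ξ` are the
universally quantified variables, `e`, `w` and `v` the ones of the last existential block. -/
structure PrenexMatrix (u : Fin m → ℂ) (x : Fin n → ℂ) (y : ℂ) (z : Fin r → ℂ) (t : ℕ → ℂ)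
    (s : Fin 7 → ℂ) (ζ : Fin 2 → Fin r → ℂ) (ξ : Fin n → ℂ) (e : Fin 3 → ℂ) (w : Fin 2 → ℕ → ℂ)
    (v : Fin 6 → ℕ → ℂ) : Prop where
  start : t 0 = 1 + 1
  trace_output : c.Trace D.relS D.relP x z (v 0)
  output : v 0 (c.length - 1) = y
  squaring : ∀ j ≤ α, w 0 j = s 0 ^ 2 ^ j
  trace_point : c.Trace D.relS D.relP (fun i => w 0 ((n + 2) * i)) z (v 1)
  point : (∃ k : Fin m, s 0 = t k ∧ s 1 = u k) → v 1 (c.length - 1) = s 1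
  step : (∃ k : Fin m, s 0 = t k ∧ s 2 = t (k + 1)) → s 2 = w 0 α
  exists_S : D.relS (s 3) (s 4) (e 0)
  exists_P : D.relP (s 3) (s 4) (e 1)
  unique_S : D.relS (s 3) (s 4) (s 5) ∧ D.relS (s 3) (s 4) (s 6) → s 5 = s 6
  unique_P : D.relP (s 3) (s 4) (s 5) ∧ D.relP (s 3) (s 4) (s 6) → s 5 = s 6
  squaring' : ∀ j ≤ α, w 1 j = e 2 ^ 2 ^ j
  trace_fst_point : c.Trace D.relS D.relP (fun i => w 1 ((n + 2) * i)) (ζ 0) (v 2)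
  trace_snd_point : c.Trace D.relS D.relP (fun i => w 1 ((n + 2) * i)) (ζ 1) (v 3)
  trace_fst : c.Trace D.relS D.relP ξ (ζ 0) (v 4)
  trace_snd : c.Trace D.relS D.relP ξ (ζ 1) (v 5)
  identification : ((∃ k : Fin m, e 2 = t k) ∧ ¬ v 2 (c.length - 1) = v 3 (c.length - 1)) ∨
    v 4 (c.length - 1) = v 5 (c.length - 1)

variable {c D}

section Functional

variable (hc : c.WellFormed) (hsub : ∀ a b, Gate.sub a b ∉ c) (hne : c ≠ [])
  (hS : IsOperationGraph D.relS) (hP : IsOperationGraph D.relP)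

include hsub hS hP

include hne in
theorem psi_iff_of_trace {z : Fin r → ℂ} {x : Fin n → ℂ} {v : ℕ → ℂ}
    (hv : c.Trace D.relS D.relP x z v) {y : ℂ} : Psi c D z x y ↔ v (c.length - 1) = y := by
  have hpos := List.length_pos_iff.mpr hne
  rw [Psi, Circuit.relEval_iff hne]
  constructor
  · rintro ⟨v', hv', rfl⟩
    exact hv.unique hsub (fun a b _ _ h h' => (hS a b).unique h h')
      (fun a b _ _ h h' => (hP a b).unique h h') hv' _ (by omega)
  · exact fun h => ⟨v, hv, h⟩

include hc in
theorem exists_trace (x : Fin n → ℂ) (z : Fin r → ℂ) :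
    ∃ v : ℕ → ℂ, c.Trace D.relS D.relP x z v :=
  hc.exists_trace hsub (fun a b => (hS a b).exists) (fun a b => (hP a b).exists) x z 0

include hc hne in
theorem exists_objectMap (z : Fin r → ℂ) :
    ∃ F : (Fin n → ℂ) → ℂ, ∀ x y, Psi c D z x y ↔ F x = y := by
  choose v hv using fun x => exists_trace hc hsub hS hP x z
  exact ⟨fun x => v x (c.length - 1), fun x y => psi_iff_of_trace hsub hne hS hP (hv x)⟩

end Functional

/-- As N = 2^(n+2), the coordinate t^(N^i) is the entry (n + 2)·i of the sequence of repeated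
squares of t. -/
theorem powerPoint_eq_of_squaring {t : ℂ} {w : ℕ → ℂ} {k : Fin m}
    (ht : t = 2 ^ (2 ^ α) ^ (k : ℕ)) (hα : (n + 2) * n ≤ α) (hw : ∀ j ≤ α, w j = t ^ 2 ^ j) :
    (fun i : Fin n => w ((n + 2) * i)) =
      ratPoint (powerPoint m n (2 ^ (n + 2)) (2 ^ α) k) := by
  have h : ∀ i : Fin n, w ((n + 2) * i) = t ^ (2 ^ (n + 2)) ^ (i : ℕ) := fun i => by
    rw [hw _ ((Nat.mul_le_mul_left _ i.2.le).trans hα), pow_mul]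
  rw [ratPoint_powerPoint, ← ht]
  exact funext h

theorem exists_vector (p q p' a b d e : ℂ) : ∃ s : Fin 7 → ℂ, s 0 = p ∧ s 1 = q ∧ s 2 = p' ∧
    s 3 = a ∧ s 4 = b ∧ s 5 = d ∧ s 6 = e :=
  ⟨![p, q, p', a, b, d, e], by simp⟩
theorem isOperationGraph_of_forall {Q : ℂ → ℂ → ℂ → Prop}
    (h : ∀ s : Fin 7 → ℂ, ∃ d, Q (s 3) (s 4) d ∧
      (Q (s 3) (s 4) (s 5) ∧ Q (s 3) (s 4) (s 6) → s 5 = s 6)) : IsOperationGraph Q := by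
  have h1 : ∀ a b d' d, ∃ e, Q a b e ∧ (Q a b d' ∧ Q a b d → d' = d) := by
    intro a b d' d
    obtain ⟨s, -, -, -, h3, h4, h5, h6⟩ := exists_vector 0 0 0 a b d' d
    have := h s
    rwa [h3, h4, h5, h6] at this
  intro a b
  obtain ⟨d, hd, -⟩ := h1 a b 0 0
  refine ⟨d, hd, fun d' hd' => ?_⟩
  obtain ⟨-, -, h1⟩ := h1 a b d' d
  exact h1 ⟨hd', hd⟩

variable {α} {u : Fin m → ℂ} {x : Fin n → ℂ} {y : ℂ}

/-- Taking s 0 = t k and s 2 = t (k + 1) activates the guarded condition `step`, which says that t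
(k + 1) is the α-fold square of t k. -/
theorem eq_two_pow_of_prenexMatrix {z : Fin r → ℂ} {t : ℕ → ℂ} {ζ : Fin 2 → Fin r → ℂ}
    {ξ : Fin n → ℂ} (hs : ∀ s, ∃ e w v, PrenexMatrix c D α u x y z t s ζ ξ e w v) :
    ∀ k ≤ m, t k = 2 ^ (2 ^ α) ^ k := by
  intro k hk
  induction k with
  | zero =>
    obtain ⟨e, w, v, h1⟩ := hs fun _ => 0
    rw [h1.start, pow_zero, pow_one, one_add_one_eq_two]
  | succ k ih =>
    obtain ⟨s, hs0, -, hs2, -⟩ := exists_vector (t k) 0 (t (k + 1)) 0 0 0 0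
    obtain ⟨e, w, v, h1⟩ := hs s
    rw [← hs2, h1.step ⟨⟨k, hk⟩, hs0, hs2⟩, h1.squaring α le_rfl, hs0, ih (by omega),
      pow_succ (2 ^ α) k, pow_mul]

/-- Each part of `Phi` is obtained from a suitable instance of the universal variables: s 0 and s 1
select a point and the prescribed value there, s 3 to s 6 test the operation graphs, and ζ, ξ test
two members of the class at an argument. -/
theorem phi_of_prenexMatrix (hc : c.WellFormed) (hsub : ∀ a b, Gate.sub a b ∉ c) (hne : c ≠ [])
    (hα : (n + 2) * n ≤ α) {z : Fin r → ℂ} {t : ℕ → ℂ}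
    (h : ∀ s ζ ξ, ∃ e w v, PrenexMatrix c D α u x y z t s ζ ξ e w v) :
    Phi c (powerPoint m n (2 ^ (n + 2)) (2 ^ α)) D u x y := by
  have hs : ∀ s : Fin 7 → ℂ, ∃ e w v, PrenexMatrix c D α u x y z t s (fun _ _ => 0) (fun _ => 0)
      e w v := fun s => h s _ _
  have hS : IsOperationGraph D.relS := isOperationGraph_of_forall fun s => by
    obtain ⟨e, w, v, h1⟩ := hs s
    exact ⟨_, h1.exists_S, h1.unique_S⟩
  have hP : IsOperationGraph D.relP := isOperationGraph_of_forall fun s => by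
    obtain ⟨e, w, v, h1⟩ := hs s
    exact ⟨_, h1.exists_P, h1.unique_P⟩
  have ht := eq_two_pow_of_prenexMatrix hs
  have hout := fun {z x v} (hv : c.Trace D.relS D.relP x z v) {y} =>
    psi_iff_of_trace hsub hne hS hP hv (y := y)
  refine ⟨⟨z, ?_, fun k => ?_⟩, hS, hP, ?_, ?_⟩
  · obtain ⟨e, w, v, h1⟩ := hs fun _ => 0
    exact (hout h1.trace_output).mpr h1.output
  · obtain ⟨s, hs0, hs1, -⟩ := exists_vector (t k) (u k) 0 0 0 0 0
    obtain ⟨e, w, v, h1⟩ := hs s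
    have hw := powerPoint_eq_of_squaring (k := k) α (hs0.trans (ht k k.2.le)) hα h1.squaring
    rw [← hw, ← hs1]
    exact (hout h1.trace_point).mpr (h1.point ⟨k, hs0, hs1⟩)
  · rintro F ⟨z1, hF⟩ G ⟨z2, hG⟩ hFG
    funext ξ
    obtain ⟨e, w, v, h1⟩ := h (fun _ => 0) ![z1, z2] ξ
    have h4 := (hF _ _).mp ((hout h1.trace_fst).mpr rfl)
    have h5 := (hG _ _).mp ((hout h1.trace_snd).mpr rfl)
    rcases h1.identification with ⟨⟨k, hk⟩, hk'⟩ | h6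
    · refine absurd ?_ hk'
      have hw := powerPoint_eq_of_squaring (k := k) α (hk.trans (ht k k.2.le)) hα h1.squaring'
      have h2 := (hF _ _).mp ((hout h1.trace_fst_point).mpr rfl)
      have h3 := (hG _ _).mp ((hout h1.trace_snd_point).mpr rfl)
      rw [← h2, ← h3, hw]
      exact hFG k
    · rw [h4, h5, h6]
  · obtain ⟨F, hF⟩ := exists_objectMap hc hsub hne hS hP z
    exact ⟨F, z, hF⟩

theorem prenexMatrix_of_phi (hc : c.WellFormed) (hsub : ∀ a b, Gate.sub a b ∉ c) (hne : c ≠ [])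
    (hα : (n + 2) * n ≤ α) (h : Phi c (powerPoint m n (2 ^ (n + 2)) (2 ^ α)) D u x y) :
    ∃ (z : Fin r → ℂ) (t : Fin (m + 1) → ℂ), ∀ s ζ ξ,
      ∃ (e : Fin 3 → ℂ) (w : Fin 2 → Fin (α + 1) → ℂ) (v : Fin 6 → Fin (c.length + 1) → ℂ),
        PrenexMatrix c D α u x y z (periodic t) s ζ ξ e (fun i => periodic (w i))
          (fun i => periodic (v i)) := by
  obtain ⟨⟨z, hy, hu⟩, hS, hP, hid, -⟩ := h
  have hout := fun {z x v} (hv : c.Trace D.relS D.relP x z v) {y} =>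
    psi_iff_of_trace hsub hne hS hP hv (y := y)
  have htr : ∀ x z, ∃ v : Fin (c.length + 1) → ℂ, c.Trace D.relS D.relP x z (periodic v) := by
    intro x z
    obtain ⟨v, hv⟩ := exists_trace hc hsub hS hP x z
    obtain ⟨v', h⟩ := exists_periodic v
    exact ⟨v', hv.congr fun p hp => (h p hp.le).symm⟩
  have hsq : ∀ p : ℂ, ∃ w : Fin (α + 1) → ℂ, ∀ j ≤ α, periodic w j = p ^ 2 ^ j := fun p =>
    exists_periodic _
  obtain ⟨t, ht⟩ := exists_periodic (K := m) fun k : ℕ => (2 : ℂ) ^ (2 ^ α) ^ k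
  refine ⟨z, t, fun s ζ ξ => ?_⟩
  obtain ⟨d, hd, hdu⟩ := hS (s 3) (s 4)
  obtain ⟨d', hd', hdu'⟩ := hP (s 3) (s 4)
  obtain ⟨v0, hv0⟩ := htr x z
  obtain ⟨w0, hw0⟩ := hsq (s 0)
  obtain ⟨v1, hv1⟩ := htr (fun i => periodic w0 ((n + 2) * i)) z
  obtain ⟨v4, hv4⟩ := htr ξ (ζ 0)
  obtain ⟨v5, hv5⟩ := htr ξ (ζ 1)
  -- Contrapositive of the identification property: if the two maps differ at ξ, some point of the
  -- sequence separates them and p is its power of two. If they agree at ξ, p is irrelevant and 0 is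
  -- taken.
  have hid' : ∃ p : ℂ, (∃ k : Fin m, p = periodic t k ∧
      ∃ a b, ¬ a = b ∧ Psi c D (ζ 0) (ratPoint (powerPoint m n (2 ^ (n + 2)) (2 ^ α) k)) a ∧
        Psi c D (ζ 1) (ratPoint (powerPoint m n (2 ^ (n + 2)) (2 ^ α) k)) b) ∨
      periodic v4 (c.length - 1) = periodic v5 (c.length - 1) := by
    by_cases h45 : periodic v4 (c.length - 1) = periodic v5 (c.length - 1)
    · exact ⟨0, Or.inr h45⟩
    · obtain ⟨F, hF⟩ := exists_objectMap hc hsub hne hS hP (ζ 0)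
      obtain ⟨G, hG⟩ := exists_objectMap hc hsub hne hS hP (ζ 1)
      have hne' : F ≠ G := by
        rintro rfl
        exact h45 (((hF _ _).mp ((hout hv4).mpr rfl)).symm.trans
          ((hG _ _).mp ((hout hv5).mpr rfl)))
      have h1 := mt (hid F ⟨_, hF⟩ G ⟨_, hG⟩) hne'
      push Not at h1
      obtain ⟨k, hk⟩ := h1
      exact ⟨_, Or.inl ⟨k, rfl, _, _, hk, (hF _ _).mpr rfl, (hG _ _).mpr rfl⟩⟩
  obtain ⟨p, hp⟩ := hid'
  obtain ⟨w1, hw1⟩ := hsq p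
  obtain ⟨v2, hv2⟩ := htr (fun i => periodic w1 ((n + 2) * i)) (ζ 0)
  obtain ⟨v3, hv3⟩ := htr (fun i => periodic w1 ((n + 2) * i)) (ζ 1)
  refine ⟨![d, d', p], ![w0, w1], ![v0, v1, v2, v3, v4, v5], ?_, hv0, (hout hv0).mp hy, hw0, hv1,
    ?_, ?_, hd, hd', ?_, ?_, hw1, hv2, hv3, hv4, hv5, ?_⟩
  · rw [ht 0 (Nat.zero_le _), pow_zero, pow_one, one_add_one_eq_two]
  · rintro ⟨k, hk, hk'⟩
    have hw := powerPoint_eq_of_squaring (k := k) α (hk.trans (ht k k.2.le)) hα hw0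
    have h1 := hu k
    rw [← hw, ← hk'] at h1
    exact (hout hv1).mp h1
  · rintro ⟨k, hk, hk'⟩
    change s 2 = periodic w0 α
    rw [hw0 α le_rfl, hk, hk', ht (k + 1) k.2, ht _ k.2.le, pow_succ (2 ^ α) (k : ℕ), pow_mul]
  · exact fun h => (hS _ _).unique h.1 h.2
  · exact fun h => (hP _ _).unique h.1 h.2
  · rcases hp with ⟨k, hk, a, b, hab, ha, hb⟩ | h45
    · have hw := powerPoint_eq_of_squaring (k := k) α (hk.trans (ht k k.2.le)) hα hw1
      rw [← hw] at ha hb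
      refine Or.inl ⟨⟨k, hk⟩, ?_⟩
      change ¬ periodic v2 _ = periodic v3 _
      rw [(hout hv2).mp ha, (hout hv3).mp hb]
      exact hab
    · exact Or.inr h45

end PrenexForm

/-! ### The first-order formula and its size -/

section

open FirstOrder Language

section MatrixFormula

variable {n r m : ℕ} (c : Circuit (Fin n) (Fin r)) (α : ℕ) {V : Type} (u : Fin m → V)
  (x : Fin n → V) (y : V) (z : Fin r → V) (t : ℕ → V) (s : Fin 7 → V) (ζ : Fin 2 → Fin r → V)
  (ξ : Fin n → V) (e : Fin 3 → V) (w : Fin 2 → ℕ → V) (v : Fin 6 → ℕ → V)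

/-- The quantifier-free formula for `PrenexMatrix`. -/
def matrixFormula : queryLang.Formula V :=
  twoFormula (t 0) ⊓
  (traceFormula c (v 0) x z ⊓
  (eqFormula (v 0 (c.length - 1)) y ⊓
  (squaringFormula α (w 0) (s 0) ⊓
  (traceFormula c (v 1) (fun i => w 0 ((n + 2) * i)) z ⊓
  (BoundedFormula.imp (oneOf fun k : Fin m => eqFormula (s 0) (t k) ⊓ eqFormula (s 1) (u k))
    (eqFormula (v 1 (c.length - 1)) (s 1)) ⊓
  (BoundedFormula.imp (oneOf fun k : Fin m => eqFormula (s 0) (t k) ⊓ eqFormula (s 2) (t (k + 1)))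
    (eqFormula (s 2) (w 0 α)) ⊓
  (relFormula .S (s 3) (s 4) (e 0) ⊓
  (relFormula .P (s 3) (s 4) (e 1) ⊓
  (BoundedFormula.imp (relFormula .S (s 3) (s 4) (s 5) ⊓ relFormula .S (s 3) (s 4) (s 6))
    (eqFormula (s 5) (s 6)) ⊓
  (BoundedFormula.imp (relFormula .P (s 3) (s 4) (s 5) ⊓ relFormula .P (s 3) (s 4) (s 6))
    (eqFormula (s 5) (s 6)) ⊓
  (squaringFormula α (w 1) (e 2) ⊓
  (traceFormula c (v 2) (fun i => w 1 ((n + 2) * i)) (ζ 0) ⊓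
  (traceFormula c (v 3) (fun i => w 1 ((n + 2) * i)) (ζ 1) ⊓
  (traceFormula c (v 4) ξ (ζ 0) ⊓
  (traceFormula c (v 5) ξ (ζ 1) ⊓
  (((oneOf fun k : Fin m => eqFormula (e 2) (t k)) ⊓
      BoundedFormula.not (eqFormula (v 2 (c.length - 1)) (v 3 (c.length - 1)))) ⊔
    eqFormula (v 4 (c.length - 1)) (v 5 (c.length - 1))))))))))))))))))

theorem isQF_matrixFormula : (matrixFormula c α u x y z t s ζ ξ e w v).IsQF := by
  have h1 := fun a b : V => isQF_eqFormula a b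
  have h2 := fun v x z => isQF_traceFormula (α := V) c v x z
  have h3 := fun v p => isQF_squaringFormula (α := V) α v p
  have h4 := fun R (a b d : V) => isQF_relFormula R a b d
  exact (isQF_twoFormula _).inf <| (h2 _ _ _).inf <| (h1 _ _).inf <| (h3 _ _).inf <|
    (h2 _ _ _).inf <| ((isQF_oneOf fun _ => (h1 _ _).inf (h1 _ _)).imp (h1 _ _)).inf <|
    ((isQF_oneOf fun _ => (h1 _ _).inf (h1 _ _)).imp (h1 _ _)).inf <|
    (h4 _ _ _ _).inf <| (h4 _ _ _ _).inf <|
    (((h4 _ _ _ _).inf (h4 _ _ _ _)).imp (h1 _ _)).inf <|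
    (((h4 _ _ _ _).inf (h4 _ _ _ _)).imp (h1 _ _)).inf <|
    (h3 _ _).inf <| (h2 _ _ _).inf <| (h2 _ _ _).inf <| (h2 _ _ _).inf <| (h2 _ _ _).inf <|
    (((isQF_oneOf fun _ => h1 _ _).inf (h1 _ _).not).sup (h1 _ _))

theorem formulaSize_matrixFormula_le :
    formulaSize (matrixFormula c α u x y z t s ζ ξ e w v) ≤
      300 + 54 * c.length + 20 * α + 34 * m := by
  have h1 := fun a b : V => formulaSize_eqFormula a b
  have h2 := fun v x z => formulaSize_traceFormula_le (α := V) c v x z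
  have h3 := fun v p => formulaSize_squaringFormula_le (α := V) α v p
  have h4 := fun R (a b d : V) => formulaSize_relFormula R a b d
  have h5 : ∀ f g h k : Fin m → V,
      formulaSize (oneOf fun i => eqFormula (f i) (g i) ⊓ eqFormula (h i) (k i)) ≤ 1 + m * 14 :=
    fun f g h k => formulaSize_oneOf_le fun i => by rw [formulaSize_inf, h1, h1]
  have h6 : ∀ f g : Fin m → V, formulaSize (oneOf fun i => eqFormula (f i) (g i)) ≤ 1 + m * 6 :=
    fun f g => formulaSize_oneOf_le fun i => by rw [h1]
  simp only [matrixFormula, formulaSize_inf, formulaSize_sup, formulaSize, h1, h4,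
    formulaSize_twoFormula]
  have := h2 (v 0) x z
  have := h2 (v 1) (fun i => w 0 ((n + 2) * i)) z
  have := h2 (v 2) (fun i => w 1 ((n + 2) * i)) (ζ 0)
  have := h2 (v 3) (fun i => w 1 ((n + 2) * i)) (ζ 1)
  have := h2 (v 4) ξ (ζ 0)
  have := h2 (v 5) ξ (ζ 1)
  have := h3 (w 0) (s 0)
  have := h3 (w 1) (e 2)
  have := h5 (fun _ => s 0) (fun k => t k) (fun _ => s 1) u
  have := h5 (fun _ => s 0) (fun k => t k) (fun _ => s 2) (fun k => t (k + 1))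
  have := h6 (fun _ => e 2) (fun k => t k)
  omega

variable {c}

theorem holds_matrixFormula (hc : c.WellFormed) {D : Database} {W : V → ℂ} :
    Holds D (matrixFormula c α u x y z t s ζ ξ e w v) W ↔
      PrenexMatrix c D α (fun k => W (u k)) (fun i => W (x i)) (W y) (fun i => W (z i))
        (fun i => W (t i)) (fun i => W (s i)) (fun i j => W (ζ i j)) (fun i => W (ξ i))
        (fun i => W (e i)) (fun i j => W (w i j)) (fun i j => W (v i j)) := by
  simp only [matrixFormula, holds_inf, holds_sup, holds_imp, holds_not, holds_oneOf,
    holds_eqFormula, holds_twoFormula, holds_relFormula_S, holds_relFormula_P,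
    holds_traceFormula hc, holds_squaringFormula]
  constructor
  · rintro ⟨h1, h2, h3, h4, h5, h6, h7, h8, h9, h10, h11, h12, h13, h14, h15, h16, h17⟩
    exact ⟨h1, h2, h3, h4, h5, h6, h7, h8, h9, h10, h11, h12, h13, h14, h15, h16, h17⟩
  · rintro ⟨h1, h2, h3, h4, h5, h6, h7, h8, h9, h10, h11, h12, h13, h14, h15, h16, h17⟩
    exact ⟨h1, h2, h3, h4, h5, h6, h7, h8, h9, h10, h11, h12, h13, h14, h15, h16, h17⟩

end MatrixFormula

section PhiFormula

variable {n r : ℕ} (m : ℕ) (c : Circuit (Fin n) (Fin r)) (α : ℕ)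

/-- A prenex formula for `Phi`, for identification sequences of iterated powers of two. -/
def phiFormula : queryLang.Formula (QueryVar m n) :=
  ((Formula.iExs (α := (QueryVar m n ⊕ (Fin r ⊕ Fin (m + 1))) ⊕ (Fin 7 ⊕ ((Fin 2 × Fin r) ⊕ Fin n)))
    (Fin 3 ⊕ ((Fin 2 × Fin (α + 1)) ⊕ (Fin 6 × Fin (c.length + 1)))) <|
    matrixFormula c α (fun k => Sum.inl (Sum.inl (Sum.inl (Sum.inl k))))
      (fun i => Sum.inl (Sum.inl (Sum.inl (Sum.inr (Sum.inl i)))))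
      (Sum.inl (Sum.inl (Sum.inl (Sum.inr (Sum.inr ())))))
      (fun i => Sum.inl (Sum.inl (Sum.inr (Sum.inl i))))
      (periodic fun k => Sum.inl (Sum.inl (Sum.inr (Sum.inr k))))
      (fun i => Sum.inl (Sum.inr (Sum.inl i)))
      (fun i j => Sum.inl (Sum.inr (Sum.inr (Sum.inl (i, j)))))
      (fun i => Sum.inl (Sum.inr (Sum.inr (Sum.inr i))))
      (fun i => Sum.inr (Sum.inl i))
      (fun i => periodic fun j => Sum.inr (Sum.inr (Sum.inl (i, j))))
      (fun i => periodic fun j => Sum.inr (Sum.inr (Sum.inr (i, j))))).iAlls _).iExs _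

theorem hasAlternationsLE_phiFormula : HasAlternationsLE 2 (phiFormula m c α) :=
  ⟨false, PrenexAlt.iExs <| PrenexAlt.alternate (q := true) <| PrenexAlt.iAlls <|
    PrenexAlt.alternate (q := false) <| PrenexAlt.iExs <| .of_isQF _ <|
    isQF_matrixFormula _ _ _ _ _ _ _ _ _ _ _ _ _⟩

/-- The bound is linear in α and m separately: quantifying universally over the points lets all of
them share two squaring sequences, where separate sequences would cost about m·α. -/
theorem formulaSize_phiFormula_le :
    formulaSize (phiFormula m c α) ≤ 400 + 84 * c.length + 30 * α + 39 * m + 7 * r + n := by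
  rw [phiFormula, formulaSize_iExs, formulaSize_iAlls, formulaSize_iExs]
  simp only [Nat.card_sum, Nat.card_prod, Nat.card_fin]
  have := formulaSize_matrixFormula_le c α
    (V := ((QueryVar m n ⊕ (Fin r ⊕ Fin (m + 1))) ⊕ (Fin 7 ⊕ ((Fin 2 × Fin r) ⊕ Fin n))) ⊕
      (Fin 3 ⊕ ((Fin 2 × Fin (α + 1)) ⊕ (Fin 6 × Fin (c.length + 1)))))
    (fun k => Sum.inl (Sum.inl (Sum.inl (Sum.inl k))))
    (fun i => Sum.inl (Sum.inl (Sum.inl (Sum.inr (Sum.inl i)))))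
    (Sum.inl (Sum.inl (Sum.inl (Sum.inr (Sum.inr ())))))
    (fun i => Sum.inl (Sum.inl (Sum.inr (Sum.inl i))))
    (periodic fun k => Sum.inl (Sum.inl (Sum.inr (Sum.inr k))))
    (fun i => Sum.inl (Sum.inr (Sum.inl i)))
    (fun i j => Sum.inl (Sum.inr (Sum.inr (Sum.inl (i, j)))))
    (fun i => Sum.inl (Sum.inr (Sum.inr (Sum.inr i))))
    (fun i => Sum.inr (Sum.inl i))
    (fun i => periodic fun j => Sum.inr (Sum.inr (Sum.inl (i, j))))
    (fun i => periodic fun j => Sum.inr (Sum.inr (Sum.inr (i, j))))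
  omega

variable {c α}

theorem expressesPhi_phiFormula (hc : c.WellFormed) (hsub : ∀ a b, Gate.sub a b ∉ c) (hne : c ≠ [])
    (hα : (n + 2) * n ≤ α) :
    ExpressesPhi c (powerPoint m n (2 ^ (n + 2)) (2 ^ α)) (phiFormula m c α) := by
  intro D u x y
  rw [phiFormula, holds_iExs]
  simp only [holds_iAlls, holds_iExs, holds_matrixFormula _ _ _ _ _ _ _ _ _ _ _ _ hc]
  constructor
  · rintro ⟨b1, h⟩
    refine phi_of_prenexMatrix hc hsub hne hα (z := fun i => b1 (Sum.inl i))
      (t := fun i => b1 (Sum.inr (Fin.ofNat _ i))) fun s ζ ξ => ?_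
    obtain ⟨b3, h⟩ := h (Sum.elim s (Sum.elim (fun i => ζ i.1 i.2) ξ))
    exact ⟨_, _, _, h⟩
  · intro h
    obtain ⟨z, t, h⟩ := prenexMatrix_of_phi hc hsub hne hα h
    refine ⟨Sum.elim z t, fun b2 => ?_⟩
    obtain ⟨e, w, v, h⟩ := h (fun i => b2 (Sum.inl i)) (fun i j => b2 (Sum.inr (Sum.inl (i, j))))
      (fun i => b2 (Sum.inr (Sum.inr i)))
    exact ⟨Sum.elim e (Sum.elim (fun i => w i.1 i.2) (fun i => v i.1 i.2)), h⟩

end PhiFormula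

/-! ### Quadratic formulas and superpolynomial time -/

/-- The formulas for `Phi` can be chosen prenex, of quadratic length and with two quantifier
alternations. -/
theorem exists_short_formula {n : ℕ} (hn : 1 ≤ n) :
    ∃ (c : Circuit (Fin n) (Fin (numGenericScalars n n)))
      (γ : Fin (numPoints n n) → Fin n → ℚ)
      (φ : queryLang.Formula (QueryVar (numPoints n n) n)),
      IsGenericCircuit n n c ∧ c.length ≤ 7000 * n ^ 2 ∧
      IsIdentificationSeq (polyClosure (lowComplexity n n)) γ ∧
      ExpressesPhi c γ φ ∧ HasAlternationsLE 2 φ ∧ formulaSize φ ≤ 7000 * n ^ 2 := by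
  obtain ⟨c, hgen, hc, hsub, hne, hlen⟩ := exists_genericCircuit n
  have hn2 : n ≤ n ^ 2 := Nat.le_self_pow two_ne_zero n
  have h1 := formulaSize_phiFormula_le (numPoints n n) c (growthExponent n)
  have hm : numPoints n n = 16 * n ^ 2 + 2 := by rw [numPoints]; ring
  have hr : numGenericScalars n n = 4 * n ^ 2 + 4 * n + 1 := by rw [numGenericScalars]; ring
  have hα : growthExponent n = 95 * n ^ 2 := rfl
  have hα' : (n + 2) * n ≤ growthExponent n := by
    rw [hα, show (n + 2) * n = n ^ 2 + 2 * n by ring]; omega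
  refine ⟨c, _, phiFormula (numPoints n n) c (growthExponent n), hgen, by omega,
    isIdentificationSeq_growthExponent hn, expressesPhi_phiFormula _ hc hsub hne hα',
    hasAlternationsLE_phiFormula _ _ _, by omega⟩

open Filter in
theorem exists_eval_lt_two_pow (p : Polynomial ℕ) :
    ∃ n : ℕ, 1 ≤ n ∧ p.eval (7020 * n ^ 2) < 2 ^ n := by
  have hq : ∀ q : Polynomial ℕ, ∀ᶠ n : ℕ in atTop, q.eval n < 2 ^ n := by
    intro q
    have h : Tendsto (fun n : ℕ => ∑ i ∈ q.support, (q.coeff i : ℝ) * ((n : ℝ) ^ i / 2 ^ n))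
        atTop (nhds (∑ i ∈ q.support, (q.coeff i : ℝ) * 0)) :=
      tendsto_finsetSum _ fun i _ =>
        (tendsto_pow_const_div_const_pow_of_one_lt i one_lt_two).const_mul _
    simp only [mul_zero, Finset.sum_const_zero] at h
    filter_upwards [h.eventually_lt_const one_pos] with n hn
    simp only [mul_div_assoc', ← Finset.sum_div] at hn
    rw [div_lt_one (by positivity)] at hn
    rw [Polynomial.eval_eq_sum, Polynomial.sum]
    exact_mod_cast hn
  obtain ⟨n, h1, h2⟩ := ((eventually_ge_atTop 1).and
    (hq (p.comp (Polynomial.C 7020 * Polynomial.X ^ 2)))).exists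
  exact ⟨n, h1, by simpa using h2⟩

/-- Branching-parsimonious procedures do not run in polynomial time. -/
theorem not_polynomial_time {Q : Procedure}
    (hQ : Q.IsBranchingParsimonious (boundedAlternationInputs 2)) (p : Polynomial ℕ) :
    ∃ I ∈ boundedAlternationInputs 2, I.AdmitsBranchingFree ∧
      ∃ (β : Circuit (Fin I.n) I.K) (t : ℕ), Q.OutputsInTime I β t ∧ p.eval I.size < t := by
  obtain ⟨n, hn, hp⟩ := exists_eval_lt_two_pow p
  obtain ⟨c, γ, φ, hc, -, hγ, hφ, halt, hsize⟩ := exists_short_formula hn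
  obtain ⟨hadm, h⟩ := branchingFree_lower_bound n c γ φ hc hγ hφ
  have hI : (⟨numPoints n n, n, Database.arithmetic, φ⟩ : QueryInput) ∈
    boundedAlternationInputs 2 := ⟨rfl, halt⟩
  obtain ⟨β, t, ht, -, -, htn⟩ := h Q _ hQ hI
  refine ⟨_, hI, hadm, β, t, ht, lt_of_le_of_lt ?_ (hp.trans_le htn)⟩
  have hn2 : n ≤ n ^ 2 := Nat.le_self_pow two_ne_zero n
  have hm : numPoints n n = 16 * n ^ 2 + 2 := by rw [numPoints]; ring
  -- The formula contributes 7000n², and the 16n² + n + 3 free variables are at most 20n².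
  have hs : QueryInput.size ⟨numPoints n n, n, Database.arithmetic, φ⟩ ≤ 7020 * n ^ 2 := by
    change formulaSize φ + (numPoints n n + n + 1) ≤ _
    omega
  rw [Polynomial.eval_eq_sum, Polynomial.eval_eq_sum]
  exact Finset.sum_le_sum fun i _ => Nat.mul_le_mul_left _ (Nat.pow_le_pow_left hs i)

end

end

theorem theorem1 :
    -- the formulas of quadratic size, with a fixed number of quantifier alternations
    (∃ C a : ℕ, ∀ n : ℕ, 1 ≤ n →
      ∃ (c : Circuit (Fin n) (Fin (numGenericScalars n n)))
        (γ : Fin (numPoints n n) → Fin n → ℚ)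
        (φ : queryLang.Formula (QueryVar (numPoints n n) n)),
        IsGenericCircuit n n c ∧ c.length ≤ C * n ^ 2 ∧
        IsIdentificationSeq (polyClosure (lowComplexity n n)) γ ∧
        ExpressesPhi c γ φ ∧ HasAlternationsLE a φ ∧ formulaSize φ ≤ C * n ^ 2) ∧
    -- the lower bounds, for every choice of the circuit, the sequence and the formula
    (∀ (n : ℕ) (c : Circuit (Fin n) (Fin (numGenericScalars n n)))
      (γ : Fin (numPoints n n) → Fin n → ℚ)
      (φ : queryLang.Formula (QueryVar (numPoints n n) n)),
      IsGenericCircuit n n c →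
      IsIdentificationSeq (polyClosure (lowComplexity n n)) γ →
      ExpressesPhi c γ φ →
      QueryInput.AdmitsBranchingFree ⟨numPoints n n, n, Database.arithmetic, φ⟩ ∧
      ∀ (Q : Procedure) (𝓘 : Set QueryInput), Q.IsBranchingParsimonious 𝓘 →
        (⟨numPoints n n, n, Database.arithmetic, φ⟩ : QueryInput) ∈ 𝓘 →
        ∃ (β : Circuit (Fin n) (QueryInput.K ⟨numPoints n n, n, Database.arithmetic, φ⟩)) (t : ℕ),
          Q.OutputsInTime ⟨numPoints n n, n, Database.arithmetic, φ⟩ β t ∧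
          QueryInput.IsBranchingFreeRep ⟨numPoints n n, n, Database.arithmetic, φ⟩ β ∧
          2 ^ n ≤ β.numScalars ∧ 2 ^ n ≤ t) ∧
    -- no polynomial time for formulas with a fixed number of quantifier alternations
    (∃ a : ℕ, ∀ Q : Procedure, Q.IsBranchingParsimonious (boundedAlternationInputs a) →
      ∀ p : Polynomial ℕ, ∃ I ∈ boundedAlternationInputs a, I.AdmitsBranchingFree ∧
        ∃ (β : Circuit (Fin I.n) I.K) (t : ℕ), Q.OutputsInTime I β t ∧ p.eval I.size < t) := by
  exact ⟨⟨7000, 2, fun _ hn => exists_short_formula hn⟩, branchingFree_lower_bound,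
    2, fun _ hQ p => not_polynomial_time hQ p⟩
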